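/- Conventions. $\langle f,g\rangle=\int_{\mathbb R} f\overline g\,dx$ on $L^2(\mathbb R)$; $\mathbb C_\pm=\{\mu\in\mathbb C:\pm\operatorname{Im}\mu>0\}$; $H_2^+$ is the Hardy space of functions $\phi\in L^2(\mathbb R)$ that are the ($L^2$) boundary values of a holomorphic function on $\mathbb C_+$, also denoted $\phi$, whose $L^2$ norms on the lines $\operatorname{Im}=y$, $y>0$, are bounded. For $\phi\in H_2^+$ put $\overline\phi(\mu):=\overline{\phi(\overline\mu)}$ for $\mu\in\mathbb C_-$. The Friedrichs model. Let $\phi,\psi\in L^2(\mathbb R)$, and let $\widetilde A f=xf+\langle f,\psi\rangle\phi$ on the set of $f\in L^2(\mathbb R)$ with $xf\in L^2(\mathbb R)$ and $\lim_{R\to\infty}\int_{-R}^R f\,dx=0$. For each $u$ in the domain of the adjoint $\widetilde A^*$ there is a unique $c_u\in\mathbb C$ with $xu-c_u\in L^2(\mathbb R)$; put $\Gamma_1u=\lim_{R\to\infty}\int_{-R}^Ru\,dx$ and $\Gamma_2u=c_u$. For $B\in\mathbb C$ let $A_B$ be the restriction of $\widetilde A^*$ to $\ker(\Gamma_1-B\Gamma_2)$,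 and for $\mu_0\in\rho(A_B)$ let $S_{\mu_0,B}$ be the inverse of the restriction of $\Gamma_1-B\Gamma_2$ to $\ker(\widetilde A^*-\mu_0)$. Let $$\mathcal S=\operatorname{Span}_{\delta\in\rho(A_B)}(A_B-\delta)^{-1}\operatorname{Ran}(S_{\mu_0,B}),\qquad \operatorname{def}(\mathcal S)=\dim\mathcal S^\perp ,$$ and $$D(\mu)=1+\int_{\mathbb R}\frac{\psi(x)\overline{\phi(x)}}{x-\mu}\,dx,\qquad \mu\in\mathbb C\setminus\mathbb R .$$ **Theorem 8.10.** Let $\phi,\psi\in H_2^+$, let $B\in\mathbb C\setminus\{\pi i,-\pi i\}$ and $\mu_0\in\rho(A_B)$. Then $\overline{\mathcal S}$ is the closed linear span of the functions $$\frac1{x-\mu}\quad(\mu\in\mathbb C_+)\qquad\text{and}\qquad \frac{D(\mu)+2\pi i\,\overline\phi(\mu)\,\psi(x)}{x-\mu}\quad(\mu\in\mathbb C_-).$$ Moreover, suppose that $$\psi(x)=\sum_{j=1}^N\frac{c_j}{x-z_j}$$ with $c_j\ne0$, $\operatorname{Im}z_j<0$ and the $z_j$ pairwise distinct, and put $$D_+(\mu)=1+2\pi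 i\sum_{j=1}^N\frac{c_j\,\overline\phi(z_j)}{\mu-z_j},\qquad\mu\in\mathbb C .$$ Then $D_+$ is meromorphic on $\mathbb C$ and coincides with $D$ on $\mathbb C_+$. Suppose further that for every $j$ with $\overline\phi(z_j)=0$ the limit $$\ell_j=\lim_{\mu\to z_j}\frac{2\pi i\,\overline\phi(\mu)\,c_j}{D_+(\mu)(\mu-z_j)}$$ exists in $\mathbb C$. Then $\mathcal S^\perp$ is finite-dimensional and $$\operatorname{def}(\mathcal S)=N-P-M-M_0 ,$$ where * $P$ is the sum of the orders of the poles of $\overline\phi(\mu)/D_+(\mu)$ in $\mathbb C_-\setminus\{z_1,\dots,z_N\}$; * $M=\sum_{t\in\mathbb R}m(t)$, where $m(t)$ is the least integer $m\ge0$ such that $(x-t)^m\,\overline{\phi(x)}/D_+(x)$ is square integrable on a neighbourhood of $t$ in $\mathbb R$ (only finitely many $m(t)$ are nonzero); * $M_0$ is the number of $j$ with $\overline\phi(z_j)=0$ and $\ell_j\ne1$. -/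

import Mathlib

open MeasureTheory Filter Topology
open scoped ENNReal ComplexConjugate InnerProductSpace LinearPMap

noncomputable section

namespace Friedrichs

/-- The Hilbert space `L²(ℝ)` of complex valued functions. In terms of Mathlib's inner product,
which is conjugate linear in its first argument, `⟨f, g⟩ = ∫ f(x) conj(g(x)) dx` is `inner ℂ g f`. -/
abbrev L2R : Type := Lp ℂ 2 (volume : Measure ℝ)

/-- `Γ₁ u = a`: the symmetric improper integral of `u` exists and equals `a`. -/
def HasGammaOne (u : L2R) (a : ℂ) : Prop :=
  Tendsto (fun R : ℝ => ∫ x in (-R)..R, u x) atTop (𝓝 a)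

/-- `Γ₂ u = c`: the number `c = c_u` is such that `x u(x) - c` is square integrable.
There is at most one such `c`, because nonzero constants are not square integrable. -/
def HasGammaTwo (u : L2R) (c : ℂ) : Prop :=
  MemLp (fun x : ℝ => (x : ℂ) * u x - c) 2 volume

theorem intervalIntegrable_coe (u : L2R) (a b : ℝ) :
    IntervalIntegrable (fun x => u x) volume a b :=
  intervalIntegrable_iff.2 ((((Lp.memLp u).locallyIntegrable (by norm_num)).integrableOn_isCompact
    isCompact_uIcc).mono_set Set.uIoc_subset_uIcc)

theorem HasGammaOne.add {u v : L2R} {a b : ℂ} (hu : HasGammaOne u a) (hv : HasGammaOne v b) :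
    HasGammaOne (u + v) (a + b) := by
  refine (Tendsto.add hu hv).congr fun R => ?_
  rw [← intervalIntegral.integral_add (intervalIntegrable_coe u _ _)
    (intervalIntegrable_coe v _ _)]
  refine intervalIntegral.integral_congr_ae ?_
  filter_upwards [Lp.coeFn_add u v] with x hx _
  rw [hx, Pi.add_apply]

theorem HasGammaOne.smul {u : L2R} {a : ℂ} (k : ℂ) (hu : HasGammaOne u a) :
    HasGammaOne (k • u) (k * a) := by
  refine (Tendsto.const_mul k hu).congr fun R => ?_
  rw [← intervalIntegral.integral_const_mul]
  refine intervalIntegral.integral_congr_ae ?_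
  filter_upwards [Lp.coeFn_smul k u] with x hx _
  rw [hx, Pi.smul_apply, smul_eq_mul]

theorem hasGammaOne_zero : HasGammaOne 0 0 := by
  refine tendsto_const_nhds.congr fun R => ?_
  rw [intervalIntegral.integral_congr_ae (g := fun _ => (0 : ℂ))]
  · simp
  · filter_upwards [Lp.coeFn_zero ℂ 2 (volume : Measure ℝ)] with x hx _
    rw [hx, Pi.zero_apply]

theorem HasGammaTwo.add {u v : L2R} {a b : ℂ} (hu : HasGammaTwo u a) (hv : HasGammaTwo v b) :
    HasGammaTwo (u + v) (a + b) := by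
  refine (MemLp.add hu hv).ae_eq ?_
  filter_upwards [Lp.coeFn_add u v] with x hx
  simp only [hx, Pi.add_apply]
  ring

theorem HasGammaTwo.smul {u : L2R} {a : ℂ} (k : ℂ) (hu : HasGammaTwo u a) :
    HasGammaTwo (k • u) (k * a) := by
  refine (MemLp.const_smul hu k).ae_eq ?_
  filter_upwards [Lp.coeFn_smul k u] with x hx
  simp only [hx, Pi.smul_apply, smul_eq_mul]
  ring

theorem hasGammaTwo_zero : HasGammaTwo 0 0 := by
  refine (MemLp.zero (ε := ℂ) (p := 2) (μ := (volume : Measure ℝ))).ae_eq ?_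
  filter_upwards [Lp.coeFn_zero ℂ 2 (volume : Measure ℝ)] with x hx
  simp only [hx, Pi.zero_apply, mul_zero, sub_zero]

/-- The domain of the minimal operators: `f ∈ L²` with `x f(x) ∈ L²` and
`lim_{R → ∞} ∫_{-R}^R f(x) dx = 0`. -/
def minDomain : Submodule ℂ L2R where
  carrier := {f | HasGammaTwo f 0 ∧ HasGammaOne f 0}
  add_mem' := fun hf hg => ⟨by simpa using hf.1.add hg.1, by simpa using hf.2.add hg.2⟩
  zero_mem' := ⟨hasGammaTwo_zero, hasGammaOne_zero⟩
  smul_mem' := fun k f hf => ⟨by simpa using hf.1.smul k, by simpa using hf.2.smul k⟩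

theorem minDomain_memLp (f : minDomain) :
    MemLp (fun x : ℝ => (x : ℂ) * (f : L2R) x) 2 volume := by
  simpa [HasGammaTwo] using f.2.1

/-- The Friedrichs model operator `(A f)(x) = x f(x) + ⟨f, φ⟩ ψ(x)` on `minDomain`.
The operator `Ã` is the one with the roles of `φ` and `ψ` exchanged, that is `minOp ψ φ`. -/
def minOp (φ ψ : L2R) : L2R →ₗ.[ℂ] L2R where
  domain := minDomain
  toFun :=
    { toFun := fun f => (minDomain_memLp f).toLp _ + inner ℂ φ (f : L2R) • ψ
      map_add' := by
        intro f g
        have h : (minDomain_memLp (f + g)).toLp _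
            = (minDomain_memLp f).toLp _ + (minDomain_memLp g).toLp _ := by
          rw [← MemLp.toLp_add]
          refine MemLp.toLp_congr _ _ ?_
          filter_upwards [Lp.coeFn_add (f : L2R) (g : L2R)] with x hx
          rw [Submodule.coe_add, hx, Pi.add_apply, Pi.add_apply, mul_add]
        rw [h, Submodule.coe_add, inner_add_right, add_smul]
        abel
      map_smul' := by
        intro k f
        have h : (minDomain_memLp (k • f)).toLp _ = k • (minDomain_memLp f).toLp _ := by
          rw [← MemLp.toLp_const_smul]
          refine MemLp.toLp_congr _ _ ?_
          filter_upwards [Lp.coeFn_smul k (f : L2R)] with x hx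
          rw [Submodule.coe_smul, hx, Pi.smul_apply, Pi.smul_apply, smul_eq_mul, smul_eq_mul,
            mul_left_comm]
        rw [h, Submodule.coe_smul, inner_smul_right, mul_smul, RingHom.id_apply, smul_add] }

/-- The maximal operator `Ã*`, the Hilbert space adjoint of `Ã`. -/
def maxOp (φ ψ : L2R) : L2R →ₗ.[ℂ] L2R := (minOp ψ φ)†

/-- The boundary condition `Γ₁ u = B Γ₂ u`. -/
def boundaryCondition (B : ℂ) : Submodule ℂ L2R where
  carrier := {u | ∃ c, HasGammaTwo u c ∧ HasGammaOne u (B * c)}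
  add_mem' := by
    rintro u v ⟨c, hc, hc'⟩ ⟨d, hd, hd'⟩
    exact ⟨c + d, hc.add hd, by simpa [mul_add] using hc'.add hd'⟩
  zero_mem' := ⟨0, hasGammaTwo_zero, by simpa using hasGammaOne_zero⟩
  smul_mem' := by
    rintro k u ⟨c, hc, hc'⟩
    exact ⟨k * c, hc.smul k, by simpa [mul_left_comm] using hc'.smul k⟩

/-- The operator `A_B`, the restriction of `Ã*` to `ker (Γ₁ - B Γ₂)`. -/
def opB (φ ψ : L2R) (B : ℂ) : L2R →ₗ.[ℂ] L2R :=
  (maxOp φ ψ).domRestrict (boundaryCondition B)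

/-- The resolvent set of an unbounded operator `T`: the `lam` for which `T - lam` is a bijection
from the domain of `T` onto the space with a bounded inverse `R`. -/
def resolventSet (T : L2R →ₗ.[ℂ] L2R) : Set ℂ :=
  {lam | ∃ R : L2R →L[ℂ] L2R,
    (∀ u : T.domain, R (T u - lam • (u : L2R)) = u) ∧
    ∀ w : L2R, ∃ u : T.domain, (u : L2R) = R w ∧ T u - lam • (u : L2R) = w}

/-- The range of the solution operator `S_{lam,B}`: all `u ∈ ker (Ã* - lam)` for which
`(Γ₁ - B Γ₂) u = f` for some complex number `f`. -/
def solutionRange (φ ψ : L2R) (B lam : ℂ) : Set L2R :=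
  {u | ∃ v : (maxOp φ ψ).domain, (v : L2R) = u ∧ maxOp φ ψ v = lam • u ∧
    ∃ f c : ℂ, HasGammaTwo u c ∧ HasGammaOne u (f + B * c)}

/-- The space `S_B`, the linear span of `(A_B - δ)⁻¹ Ran(S_{μ₀,B})` over all `δ` in the resolvent
set of `A_B`. The detectable subspace is its closure. -/
def detectable (φ ψ : L2R) (B μ₀ : ℂ) : Submodule ℂ L2R :=
  Submodule.span ℂ {v | ∃ δ ∈ resolventSet (opB φ ψ B), ∃ w : (opB φ ψ B).domain,
    (w : L2R) = v ∧ opB φ ψ B w - δ • v ∈ solutionRange φ ψ B μ₀}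

/-- `φ ∈ H₂⁺`, with `Φ` the corresponding function in the Hardy space of the upper half-plane:
`Φ` is holomorphic there, its `L²` norms on horizontal lines are bounded, and `φ` is its boundary
value on the real line (in the `L²` sense). -/
def IsHardyExtension (Φ : ℂ → ℂ) (φ : L2R) : Prop :=
  DifferentiableOn ℂ Φ {w | 0 < w.im} ∧
  (∃ C : ℝ≥0∞, C ≠ ∞ ∧
    ∀ y : ℝ, 0 < y → eLpNorm (fun x : ℝ => Φ (x + y * Complex.I)) 2 volume ≤ C) ∧
  Tendsto (fun y : ℝ => eLpNorm (fun x : ℝ => Φ (x + y * Complex.I) - φ x) 2 volume)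
    (𝓝[>] 0) (𝓝 0)

/-- The Hardy space `H₂⁺` of the upper half-plane, as a set of boundary functions. -/
def HardyPlus : Set L2R := {φ | ∃ Φ : ℂ → ℂ, IsHardyExtension Φ φ}

/-- The function `μ ↦ conj (Φ (conj μ))` on the lower half-plane; if `Φ` belongs to `φ ∈ H₂⁺`, this
is the extension of the conjugate of `φ` to the lower half-plane. -/
def lowerExt (Φ : ℂ → ℂ) (μ : ℂ) : ℂ := conj (Φ (conj μ))

/-- `D(μ) = 1 + ∫ ψ(x) conj(φ(x)) / (x - μ) dx` for nonreal `μ`. -/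
def funD (φ ψ : L2R) (μ : ℂ) : ℂ := 1 + ∫ x : ℝ, ψ x * conj (φ x) / ((x : ℂ) - μ)

/-- The rational function `D₊(μ) = 1 + 2πi ∑ⱼ cⱼ a(zⱼ) / (μ - zⱼ)`, where `a` is the
extension of the conjugate of `φ` to the lower half-plane. -/
def funDPlus (Φ : ℂ → ℂ) {N : ℕ} (c z : Fin N → ℂ) (μ : ℂ) : ℂ :=
  1 + 2 * Real.pi * Complex.I * ∑ j, c j * lowerExt Φ (z j) / (μ - z j)

/-- The order of the pole of `f` at `μ` (zero if there is no pole). -/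
def poleOrder (f : ℂ → ℂ) (μ : ℂ) : ℕ := (-(meromorphicOrderAt f μ).untop₀).toNat

/-- The number `P`: the sum of the orders of the poles of the quotient of the extension of the
conjugate of `φ` by `D₊` in the open lower half-plane without the points `zⱼ`. -/
def numP (Φ : ℂ → ℂ) {N : ℕ} (c z : Fin N → ℂ) : ℕ :=
  ∑ᶠ μ ∈ {w : ℂ | w.im < 0 ∧ ∀ j, w ≠ z j},
    poleOrder (fun w => lowerExt Φ w / funDPlus Φ c z w) μ

/-- The order of the real "pole" at `t` of the quotient of the conjugate of `φ` by `D₊`: the least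
`m ∈ ℕ` such that `(x - t)^m conj(φ(x)) / D₊(x)` is square integrable near `t`. -/
def realPoleOrder (φ : L2R) (Φ : ℂ → ℂ) {N : ℕ} (c z : Fin N → ℂ) (t : ℝ) : ℕ :=
  sInf {m : ℕ | ∃ ε > 0, MemLp
    (fun x : ℝ => conj (φ x) / funDPlus Φ c z (x : ℂ) * ((x : ℂ) - t) ^ m) 2
    (volume.restrict (Set.Ioo (t - ε) (t + ε)))}

/-- The number `M`: the sum of the orders of the real poles. -/
def numM (φ : L2R) (Φ : ℂ → ℂ) {N : ℕ} (c z : Fin N → ℂ) : ℕ :=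
  ∑ᶠ t : ℝ, realPoleOrder φ Φ c z t

/-- The function `μ ↦ 2πi a(μ) cⱼ / (D₊(μ) (μ - zⱼ))`, with `a` as above. -/
def degenerateQuotient (Φ : ℂ → ℂ) {N : ℕ} (c z : Fin N → ℂ) (j : Fin N) (μ : ℂ) : ℂ :=
  2 * Real.pi * Complex.I * lowerExt Φ μ * c j / (funDPlus Φ c z μ * (μ - z j))

/-- The number `M₀` of those `j` for which the conjugate of `φ` vanishes at `zⱼ` and
`degenerateQuotient` does not have the limit `1` at `zⱼ`. -/
def numMZero (Φ : ℂ → ℂ) {N : ℕ} (c z : Fin N → ℂ) : ℕ :=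
  Nat.card {j : Fin N // lowerExt Φ (z j) = 0 ∧
    ¬ Tendsto (degenerateQuotient Φ c z j) (𝓝[≠] (z j)) (𝓝 1)}

section Adjoint

open Set

theorem ae_const_of_orthogonal (h : ℝ → ℂ)
    (hloc : ∀ n : ℝ, MemLp h 2 (volume.restrict (Ioc (-n) n)))
    (H : ∀ (n : ℝ) (f : minDomain), (∀ᵐ x, x ∉ Ioc (-n) n → (f : L2R) x = 0) →
      ∫ x, h x * conj ((f : L2R) x) = 0) : ∃ c : ℂ, h =ᵐ[volume] fun _ => c := by
  have key : ∀ n : ℝ, 0 < n → ∃ c : ℂ, ∀ᵐ x ∂(volume.restrict (Ioc (-n) n)), h x = c := by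
    intro n hn
    set I := Ioc (-n) n with hI
    have hIm : MeasurableSet I := measurableSet_Ioc
    have hint : IntegrableOn h I := (hloc n).integrable (by norm_num)
    set m : ℂ := (2 * n : ℂ)⁻¹ * ∫ x in I, h x with hm
    have hvol : volume.real I = 2 * n := by
      simp [hI, Measure.real, Real.volume_Ioc]; rw [ENNReal.toReal_ofReal] <;> linarith
    set k : ℝ → ℂ := I.indicator (fun x => h x - m) with hk
    have hg : MemLp (fun x => h x - m) 2 (volume.restrict I) := (hloc n).sub (memLp_const m)
    have hkL : MemLp k 2 volume := (memLp_indicator_iff_restrict hIm).2 hg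
    have hzero : ∫ x in I, (h x - m) = 0 := by
      rw [integral_sub hint (integrable_const m)]
      simp only [integral_const, measureReal_restrict_apply_univ, hvol, hm]
      have : (n : ℂ) ≠ 0 := by exact_mod_cast hn.ne'
      rw [Complex.real_smul]; push_cast; field_simp; ring
    have hkdom : hkL.toLp k ∈ minDomain := by
      constructor
      · have h1 : MemLp (fun x : ℝ => (x : ℂ) * k x) 2 volume := by
          refine MemLp.of_le_mul (c := n) hkL
            (Complex.continuous_ofReal.aestronglyMeasurable.mul hkL.1) ?_
          refine Eventually.of_forall fun x => ?_
          by_cases hx : x ∈ I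
          · rw [norm_mul, Complex.norm_real]
            gcongr
            exact abs_le.2 ⟨hx.1.le, hx.2⟩
          · simp [hk, hx]
        refine h1.ae_eq ?_
        filter_upwards [hkL.coeFn_toLp] with x hx
        rw [hx, sub_zero]
      · refine tendsto_const_nhds.congr' ?_
        filter_upwards [eventually_ge_atTop n] with R hR
        rw [intervalIntegral.integral_of_le (by linarith),
          setIntegral_congr_ae (g := k) measurableSet_Ioc
            (by filter_upwards [hkL.coeFn_toLp] with x hx _ using hx), hk,
          setIntegral_indicator hIm, inter_eq_right.2, hzero]
        exact Ioc_subset_Ioc (by linarith) hR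
    have h0 := H n ⟨_, hkdom⟩ (by
      filter_upwards [hkL.coeFn_toLp] with x hx hxI
      show (hkL.toLp k) x = 0
      rw [hx, hk, indicator_of_notMem hxI])
    have h1 : ∫ x in I, h x * conj (h x - m) = 0 := by
      rw [← h0, ← integral_indicator hIm]
      refine integral_congr_ae ?_
      filter_upwards [hkL.coeFn_toLp] with x hx
      show _ = h x * conj ((hkL.toLp k) x)
      rw [hx]
      by_cases hxI : x ∈ I <;> simp [hk, hxI]
    have h2 : ∫ x in I, m * conj (h x - m) = 0 := by
      rw [integral_const_mul, integral_conj, hzero]; simp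
    have hgs : MemLp (fun x => conj (h x - m)) 2 (volume.restrict I) := hg.star
    have i1 : Integrable (fun x => h x * conj (h x - m)) (volume.restrict I) :=
      (hloc n).integrable_mul hgs
    have i2 : Integrable (fun x => m * conj (h x - m)) (volume.restrict I) :=
      (hgs.integrable (by norm_num)).const_mul m
    have h3 : ∫ x in I, ((‖h x - m‖ ^ 2 : ℝ) : ℂ) = 0 := by
      have : ∫ x in I, (h x * conj (h x - m) - m * conj (h x - m)) = 0 := by
        rw [integral_sub i1 i2, h1, h2, sub_zero]
      rw [← this]
      refine integral_congr_ae (Eventually.of_forall fun x => ?_)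
      simp only [← sub_mul, Complex.mul_conj, Complex.normSq_eq_norm_sq]
    rw [integral_complex_ofReal] at h3
    have h4 : ∫ x in I, ‖h x - m‖ ^ 2 = 0 := by exact_mod_cast h3
    rw [integral_eq_zero_iff_of_nonneg (fun x => by positivity) hg.norm.integrable_sq] at h4
    refine ⟨m, ?_⟩
    filter_upwards [h4] with x hx
    have : ‖h x - m‖ ^ 2 = 0 := hx
    rw [← sub_eq_zero]; simpa using this
  choose! C hC using key
  have hCC : ∀ n : ℝ, 1 ≤ n → C n = C 1 := by
    intro n hn
    have e1 := ae_restrict_of_ae_restrict_of_subset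
      (Ioc_subset_Ioc (neg_le_neg hn) hn) (hC n (by linarith))
    have e2 := hC 1 one_pos
    have : NeBot (ae (volume.restrict (Ioc (-1 : ℝ) 1))) := by
      rw [ae_neBot, Ne, Measure.restrict_eq_zero]; simp
    obtain ⟨x, hx1, hx2⟩ := (e1.and e2).exists
    rw [← hx1, hx2]
  refine ⟨C 1, ?_⟩
  have : ∀ᵐ x : ℝ, ∀ n : ℕ, x ∈ Ioc (-(n + 1 : ℝ)) (n + 1) → h x = C 1 := by
    rw [ae_all_iff]
    intro n
    rw [← ae_restrict_iff' measurableSet_Ioc]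
    have := hC (n + 1) (by positivity)
    rwa [hCC (n + 1) (by simp)] at this
  filter_upwards [this] with x hx
  obtain ⟨n, hn⟩ := exists_nat_gt |x|
  exact hx n ⟨by have := neg_abs_le x; linarith, by have := le_abs_self x; linarith⟩

theorem inner_eq_integral (f g : L2R) : inner ℂ f g = ∫ x, g x * conj (f x) := by
  rw [L2.inner_def]; rfl

/-- `minDomain` is dense, so that the adjoint of `minOp` is not a junk value. -/
theorem dense_minDomain : Dense (minDomain : Set L2R) := by
  rw [Submodule.dense_iff_topologicalClosure_eq_top, Submodule.topologicalClosure_eq_top_iff,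
    Submodule.eq_bot_iff]
  intro v hv
  obtain ⟨c, hc⟩ := ae_const_of_orthogonal v (fun n => (Lp.memLp v).restrict _) (by
    intro n f _
    rw [← inner_eq_integral]
    exact (Submodule.mem_orthogonal _ _).1 hv f f.2)
  have h := (memLp_congr_ae hc).1 (Lp.memLp v)
  rw [memLp_const_iff (by norm_num) (by norm_num)] at h
  rcases h with h | h
  · rw [h] at hc
    exact (Lp.eq_zero_iff_ae_eq_zero).2 hc
  · simp at h

theorem coeFn_minOp (φ ψ : L2R) (f : minDomain) :
    (minOp φ ψ f : L2R) =ᵐ[volume]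
      fun x : ℝ => (x : ℂ) * (f : L2R) x + inner ℂ φ (f : L2R) * ψ x := by
  have : minOp φ ψ f = (minDomain_memLp f).toLp _ + inner ℂ φ (f : L2R) • ψ := rfl
  rw [this]
  filter_upwards [Lp.coeFn_add ((minDomain_memLp f).toLp _) (inner ℂ φ (f : L2R) • ψ),
    (minDomain_memLp f).coeFn_toLp, Lp.coeFn_smul (inner ℂ φ (f : L2R)) ψ] with x h1 h2 h3
  rw [h1, Pi.add_apply, h2, h3, Pi.smul_apply, smul_eq_mul]

/-- The explicit form of `Ã*`: `(Ã* u)(x) = x u(x) - c_u + ⟨u, φ⟩ ψ(x)`. In particular `Γ₂` is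
defined on the whole domain of `Ã*`. -/
theorem maxOp_graph_iff (φ ψ u w : L2R) :
    (u, w) ∈ (maxOp φ ψ).graph ↔
      ∃ c : ℂ, w =ᵐ[volume] fun x : ℝ => (x : ℂ) * u x - c + inner ℂ φ u * ψ x := by
  have hd : Dense ((minOp ψ φ).domain : Set L2R) := dense_minDomain
  have step : (u, w) ∈ (maxOp φ ψ).graph ↔
      ∀ f : minDomain, inner ℂ (minOp ψ φ f) u = inner ℂ (f : L2R) w := by
    rw [maxOp, LinearPMap.adjoint_graph_eq_graph_adjoint hd, Submodule.mem_adjoint_iff]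
    constructor
    · intro H f
      have := H f (minOp ψ φ f) ((minOp ψ φ).mem_graph f)
      exact sub_eq_zero.1 this
    · intro H a b hab
      obtain ⟨f, rfl, rfl⟩ := (LinearPMap.mem_graph_iff _).1 hab
      exact sub_eq_zero.2 (H f)
  rw [step]
  set w' : L2R := w - inner ℂ φ u • ψ with hw'
  have hw'c : w' =ᵐ[volume] fun x => w x - inner ℂ φ u * ψ x := by
    filter_upwards [Lp.coeFn_sub w (inner ℂ φ u • ψ), Lp.coeFn_smul (inner ℂ φ u) ψ] with x h1 h2
    rw [hw', h1, Pi.sub_apply, h2, Pi.smul_apply, smul_eq_mul]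
  have step2 : ∀ f : minDomain, (inner ℂ (minOp ψ φ f) u = inner ℂ (f : L2R) w ↔
      ∫ x : ℝ, (x : ℂ) * u x * conj ((f : L2R) x) = ∫ x, w' x * conj ((f : L2R) x)) := by
    intro f
    have e1 : inner ℂ (minOp ψ φ f) u
        = (∫ x : ℝ, (x : ℂ) * u x * conj ((f : L2R) x)) + inner ℂ φ u * inner ℂ (f : L2R) ψ := by
      have : minOp ψ φ f = (minDomain_memLp f).toLp _ + inner ℂ ψ (f : L2R) • φ := rfl
      rw [this, inner_add_left, inner_smul_left, inner_conj_symm, mul_comm (inner ℂ φ u)]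
      congr 1
      rw [inner_eq_integral]
      refine integral_congr_ae ?_
      filter_upwards [(minDomain_memLp f).coeFn_toLp] with x hx
      rw [hx]; simp; ring
    have e2 : inner ℂ (f : L2R) w
        = (∫ x, w' x * conj ((f : L2R) x)) + inner ℂ φ u * inner ℂ (f : L2R) ψ := by
      rw [← inner_eq_integral, hw', inner_sub_right, inner_smul_right]; ring
    rw [e1, e2, add_left_inj]
  simp only [step2]
  have hxu : ∀ n : ℝ, MemLp (fun x : ℝ => (x : ℂ) * u x) 2 (volume.restrict (Ioc (-n) n)) := by
    intro n
    refine MemLp.of_le_mul (c := n) ((Lp.memLp u).restrict _)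
      (Complex.continuous_ofReal.aestronglyMeasurable.mul ((Lp.memLp u).restrict _).1) ?_
    filter_upwards [ae_restrict_mem measurableSet_Ioc] with x hx
    rw [norm_mul, Complex.norm_real]
    gcongr
    exact abs_le.2 ⟨hx.1.le, hx.2⟩
  have ixu : ∀ f : minDomain, Integrable (fun x : ℝ => (x : ℂ) * u x * conj ((f : L2R) x)) := by
    intro f
    have h1 := (Lp.memLp u).integrable_mul (minDomain_memLp f).star
    refine h1.congr (Eventually.of_forall fun x => ?_)
    simp; ring
  have iw : ∀ f : minDomain, Integrable (fun x : ℝ => w' x * conj ((f : L2R) x)) :=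
    fun f => (Lp.memLp w').integrable_mul (Lp.memLp (f : L2R)).star
  constructor
  · intro H
    obtain ⟨c, hc⟩ := ae_const_of_orthogonal (fun x => (x : ℂ) * u x - w' x)
      (fun n => (hxu n).sub ((Lp.memLp w').restrict _)) (by
        intro n f _
        simp only [sub_mul]
        rw [integral_sub (ixu f) (iw f), H f, sub_self])
    refine ⟨c, ?_⟩
    filter_upwards [hc, hw'c] with x h1 h2
    rw [h2] at h1
    linear_combination -h1
  · rintro ⟨c, hc⟩ f
    have hce : ∀ᵐ x : ℝ, (x : ℂ) * u x * conj ((f : L2R) x) - w' x * conj ((f : L2R) x)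
        = c * conj ((f : L2R) x) := by
      filter_upwards [hc, hw'c] with x h1 h2
      rw [h2, h1]; ring
    rw [← sub_eq_zero, ← integral_sub (ixu f) (iw f)]
    have hI := ((ixu f).sub (iw f))
    have t1 := intervalIntegral_tendsto_integral hI tendsto_neg_atTop_atBot tendsto_id
    refine tendsto_nhds_unique t1 ?_
    have t2 : Tendsto (fun R : ℝ => c * conj (∫ x in (-R)..R, (f : L2R) x)) atTop (𝓝 (c * conj 0)) :=
      Tendsto.const_mul c ((Complex.continuous_conj.tendsto _).comp f.2.2)
    rw [map_zero, mul_zero] at t2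
    refine t2.congr' ?_
    filter_upwards [eventually_ge_atTop 0] with R hR
    rw [intervalIntegral.integral_of_le (by linarith), id,
      intervalIntegral.integral_of_le (by linarith), ← integral_conj, ← integral_const_mul]
    refine (setIntegral_congr_ae measurableSet_Ioc ?_).symm
    filter_upwards [hce] with x hx _ using hx

end Adjoint

end Friedrichs

end

/-! Resolvent side. For nonreal `δ`, dividing `(A_B - δ) u = v` by `x - δ` gives `u = Res δ v + c •
rk δ - k • Res δ ψ` with `c = c_u` and `k = ⟨u, φ⟩`. The definition of `k` and the boundary
condition form a 2 × 2 linear system for `(c, k)`. Its determinant is, up to sign, `D(δ) (B - sgm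
δ)` plus the product of the Cauchy transforms of `ψ` and `conj φ`. That product is zero: the Cauchy
transform of an `H₂⁺` function vanishes in the lower half-plane, that of its conjugate in the upper
one. So the nonreal points of the resolvent set are those where `D ≠ 0`
(`mem_resolventSet_iff_of_im_ne`), real points never belong to it, and the kernel of `Ã* - δ` is
spanned by `kerVec φ ψ δ` when `D(δ) ≠ 0`. If `s δ` is the kernel vector with `(Γ₁ - B Γ₂) s δ = 1`,
then `(A_B - δ)⁻¹ s μ₀ = (s δ - s μ₀) / (δ - μ₀)` for `δ ≠ μ₀`, and `s δ` tends to zero along the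
positive imaginary axis. Hence the closure of `𝒮` is the closed span of all kernel vectors
(`detectable_closure_eq`).

Defect. Put `f = conj g` and `β = cau (conj φ)`. Then `g ⟂ 𝒮` means that `cau f` vanishes in `ℂ₊`
and `D · cau f = β · cau (ψ f)` in `ℂ₋`. For rational `ψ`, multiplication by `∏ (μ - zⱼ)` turns this
into `n · cau f = β q`, where `n` is the numerator of `D₊` and `q` is the polynomial of degree less
than `N` interpolating multiples of the values `cau f (zⱼ)`. Uniqueness of Cauchy transforms gives
`f = conj φ · q / n` on the line (`exists_polynomial_of_pairing`). Conversely, such an `f` works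
exactly when it is square integrable, `β q / n` has no poles in `ℂ₋`, and its value at each `zⱼ` is
the one demanded by the interpolation (`cau_of_polynomial`, `pairing_eq_zero_of_polynomial`).

Each condition is local and says that `(X - w) ^ expo w` divides `q`. At `zⱼ` it is automatic if
`conj φ` does not vanish there; otherwise it reads `(ℓⱼ - 1) q(zⱼ) = 0`. The product `Q` of these
powers has degree `P + M + M₀` and divides `n`, so admissible `q` are the multiples of `Q` of degree
less than `N`, a space of dimension `N - deg Q`. -/

noncomputable section

namespace Friedrichs

/-! ### Resolvent kernels and Cauchy transforms on the line. -/

section CauchyTransform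

/-- The kernel `x ↦ 1 / (x - μ)`, set to zero for real `μ`. -/
def kern (μ : ℂ) (x : ℝ) : ℂ := if μ.im = 0 then 0 else ((x : ℂ) - μ)⁻¹

theorem kern_of_im_ne {μ : ℂ} (h : μ.im ≠ 0) (x : ℝ) : kern μ x = ((x : ℂ) - μ)⁻¹ := if_neg h

theorem ofReal_sub_ne_zero {μ : ℂ} (h : μ.im ≠ 0) (x : ℝ) : (x : ℂ) - μ ≠ 0 := by
  intro h0
  exact h (by simpa using (congrArg Complex.im h0))

theorem abs_im_le_norm_ofReal_sub (μ : ℂ) (x : ℝ) : |μ.im| ≤ ‖(x : ℂ) - μ‖ := by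
  simpa using Complex.abs_im_le_norm ((x : ℂ) - μ)

theorem norm_inv_ofReal_sub_le (μ : ℂ) (hμ : μ.im ≠ 0) (x : ℝ) : ‖((x : ℂ) - μ)⁻¹‖ ≤ |μ.im|⁻¹ := by
  rw [norm_inv]
  exact inv_anti₀ (abs_pos.2 hμ) (abs_im_le_norm_ofReal_sub μ x)

theorem norm_kern_le (μ : ℂ) (x : ℝ) : ‖kern μ x‖ ≤ |μ.im|⁻¹ := by
  by_cases h : μ.im = 0
  · simp [kern, h]
  · rw [kern_of_im_ne h]; exact norm_inv_ofReal_sub_le μ h x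

theorem continuous_kern (μ : ℂ) : Continuous (kern μ) := by
  by_cases h : μ.im = 0
  · have : kern μ = fun _ => 0 := funext fun x => by simp [kern, h]
    rw [this]; exact continuous_const
  · have : kern μ = fun x : ℝ => ((x : ℂ) - μ)⁻¹ := funext (kern_of_im_ne h)
    rw [this]
    exact (Complex.continuous_ofReal.sub continuous_const).inv₀ (ofReal_sub_ne_zero h)

theorem norm_sq_ofReal_sub (μ : ℂ) (x : ℝ) : ‖(x : ℂ) - μ‖ ^ 2 = (x - μ.re) ^ 2 + μ.im ^ 2 := by
  rw [← Complex.normSq_eq_norm_sq, Complex.normSq_apply]; simp; ring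

theorem norm_sq_kern {μ : ℂ} (h : μ.im ≠ 0) (x : ℝ) :
    ‖kern μ x‖ ^ 2 = (μ.im ^ 2)⁻¹ * (1 + (|μ.im|⁻¹ * (x - μ.re)) ^ 2)⁻¹ := by
  rw [kern_of_im_ne h, norm_inv, inv_pow, norm_sq_ofReal_sub, ← mul_inv, mul_pow, inv_pow, sq_abs]
  field_simp
  rw [add_comm]

theorem integrable_norm_sq_kern (μ : ℂ) : Integrable fun x => ‖kern μ x‖ ^ 2 := by
  by_cases h : μ.im = 0
  · simp [kern, h]
  · simp only [norm_sq_kern h]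
    refine Integrable.const_mul ?_ _
    exact ((integrable_inv_one_add_sq.comp_mul_left' (by simpa using h)).comp_sub_right μ.re)

theorem memLp_kern (μ : ℂ) : MemLp (kern μ) 2 volume :=
  (memLp_two_iff_integrable_sq_norm (continuous_kern μ).aestronglyMeasurable).2
    (integrable_norm_sq_kern μ)

theorem integral_norm_sq_kern {μ : ℂ} (h : μ.im ≠ 0) :
    ∫ x, ‖kern μ x‖ ^ 2 = Real.pi / |μ.im| := by
  simp only [norm_sq_kern h]
  rw [integral_const_mul, integral_sub_right_eq_self (fun x => (1 + (|μ.im|⁻¹ * x) ^ 2)⁻¹) μ.re,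
    Measure.integral_comp_mul_left (fun x => (1 + x ^ 2)⁻¹) |μ.im|⁻¹, integral_univ_inv_one_add_sq,
    ← sq_abs]
  have : 0 < |μ.im| := abs_pos.2 h
  simp only [inv_inv, abs_abs, smul_eq_mul]
  field_simp

/-- The function `x ↦ 1 / (x - μ)` as an element of `L²`. -/
def rk (μ : ℂ) : L2R := (memLp_kern μ).toLp _

theorem coeFn_rk {μ : ℂ} (h : μ.im ≠ 0) : rk μ =ᵐ[volume] fun x : ℝ => ((x : ℂ) - μ)⁻¹ := by
  filter_upwards [(memLp_kern μ).coeFn_toLp] with x hx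
  rw [rk, hx, kern_of_im_ne h]

theorem norm_sq_eq_integral (f : L2R) : ‖f‖ ^ 2 = ∫ x, ‖f x‖ ^ 2 := by
  have h := inner_self_eq_norm_sq_to_K (𝕜 := ℂ) f
  rw [inner_eq_integral] at h
  have e : ∀ x, f x * conj (f x) = ((‖f x‖ ^ 2 : ℝ) : ℂ) := fun x => by
    rw [Complex.mul_conj, Complex.normSq_eq_norm_sq]
  simp only [e, integral_complex_ofReal] at h
  have h2 : ((∫ x, ‖f x‖ ^ 2 : ℝ) : ℂ) = ((‖f‖ ^ 2 : ℝ) : ℂ) := by rw [h]; push_cast; rfl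
  exact (Complex.ofReal_injective h2).symm

theorem norm_rk_sq {μ : ℂ} (h : μ.im ≠ 0) : ‖rk μ‖ ^ 2 = Real.pi / |μ.im| := by
  rw [norm_sq_eq_integral, ← integral_norm_sq_kern h]
  refine integral_congr_ae ?_
  filter_upwards [coeFn_rk h] with x hx
  rw [hx, kern_of_im_ne h]

theorem memLp_kern_mul (μ : ℂ) {f : ℝ → ℂ} (hf : MemLp f 2 volume) :
    MemLp (fun x => kern μ x * f x) 2 volume := by
  refine MemLp.of_le_mul (c := |μ.im|⁻¹) hf
    ((continuous_kern μ).aestronglyMeasurable.mul hf.1) (Eventually.of_forall fun x => ?_)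
  rw [norm_mul]
  exact mul_le_mul_of_nonneg_right (norm_kern_le μ x) (norm_nonneg _)

/-- Multiplication by `1 / (x - μ)` as a bounded operator (zero for real `μ`). -/
def Res (μ : ℂ) : L2R →L[ℂ] L2R :=
  LinearMap.mkContinuous
    { toFun := fun f => (memLp_kern_mul μ (Lp.memLp f)).toLp _
      map_add' := by
        intro f g
        rw [← MemLp.toLp_add]
        refine MemLp.toLp_congr _ _ ?_
        filter_upwards [Lp.coeFn_add f g] with x hx
        simp only [hx, Pi.add_apply, mul_add]
      map_smul' := by
        intro k f
        rw [RingHom.id_apply, ← MemLp.toLp_const_smul]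
        refine MemLp.toLp_congr _ _ ?_
        filter_upwards [Lp.coeFn_smul k f] with x hx
        simp only [hx, Pi.smul_apply, smul_eq_mul]
        ring } |μ.im|⁻¹ (by
      intro f
      refine Lp.norm_le_mul_norm_of_ae_le_mul ?_
      filter_upwards [(memLp_kern_mul μ (Lp.memLp f)).coeFn_toLp] with x hx
      simp only [LinearMap.coe_mk, AddHom.coe_mk]
      rw [hx, norm_mul]
      exact mul_le_mul_of_nonneg_right (norm_kern_le μ x) (norm_nonneg _))

theorem norm_Res_apply_le (μ : ℂ) (f : L2R) : ‖Res μ f‖ ≤ |μ.im|⁻¹ * ‖f‖ :=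
  (Res μ).le_of_opNorm_le (LinearMap.mkContinuous_norm_le _ (by positivity) _) f

theorem coeFn_Res {μ : ℂ} (h : μ.im ≠ 0) (f : L2R) :
    Res μ f =ᵐ[volume] fun x : ℝ => f x / ((x : ℂ) - μ) := by
  have : Res μ f = (memLp_kern_mul μ (Lp.memLp f)).toLp _ := rfl
  filter_upwards [(memLp_kern_mul μ (Lp.memLp f)).coeFn_toLp] with x hx
  rw [this, hx, kern_of_im_ne h, div_eq_mul_inv, mul_comm]

theorem Res_sub_Res {μ ν : ℂ} (hμ : μ.im ≠ 0) (hν : ν.im ≠ 0) (f : L2R) :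
    Res μ f - Res ν f = (μ - ν) • Res μ (Res ν f) := by
  refine Lp.ext ?_
  filter_upwards [Lp.coeFn_sub (Res μ f) (Res ν f), Lp.coeFn_smul (μ - ν) (Res μ (Res ν f)),
    coeFn_Res hμ f, coeFn_Res hν f, coeFn_Res hμ (Res ν f)] with x h1 h2 h3 h4 h5
  rw [h1, h2, Pi.sub_apply, Pi.smul_apply, h3, h5, h4, smul_eq_mul]
  have := ofReal_sub_ne_zero hμ x
  have := ofReal_sub_ne_zero hν x
  field_simp
  ring

theorem rk_sub_rk {μ ν : ℂ} (hμ : μ.im ≠ 0) (hν : ν.im ≠ 0) :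
    rk μ - rk ν = (μ - ν) • Res μ (rk ν) := by
  refine Lp.ext ?_
  filter_upwards [Lp.coeFn_sub (rk μ) (rk ν), Lp.coeFn_smul (μ - ν) (Res μ (rk ν)),
    coeFn_rk hμ, coeFn_rk hν, coeFn_Res hμ (rk ν)] with x h1 h2 h3 h4 h5
  rw [h1, h2, Pi.sub_apply, Pi.smul_apply, h3, h5, h4, smul_eq_mul]
  have := ofReal_sub_ne_zero hμ x
  have := ofReal_sub_ne_zero hν x
  field_simp
  ring

/-- The bound `‖Res μ g‖ ≤ ‖g‖ / |Im μ|` stays bounded near `ν`, so the factor `μ - ν` forces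
convergence. This serves both `rk` and `Res`. -/
theorem tendsto_of_resolvent_identity {ν : ℂ} (hν : ν.im ≠ 0) (F : ℂ → L2R) (g : L2R)
    (h : ∀ μ : ℂ, μ.im ≠ 0 → F μ - F ν = (μ - ν) • Res μ g) : Tendsto F (𝓝 ν) (𝓝 (F ν)) := by
  rw [tendsto_iff_norm_sub_tendsto_zero]
  have h1 : Tendsto (fun μ : ℂ => ‖μ - ν‖ * (|μ.im|⁻¹ * ‖g‖)) (𝓝 ν) (𝓝 (‖ν - ν‖ * (|ν.im|⁻¹ * ‖g‖))) := by
    refine Tendsto.mul ((tendsto_id.sub_const ν).norm) (Tendsto.mul_const _ ?_)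
    exact (Complex.continuous_im.tendsto ν).abs.inv₀ (by simpa using hν)
  simp only [sub_self, norm_zero, zero_mul] at h1
  refine squeeze_zero' (Eventually.of_forall fun _ => norm_nonneg _) ?_ h1
  filter_upwards [Complex.continuous_im.continuousAt.eventually_ne hν] with μ hμ
  rw [h μ hμ, norm_smul]
  gcongr
  exact norm_Res_apply_le μ g

theorem continuousAt_rk {ν : ℂ} (hν : ν.im ≠ 0) : ContinuousAt rk ν :=
  tendsto_of_resolvent_identity hν rk _ fun _ hμ => rk_sub_rk hμ hν

theorem continuousAt_Res_apply {ν : ℂ} (hν : ν.im ≠ 0) (f : L2R) :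
    ContinuousAt (fun μ => Res μ f) ν :=
  tendsto_of_resolvent_identity hν (fun μ => Res μ f) _ fun _ hμ => Res_sub_Res hμ hν f

/-- The Cauchy transform `∫ h(x) / (x - μ) dx`. -/
def cau (h : ℝ → ℂ) (μ : ℂ) : ℂ := ∫ x : ℝ, h x / ((x : ℂ) - μ)

theorem cau_congr {f g : ℝ → ℂ} (h : f =ᵐ[volume] g) (μ : ℂ) : cau f μ = cau g μ := by
  refine integral_congr_ae ?_
  filter_upwards [h] with x hx
  rw [hx]

theorem memLp_inv_ofReal_sub {μ : ℂ} (h : μ.im ≠ 0) :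
    MemLp (fun x : ℝ => ((x : ℂ) - μ)⁻¹) 2 volume := by
  have := memLp_kern μ
  rwa [show kern μ = fun x : ℝ => ((x : ℂ) - μ)⁻¹ from funext (kern_of_im_ne h)] at this

theorem integrable_div_of_memLp {f : ℝ → ℂ} (hf : MemLp f 2 volume) {μ : ℂ} (h : μ.im ≠ 0) :
    Integrable fun x : ℝ => f x / ((x : ℂ) - μ) := by
  simp only [div_eq_mul_inv]
  exact hf.integrable_mul (memLp_inv_ofReal_sub h)

theorem integrable_div_of_integrable {f : ℝ → ℂ} (hf : Integrable f) {μ : ℂ} (h : μ.im ≠ 0) :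
    Integrable fun x : ℝ => f x / ((x : ℂ) - μ) := by
  refine (hf.bdd_mul (c := |μ.im|⁻¹) (continuous_kern μ).aestronglyMeasurable
    (Eventually.of_forall (norm_kern_le μ))).congr (Eventually.of_forall fun x => ?_)
  simp only [kern_of_im_ne h]
  rw [div_eq_mul_inv, mul_comm]

theorem cau_eq_inner (f : L2R) {μ : ℂ} (h : μ.im ≠ 0) : cau f μ = inner ℂ (rk (conj μ)) f := by
  rw [inner_eq_integral]
  refine integral_congr_ae ?_
  filter_upwards [coeFn_rk (μ := conj μ) (by simpa using h)] with x hx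
  rw [hx, div_eq_mul_inv]; simp

theorem norm_cau_le (f : L2R) {μ : ℂ} (h : μ.im ≠ 0) :
    ‖cau f μ‖ ≤ Real.sqrt (Real.pi / |μ.im|) * ‖f‖ := by
  rw [cau_eq_inner f h]
  refine (norm_inner_le_norm _ _).trans (le_of_eq ?_)
  congr 1
  rw [eq_comm, Real.sqrt_eq_iff_mul_self_eq (by positivity) (norm_nonneg _), ← sq,
    norm_rk_sq (by simpa using h)]
  simp

theorem norm_cau_le_of_integrable {h : ℝ → ℂ} (hh : Integrable h) {μ : ℂ} (hμ : μ.im ≠ 0) :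
    ‖cau h μ‖ ≤ |μ.im|⁻¹ * ∫ x, ‖h x‖ := by
  rw [cau, ← integral_const_mul]
  refine norm_integral_le_of_norm_le (hh.norm.const_mul _) (Eventually.of_forall fun x => ?_)
  rw [div_eq_mul_inv, norm_mul, mul_comm]
  gcongr
  exact norm_inv_ofReal_sub_le μ hμ x

theorem differentiableAt_cau_of_integrable {h : ℝ → ℂ} (hh : Integrable h) {μ : ℂ}
    (hμ : μ.im ≠ 0) : DifferentiableAt ℂ (cau h) μ := by
  have hb : 0 < |μ.im| / 2 := by positivity
  have him : ∀ ν ∈ Metric.ball μ (|μ.im| / 2), |μ.im| / 2 ≤ |ν.im| ∧ ν.im ≠ 0 := by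
    intro ν hν
    have h1 : |(μ - ν).im| ≤ ‖μ - ν‖ := Complex.abs_im_le_norm _
    rw [Metric.mem_ball, dist_comm, dist_eq_norm] at hν
    have h2 := abs_sub_abs_le_abs_sub μ.im ν.im
    rw [Complex.sub_im] at h1
    have : |μ.im| / 2 ≤ |ν.im| := by linarith
    exact ⟨this, fun h0 => by rw [h0, abs_zero] at this; linarith⟩
  have := hasDerivAt_integral_of_dominated_loc_of_deriv_le (μ := (volume : Measure ℝ)) (𝕜 := ℂ)
    (F := fun (ν : ℂ) (x : ℝ) => h x / ((x : ℂ) - ν))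
    (F' := fun (ν : ℂ) (x : ℝ) => h x / ((x : ℂ) - ν) ^ 2) (x₀ := μ)
    (bound := fun x => ‖h x‖ * ((|μ.im| / 2)⁻¹) ^ 2) (Metric.ball_mem_nhds μ hb) ?_
    (integrable_div_of_integrable hh hμ) ?_ ?_ (hh.norm.mul_const _) ?_
  · exact this.2.differentiableAt
  · filter_upwards [Metric.ball_mem_nhds μ hb] with ν hν
    exact (integrable_div_of_integrable hh (him ν hν).2).1
  · have := (integrable_div_of_integrable (integrable_div_of_integrable hh hμ) hμ).1
    refine this.congr (Eventually.of_forall fun x => ?_)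
    show h x / ((x : ℂ) - μ) / ((x : ℂ) - μ) = h x / ((x : ℂ) - μ) ^ 2
    rw [div_div, sq]
  · refine Eventually.of_forall fun x ν hν => ?_
    rw [div_eq_mul_inv, norm_mul, norm_inv, norm_pow, ← inv_pow]
    gcongr
    exact (him ν hν).1.trans (abs_im_le_norm_ofReal_sub ν x)
  · refine Eventually.of_forall fun x ν hν => ?_
    have h0 := ofReal_sub_ne_zero (him ν hν).2 x
    have h1 : HasDerivAt (fun ν : ℂ => (x : ℂ) - ν) (-1) ν := (hasDerivAt_id ν).const_sub _
    have := (hasDerivAt_const ν (h x)).div h1 h0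
    exact this.congr_deriv (by ring)

theorem cau_div {f : ℝ → ℂ} {μ ν : ℂ} (hμ : Integrable fun x : ℝ => f x / ((x : ℂ) - μ))
    (hν : Integrable fun x : ℝ => f x / ((x : ℂ) - ν)) (hμ' : μ.im ≠ 0) (hν' : ν.im ≠ 0) :
    cau f μ - cau f ν = (μ - ν) * cau (fun x => f x / ((x : ℂ) - ν)) μ := by
  rw [cau, cau, cau, ← integral_sub hμ hν, ← integral_const_mul]
  refine integral_congr_ae (Eventually.of_forall fun x => ?_)
  have := ofReal_sub_ne_zero hμ' x
  have := ofReal_sub_ne_zero hν' x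
  field_simp
  ring

theorem cau_div_eq {f : ℝ → ℂ} (hf : MemLp f 2 volume) {μ ν : ℂ} (hμ : μ.im ≠ 0) (hν : ν.im ≠ 0)
    (hne : μ ≠ ν) : cau (fun x => f x / ((x : ℂ) - ν)) μ = (cau f μ - cau f ν) / (μ - ν) := by
  rw [cau_div (integrable_div_of_memLp hf hμ) (integrable_div_of_memLp hf hν) hμ hν,
    mul_div_cancel_left₀ _ (sub_ne_zero.2 hne)]

/-- The identity `cau f ν = cau f i + (ν - i) cau (f / (x - i)) ν` reduces the square integrable
case to the integrable one. -/
theorem differentiableAt_cau {f : ℝ → ℂ} (hf : MemLp f 2 volume) {μ : ℂ} (hμ : μ.im ≠ 0) :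
    DifferentiableAt ℂ (cau f) μ := by
  have hI : (Complex.I).im ≠ 0 := by simp
  have h := differentiableAt_cau_of_integrable (integrable_div_of_memLp hf hI) hμ
  have h2 : DifferentiableAt ℂ (fun ν => cau f Complex.I +
      (ν - Complex.I) * cau (fun x => f x / ((x : ℂ) - Complex.I)) ν) μ :=
    ((differentiableAt_id.sub_const _).mul h).const_add _
  refine h2.congr_of_eventuallyEq ?_
  filter_upwards [Complex.continuous_im.continuousAt.eventually_ne hμ] with ν hν
  rw [← cau_div (integrable_div_of_memLp hf hν) (integrable_div_of_memLp hf hI) hν hI]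
  ring

/-- The value `± π i` of the improper integral of `1 / (x - μ)` for `± Im μ > 0`. -/
def sgm (μ : ℂ) : ℂ := if 0 < μ.im then Real.pi * Complex.I else -(Real.pi * Complex.I)

theorem tendsto_log_ofReal_sub (μ : ℂ) :
    Tendsto (fun R : ℝ => Complex.log ((R : ℂ) - μ) - Real.log R) atTop (𝓝 0) := by
  have h1 : Tendsto (fun R : ℝ => 1 - μ * ((R⁻¹ : ℝ) : ℂ)) atTop (𝓝 (1 - μ * ((0 : ℝ) : ℂ))) :=
    tendsto_const_nhds.sub (tendsto_const_nhds.mul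
      ((Complex.continuous_ofReal.tendsto 0).comp tendsto_inv_atTop_zero))
  simp only [Complex.ofReal_zero, mul_zero, sub_zero] at h1
  have h2 := h1.clog (Complex.one_mem_slitPlane)
  rw [Complex.log_one] at h2
  refine h2.congr' ?_
  filter_upwards [eventually_gt_atTop 0, h1.eventually_ne one_ne_zero] with R hR hne
  have hR' : (R : ℂ) ≠ 0 := by exact_mod_cast hR.ne'
  have : (R : ℂ) - μ = (R : ℂ) * (1 - μ * ((R⁻¹ : ℝ) : ℂ)) := by push_cast; field_simp
  rw [this, Complex.log_ofReal_mul hR hne]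
  ring

/-- The path `x - μ` never meets the branch cut, so `log (x - μ)` is a primitive. The moduli at the
two ends cancel in the limit and only the change of argument remains. -/
theorem tendsto_integral_inv_sub {μ : ℂ} (h : μ.im ≠ 0) :
    Tendsto (fun R : ℝ => ∫ x in (-R)..R, ((x : ℂ) - μ)⁻¹) atTop (𝓝 (sgm μ)) := by
  have hslit : ∀ x : ℝ, (x : ℂ) - μ ∈ Complex.slitPlane := fun x =>
    Or.inr (by simpa using h)
  have hint : ∀ R : ℝ, ∫ x in (-R)..R, ((x : ℂ) - μ)⁻¹
      = Complex.log ((R : ℂ) - μ) - Complex.log (((-R : ℝ) : ℂ) - μ) := by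
    intro R
    refine intervalIntegral.integral_eq_sub_of_hasDerivAt (f := fun x : ℝ => Complex.log ((x : ℂ) - μ)) (fun x _ => ?_) ?_
    · have h1 : HasDerivAt (fun x : ℝ => (x : ℂ) - μ) 1 x :=
        (Complex.ofRealCLM.hasDerivAt).sub_const μ
      simpa using h1.clog_real (hslit x)
    · refine Continuous.intervalIntegrable ?_ _ _
      exact (Complex.continuous_ofReal.sub continuous_const).inv₀ (ofReal_sub_ne_zero h)
  simp only [hint]
  have hneg : ∀ R : ℝ, Complex.log (((-R : ℝ) : ℂ) - μ)
      = Complex.log ((R : ℂ) - (-μ)) - sgm μ := by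
    intro R
    have e : ((-R : ℝ) : ℂ) - μ = -((R : ℂ) + μ) := by push_cast; ring
    rw [e, sub_neg_eq_add, Complex.log, Complex.log, norm_neg]
    rcases lt_or_gt_of_ne h with h' | h'
    · rw [Complex.arg_neg_eq_arg_add_pi_of_im_neg (by simpa using h'), sgm, if_neg (by linarith)]
      push_cast; ring
    · rw [Complex.arg_neg_eq_arg_sub_pi_of_im_pos (by simpa using h'), sgm, if_pos h']
      push_cast; ring
  have := ((tendsto_log_ofReal_sub μ).sub (tendsto_log_ofReal_sub (-μ))).add_const (sgm μ)
  rw [sub_zero, zero_add] at this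
  refine this.congr fun R => ?_
  rw [hneg]; ring

theorem hasGammaOne_rk {μ : ℂ} (h : μ.im ≠ 0) : HasGammaOne (rk μ) (sgm μ) := by
  refine (tendsto_integral_inv_sub h).congr fun R => ?_
  refine intervalIntegral.integral_congr_ae ?_
  filter_upwards [coeFn_rk h] with x hx _
  rw [hx]

theorem hasGammaOne_Res {μ : ℂ} (h : μ.im ≠ 0) (f : L2R) : HasGammaOne (Res μ f) (cau f μ) := by
  have h1 := intervalIntegral_tendsto_integral (integrable_div_of_memLp (Lp.memLp f) h)
    tendsto_neg_atTop_atBot tendsto_id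
  refine h1.congr fun R => ?_
  refine intervalIntegral.integral_congr_ae ?_
  filter_upwards [coeFn_Res h f] with x hx _
  rw [hx]

theorem integral_inv_sub_sub_inv_sub {μ ν : ℂ} (hμ : μ.im ≠ 0) (hν : ν.im ≠ 0) :
    ∫ x : ℝ, (((x : ℂ) - μ)⁻¹ - ((x : ℂ) - ν)⁻¹) = sgm μ - sgm ν := by
  have hcont : ∀ {μ : ℂ}, μ.im ≠ 0 → Continuous fun x : ℝ => ((x : ℂ) - μ)⁻¹ := fun h =>
    (Complex.continuous_ofReal.sub continuous_const).inv₀ (ofReal_sub_ne_zero h)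
  have hI : Integrable fun x : ℝ => (((x : ℂ) - μ)⁻¹ - ((x : ℂ) - ν)⁻¹) := by
    have := ((memLp_inv_ofReal_sub hμ).integrable_mul (memLp_inv_ofReal_sub hν)).const_mul (μ - ν)
    refine this.congr (Eventually.of_forall fun x => ?_)
    have := ofReal_sub_ne_zero hμ x
    have := ofReal_sub_ne_zero hν x
    simp only [Pi.mul_apply]
    field_simp
    ring
  refine tendsto_nhds_unique
    (intervalIntegral_tendsto_integral hI tendsto_neg_atTop_atBot tendsto_id) ?_
  refine ((tendsto_integral_inv_sub hμ).sub (tendsto_integral_inv_sub hν)).congr fun R => ?_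
  rw [id, intervalIntegral.integral_sub ((hcont hμ).intervalIntegrable _ _)
    ((hcont hν).intervalIntegrable _ _)]

/-- An `L²` function whose Cauchy transform vanishes off the real line is zero. -/
theorem ae_eq_zero_of_cau_eq_zero {f : ℝ → ℂ} (hf : MemLp f 2 volume)
    (h : ∀ μ : ℂ, μ.im ≠ 0 → cau f μ = 0) : f =ᵐ[volume] 0 := by
  have hI : (Complex.I).im ≠ 0 := by simp
  -- Dividing by `x - i` gives an integrable function whose Cauchy transform, a difference quotient
  -- of that of `f`, still vanishes; at `i` itself this follows by continuity.
  set g : ℝ → ℂ := fun x => f x / ((x : ℂ) - Complex.I) with hg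
  have hgi : Integrable g := integrable_div_of_memLp hf hI
  have hg0 : ∀ μ : ℂ, μ.im ≠ 0 → cau g μ = 0 := by
    intro μ hμ
    have h1 : ∀ ν : ℂ, ν.im ≠ 0 → ν ≠ Complex.I → cau g ν = 0 := fun ν hν hne => by
      rw [hg, cau_div_eq hf hν hI hne, h ν hν, h _ hI]; simp
    have hc : ContinuousAt (cau g) μ := (differentiableAt_cau_of_integrable hgi hμ).continuousAt
    have h2 : ∀ᶠ ν in 𝓝[≠] μ, cau g ν = 0 := by
      rcases eq_or_ne μ Complex.I with rfl | hne
      · filter_upwards [self_mem_nhdsWithin, mem_nhdsWithin_of_mem_nhds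
          (Complex.continuous_im.continuousAt.eventually_ne hμ)] with ν h3 h4 using h1 ν h4 h3
      · filter_upwards [mem_nhdsWithin_of_mem_nhds (eventually_ne_nhds hne),
          mem_nhdsWithin_of_mem_nhds
          (Complex.continuous_im.continuousAt.eventually_ne hμ)] with ν h3 h4 using h1 ν h4 h3
    refine tendsto_nhds_unique (hc.tendsto.mono_left (nhdsWithin_le_nhds (s := {μ}ᶜ))) ?_
    exact tendsto_const_nhds.congr' (by filter_upwards [h2] with ν hν using hν.symm)
  clear_value g
  -- The `t`-derivative of `arctan ((x - t) / y)` is minus a Poisson kernel, a combination of `1 /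
  -- (x - t ∓ i y)`. Against `g` it integrates to zero.
  have hconst : ∀ y : ℝ, 0 < y → ∀ a b : ℝ,
      ∫ x, g x * (Real.arctan ((x - a) / y) : ℂ) = ∫ x, g x * (Real.arctan ((x - b) / y) : ℂ) := by
    intro y hy
    have hmeas : ∀ t : ℝ, Integrable fun x => g x * (Real.arctan ((x - t) / y) : ℂ) := by
      intro t
      refine hgi.mul_bdd (c := Real.pi / 2) ?_ (Eventually.of_forall fun x => ?_)
      · exact (Complex.continuous_ofReal.comp (Real.continuous_arctan.comp
          (by fun_prop))).aestronglyMeasurable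
      · rw [Complex.norm_real, Real.norm_eq_abs, abs_le]
        exact ⟨(Real.neg_pi_div_two_lt_arctan _).le, (Real.arctan_lt_pi_div_two _).le⟩
    have hd : ∀ t : ℝ, HasDerivAt (fun t : ℝ => ∫ x, g x * (Real.arctan ((x - t) / y) : ℂ)) 0 t := by
      intro t
      have key := hasDerivAt_integral_of_dominated_loc_of_deriv_le (μ := (volume : Measure ℝ))
        (𝕜 := ℝ) (F := fun (t : ℝ) (x : ℝ) => g x * (Real.arctan ((x - t) / y) : ℂ))
        (F' := fun (t : ℝ) (x : ℝ) => g x * ((-(y / ((x - t) ^ 2 + y ^ 2)) : ℝ) : ℂ)) (x₀ := t)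
        (bound := fun x => ‖g x‖ * y⁻¹) univ_mem
        (Eventually.of_forall fun t => (hmeas t).1) (hmeas t) ?_ ?_ (hgi.norm.mul_const _) ?_
      · have h1 : ∫ x, g x * ((-(y / ((x - t) ^ 2 + y ^ 2)) : ℝ) : ℂ) = 0 := by
          have hp : (t + y * Complex.I : ℂ).im ≠ 0 := by simpa using hy.ne'
          have hm : (t - y * Complex.I : ℂ).im ≠ 0 := by simpa using hy.ne'
          have e : ∀ x : ℝ, g x * ((-(y / ((x - t) ^ 2 + y ^ 2)) : ℝ) : ℂ)
              = (Complex.I / 2) * (g x / ((x : ℂ) - (t + y * Complex.I))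
                - g x / ((x : ℂ) - (t - y * Complex.I))) := by
            intro x
            have n1 := ofReal_sub_ne_zero hp x
            have n2 := ofReal_sub_ne_zero hm x
            have n3 : ((x : ℂ) - t) ^ 2 + (y : ℂ) ^ 2 =
              ((x : ℂ) - (t + y * Complex.I)) * ((x : ℂ) - (t - y * Complex.I)) := by
              linear_combination (y : ℂ) ^ 2 * Complex.I_sq
            push_cast
            rw [n3]
            field_simp
            linear_combination (-(2 * (y : ℂ))) * g x * Complex.I_sq
          simp only [e]
          rw [integral_const_mul, integral_sub (integrable_div_of_integrable hgi hp)
            (integrable_div_of_integrable hgi hm)]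
          have a1 := hg0 _ hp
          have a2 := hg0 _ hm
          rw [cau] at a1 a2
          rw [a1, a2]; simp
        rw [← h1]; exact key.2
      · refine hgi.1.mul (Complex.continuous_ofReal.comp ?_).aestronglyMeasurable
        refine (continuous_const.div (by fun_prop) fun x => ?_).neg
        positivity
      · refine Eventually.of_forall fun x s _ => ?_
        rw [norm_mul, Complex.norm_real, norm_neg, Real.norm_eq_abs, abs_of_nonneg (by positivity)]
        gcongr
        rw [div_le_iff₀ (by positivity)]
        have : y⁻¹ * ((x - s) ^ 2 + y ^ 2) = y⁻¹ * (x - s) ^ 2 + y := by field_simp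
        rw [this]
        have : 0 ≤ y⁻¹ * (x - s) ^ 2 := by positivity
        linarith
      · refine Eventually.of_forall fun x s _ => ?_
        have h1 : HasDerivAt (fun s : ℝ => (x - s) / y) (-1 / y) s :=
          ((hasDerivAt_id s).const_sub x).div_const y
        have h2 := (h1.arctan).ofReal_comp.const_mul (g x)
        convert h2 using 2
        congr 1
        field_simp
        ring_nf
    intro a b
    exact is_const_of_deriv_eq_zero (fun t => (hd t).differentiableAt) (fun t => (hd t).deriv) a b
  -- As `y → 0⁺` the arctangents become the steps `±π/2` at `t`; the steps at `a` and `b` differ by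
  -- `π` on `(a, b]`.
  have hint : ∀ a b : ℝ, a ≤ b → ∫ x in a..b, g x = 0 := by
    intro a b hab
    have hlim : ∀ t : ℝ, Tendsto (fun y : ℝ => ∫ x, g x * (Real.arctan ((x - t) / y) : ℂ)) (𝓝[>] 0)
        (𝓝 (∫ x, g x * (if t < x then ((Real.pi / 2 : ℝ) : ℂ) else ((-(Real.pi / 2) : ℝ) : ℂ)))) := by
      intro t
      refine tendsto_integral_filter_of_dominated_convergence (fun x => ‖g x‖ * (Real.pi / 2))
        (Eventually.of_forall fun y => ?_) (Eventually.of_forall fun y =>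
          Eventually.of_forall fun x => ?_) (hgi.norm.mul_const _) ?_
      · exact hgi.1.mul (Complex.continuous_ofReal.comp (Real.continuous_arctan.comp
          (by fun_prop))).aestronglyMeasurable
      · rw [norm_mul]
        gcongr
        rw [Complex.norm_real, Real.norm_eq_abs, abs_le]
        exact ⟨(Real.neg_pi_div_two_lt_arctan _).le, (Real.arctan_lt_pi_div_two _).le⟩
      · have hne : ∀ᵐ x : ℝ, x ≠ t := by simp [ae_iff, measure_singleton]
        filter_upwards [hne] with x hx
        refine Tendsto.const_mul _ ?_
        split_ifs with hlt
        · refine (Complex.continuous_ofReal.tendsto _).comp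
            ((Real.tendsto_arctan_atTop.mono_right nhdsWithin_le_nhds).comp ?_)
          exact (tendsto_inv_nhdsGT_zero).const_mul_atTop (sub_pos.2 hlt)
        · refine (Complex.continuous_ofReal.tendsto _).comp
            ((Real.tendsto_arctan_atBot.mono_right nhdsWithin_le_nhds).comp ?_)
          exact (tendsto_inv_nhdsGT_zero).const_mul_atTop_of_neg
            (sub_neg.2 (lt_of_le_of_ne (not_lt.1 hlt) hx))
    have e1 := tendsto_nhds_unique (hlim a) ((hlim b).congr' (by
      filter_upwards [self_mem_nhdsWithin] with y hy using hconst y hy b a))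
    have hi : ∀ t : ℝ, Integrable fun x => g x *
        (if t < x then ((Real.pi / 2 : ℝ) : ℂ) else ((-(Real.pi / 2) : ℝ) : ℂ)) := by
      intro t
      refine hgi.mul_bdd (c := Real.pi / 2) ?_ (Eventually.of_forall fun x => ?_)
      · exact (Measurable.ite measurableSet_Ioi measurable_const
          measurable_const).aestronglyMeasurable
      · split_ifs <;> rw [Complex.norm_real] <;> simp [abs_of_pos Real.pi_pos]
    rw [← sub_eq_zero, ← integral_sub (hi a) (hi b)] at e1
    have e2 : ∫ x, (Set.Ioc a b).indicator (fun x => (Real.pi : ℂ) * g x) x = 0 := by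
      rw [← e1]
      refine integral_congr_ae (Eventually.of_forall fun x => ?_)
      simp only [Set.indicator, Set.mem_Ioc]
      by_cases h1 : a < x <;> by_cases h2 : b < x
      · simp [h1, h2, not_le.2 h2]
      · simp [h1, h2, not_lt.1 h2]; ring
      · exact absurd (hab.trans_lt h2) h1
      · simp [h1, h2]
    rw [integral_indicator measurableSet_Ioc, integral_const_mul,
      ← intervalIntegral.integral_of_le hab] at e2
    simpa [Real.pi_ne_zero] using e2
  have hgz : g =ᵐ[volume] 0 := by
    have h0 := LocallyIntegrable.ae_hasDerivAt_integral hgi.locallyIntegrable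
    filter_upwards [h0] with x hx
    have hx0 := hx 0
    have e : (fun t : ℝ => ∫ s in (0 : ℝ)..t, g s) = fun _ => 0 := by
      funext t
      rcases le_total 0 t with ht | ht
      · exact hint 0 t ht
      · rw [intervalIntegral.integral_symm, hint t 0 ht, neg_zero]
    rw [e] at hx0
    exact (hx0.unique (hasDerivAt_const x 0))
  filter_upwards [hgz] with x hx
  rw [hg, Pi.zero_apply, div_eq_zero_iff] at hx
  exact hx.resolve_right (ofReal_sub_ne_zero hI x)

end CauchyTransform

/-! ### Hardy functions: contour shifting and the Cauchy formula. -/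

section HardyFunctions

theorem norm_cau_le_of_memLp {f : ℝ → ℂ} (hf : MemLp f 2 volume) {μ : ℂ} (h : μ.im ≠ 0) :
    ‖cau f μ‖ ≤ Real.sqrt (Real.pi / |μ.im|) * (eLpNorm f 2 volume).toReal := by
  rw [← cau_congr hf.coeFn_toLp, ← Lp.norm_toLp f hf]
  exact norm_cau_le _ h

theorem line_mem_upper {y : ℝ} (hy : 0 < y) (x : ℝ) : 0 < ((x : ℂ) + y * Complex.I).im := by
  simpa using hy

theorem continuous_line {g : ℂ → ℂ} (hg : ContinuousOn g {w | 0 < w.im}) {y : ℝ} (hy : 0 < y) :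
    Continuous fun x : ℝ => g (x + y * Complex.I) :=
  hg.comp_continuous (by fun_prop) fun x => line_mem_upper hy x

/-- The integral over horizontal lines of a holomorphic function whose `L¹` norms on the lines of a
strip are bounded does not depend on the line. -/
theorem integral_line_eq {g : ℂ → ℂ} (hg : DifferentiableOn ℂ g {w | 0 < w.im}) {y Y : ℝ}
    (hy : 0 < y) (hyY : y ≤ Y) {K : ℝ≥0∞} (hK : K ≠ ∞)
    (hb : ∀ t ∈ Set.Icc y Y, ∫⁻ x : ℝ, ‖g (x + t * Complex.I)‖ₑ ≤ K) :
    ∫ x : ℝ, g (x + y * Complex.I) = ∫ x : ℝ, g (x + Y * Complex.I) := by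
  have hY : 0 < Y := hy.trans_le hyY
  have hline : ∀ t ∈ Set.Icc y Y, Integrable fun x : ℝ => g (x + t * Complex.I) := fun t ht =>
    ⟨(continuous_line hg.continuousOn (hy.trans_le ht.1)).aestronglyMeasurable,
      (hb t ht).trans_lt hK.lt_top⟩
  have hmeas : AEStronglyMeasurable (fun p : ℝ × ℝ => g (p.1 + p.2 * Complex.I))
      (volume.prod (volume.restrict (Set.Ioc y Y))) := by
    have h1 : ContinuousOn (fun p : ℝ × ℝ => g (p.1 + p.2 * Complex.I))
        (Set.univ ×ˢ Set.Ioc y Y) := by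
      refine hg.continuousOn.comp (by fun_prop) fun p hp => ?_
      exact line_mem_upper (hy.trans hp.2.1) p.1
    have h2 := h1.aestronglyMeasurable (μ := volume) (MeasurableSet.univ.prod measurableSet_Ioc)
    rwa [Measure.volume_eq_prod, ← Measure.prod_restrict, Measure.restrict_univ] at h2
  have hprod : Integrable (fun p : ℝ × ℝ => g (p.1 + p.2 * Complex.I))
      (volume.prod (volume.restrict (Set.Ioc y Y))) := by
    refine ⟨hmeas, ?_⟩
    rw [hasFiniteIntegral_def, lintegral_prod_symm _ hmeas.enorm]
    calc ∫⁻ t in Set.Ioc y Y, ∫⁻ x : ℝ, ‖g (x + t * Complex.I)‖ₑ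
        ≤ ∫⁻ _ in Set.Ioc y Y, K :=
          setLIntegral_mono' measurableSet_Ioc fun t ht => hb t ⟨ht.1.le, ht.2⟩
      _ = K * volume (Set.Ioc y Y) := setLIntegral_const _ _
      _ < ∞ := ENNReal.mul_lt_top hK.lt_top (by simp)
  set A : ℝ → ℂ := fun x => ∫ t in y..Y, g (x + t * Complex.I) with hA
  have hAint : Integrable A := by
    have := hprod.integral_prod_left
    refine this.congr (Eventually.of_forall fun x => ?_)
    simp only [hA]
    rw [intervalIntegral.integral_of_le hyY]
  have hrect : ∀ R : ℝ, (∫ x in (-R)..R, g (x + Y * Complex.I))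
      - (∫ x in (-R)..R, g (x + y * Complex.I)) = Complex.I * (A R - A (-R)) := by
    intro R
    have h1 := Complex.integral_boundary_rect_eq_zero_of_differentiableOn g
      ⟨-R, y⟩ ⟨R, Y⟩ (hg.mono (by
        rintro w ⟨_, hw⟩
        simp only [Set.mem_preimage, Set.uIcc_of_le hyY] at hw
        exact hy.trans_le hw.1))
    simp only [smul_eq_mul] at h1
    simp only [hA]
    linear_combination -h1
  have t1 := (intervalIntegral_tendsto_integral (hline Y ⟨hyY, le_rfl⟩)
    tendsto_neg_atTop_atBot tendsto_id).sub (intervalIntegral_tendsto_integral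
      (hline y ⟨le_rfl, hyY⟩) tendsto_neg_atTop_atBot tendsto_id)
  have hint : Integrable fun R : ℝ => Complex.I * (A R - A (-R)) :=
    (hAint.sub hAint.comp_neg).const_mul _
  -- No pointwise decay of the vertical sides is available. As a function of `R` their contribution
  -- is integrable and also convergent, so its limit is zero.
  have h0 := IntegrableAtFilter.eq_zero_of_tendsto (l := atTop) (hint.integrableAtFilter _) (by
      intro s hs
      rcases mem_atTop_sets.1 hs with ⟨b, hb⟩
      rw [← top_le_iff, ← Real.volume_Ici (a := b)]
      exact measure_mono hb) (t1.congr fun R => hrect R)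
  exact (sub_eq_zero.1 h0).symm

theorem lintegral_enorm_mul_le {f g : ℝ → ℂ} (hf : AEStronglyMeasurable f volume)
    (hg : AEStronglyMeasurable g volume) :
    ∫⁻ x, ‖f x * g x‖ₑ ≤ eLpNorm f 2 volume * eLpNorm g 2 volume := by
  have := eLpNorm_smul_le_mul_eLpNorm (p := 2) (q := 2) (r := 1) hg hf
  rw [eLpNorm_one_eq_lintegral_enorm] at this
  exact this

/-- The line is moved up to infinity, where Cauchy–Schwarz against `1 / (w - μ)` gives decay like `Y
^ (-1/2)`. Stating the relation as a product lets `μ` lie in the upper half-plane, where `h` is a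
quotient with removed singularity. -/
theorem integral_line_eq_zero {Ψ h : ℂ → ℂ} {μ : ℂ} {C : ℝ≥0∞} (hC : C ≠ ∞)
    (hh : DifferentiableOn ℂ h {w | 0 < w.im})
    (hΨ : ∀ y : ℝ, 0 < y → eLpNorm (fun x : ℝ => Ψ (x + y * Complex.I)) 2 volume ≤ C)
    (hrel : ∀ w : ℂ, 0 < w.im → h w * (w - μ) = Ψ w) {y : ℝ} (hy : 0 < y) :
    ∫ x : ℝ, h (x + y * Complex.I) = 0 := by
  have hΨc : ContinuousOn Ψ {w | 0 < w.im} :=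
    (hh.continuousOn.mul (continuousOn_id.sub continuousOn_const)).congr fun w hw => (hrel w hw).symm
  have hlp : ∀ t : ℝ, 0 < t → MemLp (fun x : ℝ => Ψ (x + t * Complex.I)) 2 volume := fun t ht =>
    ⟨(continuous_line hΨc ht).aestronglyMeasurable, (hΨ t ht).trans_lt hC.lt_top⟩
  have heq : ∀ Y : ℝ, y ≤ Y → ∫ x : ℝ, h (x + y * Complex.I) = ∫ x : ℝ, h (x + Y * Complex.I) := by
    intro Y hyY
    -- Where `|x - Re μ| ≤ 1` the factor `w - μ` may vanish, so `h` is bounded by compactness there.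
    obtain ⟨b, hb⟩ := ((isCompact_Icc (a := μ.re - 1) (b := μ.re + 1)).reProdIm
      (isCompact_Icc (a := y) (b := Y))).exists_bound_of_continuousOn (f := h)
      (hh.continuousOn.mono (by rintro w ⟨_, hw⟩; exact hy.trans_le hw.1))
    -- For `|x - Re μ| ≥ 1` one has `|x - Re μ - i| ≤ 2 |x - Re μ| ≤ 2 |w - μ|`, hence the factor
    -- `2`.
    set k : ℝ → ℂ := fun x => 2 * kern (μ.re + Complex.I) x with hk
    have him : ((μ.re : ℂ) + Complex.I).im ≠ 0 := by simp
    have hklp : MemLp k 2 volume := (memLp_kern _).const_mul 2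
    refine integral_line_eq hh hy hyY
      (K := ENNReal.ofReal b * volume (Set.Icc (μ.re - 1) (μ.re + 1)) + C * eLpNorm k 2 volume) ?_ ?_
    · refine ENNReal.add_ne_top.2 ⟨ENNReal.mul_ne_top (by simp) (by simp),
        ENNReal.mul_ne_top hC hklp.2.ne⟩
    · intro t ht
      have ht0 : 0 < t := hy.trans_le ht.1
      have hpt : ∀ x : ℝ, ‖h (x + t * Complex.I)‖ₑ ≤
          (Set.Icc (μ.re - 1) (μ.re + 1)).indicator (fun _ => ENNReal.ofReal b) x
            + ‖Ψ (x + t * Complex.I) * k x‖ₑ := by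
        intro x
        by_cases hx : x ∈ Set.Icc (μ.re - 1) (μ.re + 1)
        · rw [Set.indicator_of_mem hx, ← ofReal_norm]
          refine le_add_right (ENNReal.ofReal_le_ofReal (hb _ ⟨?_, ?_⟩))
          · simpa using hx
          · simpa using ht
        · rw [Set.indicator_of_notMem hx, zero_add, ← ofReal_norm, ← ofReal_norm]
          refine ENNReal.ofReal_le_ofReal ?_
          rw [← hrel _ (line_mem_upper ht0 x), mul_assoc, norm_mul]
          refine le_mul_of_one_le_right (norm_nonneg _) ?_
          have hx1 : 1 ≤ |x - μ.re| := by
            by_contra hlt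
            have := abs_lt.1 (not_le.1 hlt)
            exact hx ⟨by linarith [this.1], by linarith [this.2]⟩
          have h1 : |x - μ.re| ≤ ‖(x : ℂ) + t * Complex.I - μ‖ := by
            simpa using Complex.abs_re_le_norm ((x : ℂ) + t * Complex.I - μ)
          have h2 : ‖(x : ℂ) - (μ.re + Complex.I)‖ ≤ 2 * |x - μ.re| := by
            have e : (x : ℂ) - (μ.re + Complex.I) = ((x - μ.re : ℝ) : ℂ) - Complex.I := by
              push_cast; ring
            rw [e]
            refine (norm_sub_le _ _).trans ?_
            rw [Complex.norm_I, Complex.norm_real, Real.norm_eq_abs]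
            linarith
          have h3 : 0 < ‖(x : ℂ) - (μ.re + Complex.I)‖ :=
            norm_pos_iff.2 (ofReal_sub_ne_zero him x)
          rw [hk, norm_mul, norm_mul, kern_of_im_ne him, norm_inv, Complex.norm_ofNat,
            ← mul_assoc, ← div_eq_mul_inv, le_div_iff₀ h3]
          linarith
      calc ∫⁻ x : ℝ, ‖h (x + t * Complex.I)‖ₑ
          ≤ ∫⁻ x : ℝ, ((Set.Icc (μ.re - 1) (μ.re + 1)).indicator (fun _ => ENNReal.ofReal b) x
            + ‖Ψ (x + t * Complex.I) * k x‖ₑ) := lintegral_mono hpt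
        _ = _ + _ := lintegral_add_left
            (measurable_const.indicator measurableSet_Icc) _
        _ ≤ _ := by
            refine add_le_add (le_of_eq ?_) ?_
            · rw [lintegral_indicator measurableSet_Icc, setLIntegral_const]
            · refine (lintegral_enorm_mul_le (hlp t ht0).1 hklp.1).trans ?_
              gcongr
              exact hΨ t ht0
  have hbound : ∀ Y : ℝ, max y (μ.im + 1) ≤ Y →
      ‖∫ x : ℝ, h (x + y * Complex.I)‖ ≤ Real.sqrt (Real.pi / (Y - μ.im)) * C.toReal := by
    intro Y hY
    have hY0 : 0 < Y := hy.trans_le ((le_max_left _ _).trans hY)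
    have hYμ : 0 < Y - μ.im := by linarith [(le_max_right _ _).trans hY]
    have him : (μ - Y * Complex.I).im ≠ 0 := by simp; linarith
    have e : ∫ x : ℝ, h (x + Y * Complex.I) = cau (fun x : ℝ => Ψ (x + Y * Complex.I))
        (μ - Y * Complex.I) := by
      refine integral_congr_ae (Eventually.of_forall fun x => ?_)
      have h0 := ofReal_sub_ne_zero him x
      have h1 := hrel _ (line_mem_upper hY0 x)
      simp only
      rw [eq_div_iff h0, ← h1]
      ring
    rw [heq Y ((le_max_left _ _).trans hY), e]
    refine (norm_cau_le_of_memLp (hlp Y hY0) him).trans ?_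
    have e2 : |(μ - Y * Complex.I).im| = Y - μ.im := by
      have : (μ - Y * Complex.I).im = -(Y - μ.im) := by simp
      rw [this, abs_neg, abs_of_pos hYμ]
    rw [e2]
    gcongr
    exact hΨ Y hY0
  have hlim : Tendsto (fun Y : ℝ => Real.sqrt (Real.pi / (Y - μ.im)) * C.toReal) atTop (𝓝 0) := by
    have h1 : Tendsto (fun Y : ℝ => Real.pi / (Y - μ.im)) atTop (𝓝 0) :=
      tendsto_const_nhds.div_atTop (tendsto_atTop_add_const_right _ _ tendsto_id)
    have h2 := (Real.continuous_sqrt.tendsto 0).comp h1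
    simpa using h2.mul_const C.toReal
  have : ‖∫ x : ℝ, h (x + y * Complex.I)‖ ≤ 0 :=
    ge_of_tendsto hlim (by filter_upwards [eventually_ge_atTop (max y (μ.im + 1))] with Y hY
                           using hbound Y hY)
  exact norm_le_zero_iff.1 this

namespace IsHardyExtension

variable {Φ : ℂ → ℂ} {φ : L2R}

theorem memLp_line (hφ : IsHardyExtension Φ φ) {y : ℝ} (hy : 0 < y) :
    MemLp (fun x : ℝ => Φ (x + y * Complex.I)) 2 volume := by
  obtain ⟨hd, ⟨C, hC, hb⟩, -⟩ := hφ
  exact ⟨(continuous_line hd.continuousOn hy).aestronglyMeasurable, (hb y hy).trans_lt hC.lt_top⟩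

theorem tendsto_cau_line (hφ : IsHardyExtension Φ φ) {μ : ℂ} (hμ : μ.im ≠ 0) :
    Tendsto (fun y : ℝ => cau (fun x : ℝ => Φ (x + y * Complex.I)) μ) (𝓝[>] 0) (𝓝 (cau φ μ)) := by
  rw [tendsto_iff_norm_sub_tendsto_zero]
  have h1 := ((ENNReal.tendsto_toReal ENNReal.zero_ne_top).comp hφ.2.2).const_mul
    (Real.sqrt (Real.pi / |μ.im|))
  rw [ENNReal.toReal_zero, mul_zero] at h1
  refine squeeze_zero' (Eventually.of_forall fun _ => norm_nonneg _) ?_ h1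
  filter_upwards [self_mem_nhdsWithin] with y hy
  have hm := hφ.memLp_line hy
  have e : cau (fun x : ℝ => Φ (x + y * Complex.I)) μ - cau φ μ
      = cau (fun x : ℝ => Φ (x + y * Complex.I) - φ x) μ := by
    rw [cau, cau, cau, ← integral_sub (integrable_div_of_memLp hm hμ)
      (integrable_div_of_memLp (Lp.memLp φ) hμ)]
    simp only [sub_div]
  rw [e]
  exact norm_cau_le_of_memLp (hm.sub (Lp.memLp φ)) hμ

theorem cau_line_eq_zero (hφ : IsHardyExtension Φ φ) {μ : ℂ} {y : ℝ} (hy : 0 < y)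
    (hμ : μ.im + y < 0) : cau (fun x : ℝ => Φ (x + y * Complex.I)) μ = 0 := by
  obtain ⟨hd, ⟨C, hC, hb⟩, -⟩ := hφ
  set ν : ℂ := μ + y * Complex.I with hν
  have hνim : ν.im < 0 := by simpa [hν] using hμ
  have hne : ∀ w : ℂ, 0 < w.im → w - ν ≠ 0 := by
    intro w hw h0
    rw [sub_eq_zero] at h0
    rw [h0] at hw
    linarith
  have := integral_line_eq_zero (Ψ := Φ) (h := fun w => Φ w / (w - ν)) (μ := ν) hC
    (hd.div (differentiableOn_id.sub (differentiableOn_const _)) hne) hb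
    (fun w hw => div_mul_cancel₀ _ (hne w hw)) hy
  rw [← this]
  refine integral_congr_ae (Eventually.of_forall fun x => ?_)
  simp only [hν]
  congr 1
  ring

theorem cau_eq_zero (hφ : IsHardyExtension Φ φ) {μ : ℂ} (hμ : μ.im < 0) : cau φ μ = 0 := by
  refine tendsto_nhds_unique (hφ.tendsto_cau_line hμ.ne) (tendsto_const_nhds.congr' ?_)
  filter_upwards [Ioo_mem_nhdsGT (show (0 : ℝ) < -μ.im by linarith)] with y hy
  exact (hφ.cau_line_eq_zero hy.1 (by linarith [hy.2])).symm

/-- Subtracting the multiple of `1 / (w + i)` that cancels the value at `ν = μ + i y` makes the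
quotient by `w - ν` holomorphic, so its line integral vanishes. The constant `2πi` comes from the
subtracted term, as `sgm μ - sgm κ`. -/
theorem cau_line_eq (hφ : IsHardyExtension Φ φ) {μ : ℂ} {y : ℝ} (hy : 0 < y)
    (hμ : 0 < μ.im) : cau (fun x : ℝ => Φ (x + y * Complex.I)) μ
      = 2 * Real.pi * Complex.I * Φ (μ + y * Complex.I) := by
  have hm := hφ.memLp_line hy
  obtain ⟨hd, ⟨C, hC, hb⟩, -⟩ := hφ
  set ν : ℂ := μ + y * Complex.I with hν
  have hνim : 0 < ν.im := by simpa [hν] using add_pos hμ hy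
  -- On the line of height `y` one has `w + i = x - κ`, so the added pole appears in the lower
  -- half-plane.
  set κ : ℂ := -Complex.I - y * Complex.I with hκ
  have hκim : κ.im < 0 := by simp [hκ]; linarith
  set a : ℂ := Φ ν * (ν + Complex.I) with ha
  have hne : ∀ w : ℂ, 0 < w.im → w + Complex.I ≠ 0 := by
    intro w hw h0
    have := congrArg Complex.im h0
    simp at this
    linarith
  set Ψ : ℂ → ℂ := fun w => Φ w - a / (w + Complex.I) with hΨ
  have hΨd : DifferentiableOn ℂ Ψ {w | 0 < w.im} :=
    hd.sub ((differentiableOn_const _).div (differentiableOn_id.add (differentiableOn_const _)) hne)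
  have hΨν : Ψ ν = 0 := by
    have := hne ν hνim
    simp only [hΨ, ha]
    rw [mul_div_cancel_right₀ _ this, sub_self]
  have hopen : IsOpen {w : ℂ | 0 < w.im} := isOpen_lt continuous_const Complex.continuous_im
  have key := integral_line_eq_zero (Ψ := Ψ) (h := dslope Ψ ν) (μ := ν)
    (C := C + ENNReal.ofReal ‖a‖ * eLpNorm (kern (-Complex.I)) 2 volume)
    (ENNReal.add_ne_top.2 ⟨hC, ENNReal.mul_ne_top (by simp) (memLp_kern _).2.ne⟩)
    ((Complex.differentiableOn_dslope (hopen.mem_nhds hνim)).2 hΨd) ?_ ?_ hy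
  · have hμ1 : μ.im ≠ 0 := hμ.ne'
    have e : ∫ x : ℝ, dslope Ψ ν (x + y * Complex.I)
        = ∫ x : ℝ, (Φ (x + y * Complex.I) / ((x : ℂ) - μ)
          - Φ ν * (((x : ℂ) - μ)⁻¹ - ((x : ℂ) - κ)⁻¹)) := by
      have hne' : ∀ᵐ x : ℝ, x ≠ ν.re := by simp [ae_iff, measure_singleton]
      refine integral_congr_ae ?_
      filter_upwards [hne'] with x hx
      have hxν : (x : ℂ) + y * Complex.I ≠ ν := by
        intro h; apply hx; simpa using congrArg Complex.re h
      rw [dslope_of_ne _ hxν, slope_def_field, hΨν]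
      have n1 := ofReal_sub_ne_zero hμ1 x
      have n2 := ofReal_sub_ne_zero hκim.ne x
      have n3 : (x : ℂ) + y * Complex.I - ν = x - μ := by rw [hν]; ring
      have n4 : (x : ℂ) + y * Complex.I + Complex.I = x - κ := by rw [hκ]; ring
      have n5 : ν + Complex.I = μ - κ := by rw [hν, hκ]; ring
      simp only [hΨ, ha]
      rw [n3, n4, n5]
      field_simp
      ring
    have hi2 : Integrable fun x : ℝ => Φ ν * (((x : ℂ) - μ)⁻¹ - ((x : ℂ) - κ)⁻¹) := by
      refine (((memLp_inv_ofReal_sub hμ1).integrable_mul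
        (memLp_inv_ofReal_sub hκim.ne)).const_mul (Φ ν * (μ - κ))).congr
        (Eventually.of_forall fun x => ?_)
      have n1 := ofReal_sub_ne_zero hμ1 x
      have n2 := ofReal_sub_ne_zero hκim.ne x
      simp only [Pi.mul_apply]
      field_simp
      ring
    rw [e, integral_sub (integrable_div_of_memLp hm hμ1) hi2, integral_const_mul,
      integral_inv_sub_sub_inv_sub hμ1 hκim.ne, sgm, sgm, if_pos hμ, if_neg (by linarith),
      sub_eq_zero] at key
    rw [cau, key]
    ring
  · intro t ht
    have e : (fun x : ℝ => Ψ (x + t * Complex.I)) = (fun x : ℝ => Φ (x + t * Complex.I))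
        - fun x : ℝ => a / (x + t * Complex.I + Complex.I) := rfl
    rw [e]
    refine (eLpNorm_sub_le (continuous_line hd.continuousOn ht).aestronglyMeasurable
      (Continuous.aestronglyMeasurable ?_) (by norm_num)).trans ?_
    · exact continuous_const.div (by fun_prop) fun x => hne _ (line_mem_upper ht x)
    · refine add_le_add (hb t ht) (eLpNorm_le_mul_eLpNorm_of_ae_le_mul
        (Eventually.of_forall fun x => ?_) _)
      rw [div_eq_mul_inv, norm_mul, norm_inv, kern_of_im_ne (by simp), norm_inv]
      have h0 : 0 < ‖(x : ℂ) - -Complex.I‖ := norm_pos_iff.2 (ofReal_sub_ne_zero (by simp) x)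
      gcongr
      rw [← sq_le_sq₀ (norm_nonneg _) (norm_nonneg _), norm_sq_ofReal_sub,
        ← Complex.normSq_eq_norm_sq, Complex.normSq_apply]
      simp
      nlinarith
  · intro w hw
    have := sub_smul_dslope Ψ ν w
    rw [hΨν, sub_zero, smul_eq_mul] at this
    rw [← this]; ring

theorem cau_eq (hφ : IsHardyExtension Φ φ) {μ : ℂ} (hμ : 0 < μ.im) :
    cau φ μ = 2 * Real.pi * Complex.I * Φ μ := by
  refine tendsto_nhds_unique (hφ.tendsto_cau_line hμ.ne') ?_
  have hopen : IsOpen {w : ℂ | 0 < w.im} := isOpen_lt continuous_const Complex.continuous_im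
  have h1 : ContinuousAt Φ μ := (hφ.1.differentiableAt (hopen.mem_nhds hμ)).continuousAt
  have h2 : Tendsto (fun y : ℝ => μ + y * Complex.I) (𝓝[>] 0) (𝓝 μ) := by
    have : Continuous fun y : ℝ => μ + y * Complex.I := by fun_prop
    simpa using (this.tendsto 0).mono_left (nhdsWithin_le_nhds (s := Set.Ioi 0))
  refine ((h1.tendsto.comp h2).const_mul (2 * Real.pi * Complex.I)).congr' ?_
  filter_upwards [self_mem_nhdsWithin] with y hy
  exact (hφ.cau_line_eq hy hμ).symm

end IsHardyExtension

theorem cau_conj (f : ℝ → ℂ) (μ : ℂ) :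
    cau (fun x => conj (f x)) μ = conj (cau f (conj μ)) := by
  rw [cau, cau, ← integral_conj]
  simp

theorem IsHardyExtension.cau_conj_eq_zero {Φ : ℂ → ℂ} {φ : L2R} (hφ : IsHardyExtension Φ φ) {μ : ℂ}
    (hμ : 0 < μ.im) : cau (fun x => conj (φ x)) μ = 0 := by
  rw [cau_conj, hφ.cau_eq_zero (by simpa using hμ), map_zero]

theorem IsHardyExtension.cau_conj_eq {Φ : ℂ → ℂ} {φ : L2R} (hφ : IsHardyExtension Φ φ) {μ : ℂ}
    (hμ : μ.im < 0) : cau (fun x => conj (φ x)) μ = -(2 * Real.pi * Complex.I) * lowerExt Φ μ := by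
  rw [cau_conj, hφ.cau_eq (by simpa using hμ), lowerExt]
  simp only [map_mul, Complex.conj_I, Complex.conj_ofReal, map_ofNat]
  ring

end HardyFunctions

/-! ### The resolvent set of `A_B` and the kernels of `Ã* - δ`. -/

section Resolvent

theorem HasGammaOne.unique {u : L2R} {a b : ℂ} (ha : HasGammaOne u a) (hb : HasGammaOne u b) :
    a = b := tendsto_nhds_unique ha hb

theorem eq_zero_of_memLp_const {c : ℂ} (h : MemLp (fun _ : ℝ => c) 2 volume) : c = 0 := by
  rw [memLp_const_iff (by norm_num) (by norm_num)] at h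
  simpa using h

theorem HasGammaTwo.unique {u : L2R} {a b : ℂ} (ha : HasGammaTwo u a) (hb : HasGammaTwo u b) :
    a = b := by
  refine (sub_eq_zero.1 (eq_zero_of_memLp_const ((ha.sub hb).ae_eq ?_))).symm
  exact Eventually.of_forall fun x => by simp

theorem HasGammaOne.sub {u v : L2R} {a b : ℂ} (hu : HasGammaOne u a) (hv : HasGammaOne v b) :
    HasGammaOne (u - v) (a - b) := by
  have := hu.add (hv.smul (-1))
  rwa [neg_one_smul, neg_one_mul, ← sub_eq_add_neg, ← sub_eq_add_neg] at this

variable {φ ψ : L2R} {B : ℂ}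

theorem hasGammaTwo_of_ae {u w : L2R} {c k : ℂ}
    (h : w =ᵐ[volume] fun x : ℝ => (x : ℂ) * u x - c + k * ψ x) : HasGammaTwo u c := by
  refine ((Lp.memLp w).sub ((Lp.memLp ψ).const_mul k)).ae_eq ?_
  filter_upwards [h] with x hx
  simp only [Pi.sub_apply, hx]
  ring

theorem ae_sub_smul_iff {u v w : L2R} {δ c k : ℂ} (hv : w - δ • u = v) :
    (w =ᵐ[volume] fun x : ℝ => (x : ℂ) * u x - c + k * ψ x) ↔
      v =ᵐ[volume] fun x : ℝ => ((x : ℂ) - δ) * u x - c + k * ψ x := by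
  have h1 : v =ᵐ[volume] fun x => w x - δ * u x := by
    rw [← hv]
    filter_upwards [Lp.coeFn_sub w (δ • u), Lp.coeFn_smul δ u] with x h2 h3
    rw [h2, Pi.sub_apply, h3, Pi.smul_apply, smul_eq_mul]
  constructor <;> intro h <;> filter_upwards [h, h1] with x h2 h3
  · rw [h3, h2]; ring
  · rw [h2] at h3; linear_combination -h3

/-- `(A_B - δ) u = v` in explicit form. -/
theorem exists_opB_iff {u v : L2R} {δ : ℂ} :
    (∃ w : (opB φ ψ B).domain, (w : L2R) = u ∧ opB φ ψ B w - δ • u = v) ↔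
      ∃ c : ℂ, (v =ᵐ[volume] fun x : ℝ => ((x : ℂ) - δ) * u x - c + inner ℂ φ u * ψ x) ∧
        HasGammaOne u (B * c) := by
  constructor
  · rintro ⟨w, rfl, hw⟩
    have hmax : opB φ ψ B w = maxOp φ ψ ⟨w, w.2.2⟩ := LinearPMap.domRestrict_apply rfl
    obtain ⟨c, hc⟩ := (maxOp_graph_iff φ ψ w (opB φ ψ B w)).1 (by
      rw [hmax]; exact LinearPMap.mem_graph _ ⟨(w : L2R), w.2.2⟩)
    obtain ⟨c', h2, h1⟩ := w.2.1
    obtain rfl := h2.unique (hasGammaTwo_of_ae hc)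
    exact ⟨c', (ae_sub_smul_iff hw).1 hc, h1⟩
  · rintro ⟨c, hc, h1⟩
    have hc' := (ae_sub_smul_iff (w := v + δ • u) (by abel)).2 hc
    obtain ⟨w, hw, hw'⟩ := (LinearPMap.mem_graph_iff _).1
      ((maxOp_graph_iff φ ψ u (v + δ • u)).2 ⟨c, hc'⟩)
    subst hw
    refine ⟨⟨w, ⟨c, hasGammaTwo_of_ae hc', h1⟩, w.2⟩, rfl, ?_⟩
    have hmax : opB φ ψ B ⟨w, ⟨c, hasGammaTwo_of_ae hc', h1⟩, w.2⟩ = maxOp φ ψ w :=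
      LinearPMap.domRestrict_apply rfl
    rw [hmax, hw', add_sub_cancel_right]

theorem mem_solutionRange_iff {u : L2R} {δ : ℂ} :
    u ∈ solutionRange φ ψ B δ ↔
      ∃ c : ℂ, ((0 : L2R) =ᵐ[volume]
        fun x : ℝ => ((x : ℂ) - δ) * u x - c + inner ℂ φ u * ψ x) ∧ ∃ a, HasGammaOne u a := by
  constructor
  · rintro ⟨v, rfl, hv, f, c', -, h1⟩
    obtain ⟨c, hc⟩ := (maxOp_graph_iff φ ψ v (maxOp φ ψ v)).1 (LinearPMap.mem_graph _ v)
    exact ⟨c, (ae_sub_smul_iff (by rw [hv, sub_self])).1 hc, _, h1⟩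
  · rintro ⟨c, hc, a, h1⟩
    have hc' := (ae_sub_smul_iff (w := δ • u) (by rw [sub_self])).2 hc
    obtain ⟨w, hw, hw'⟩ := (LinearPMap.mem_graph_iff _).1
      ((maxOp_graph_iff φ ψ u (δ • u)).2 ⟨c, hc'⟩)
    exact ⟨w, hw, hw', a - B * c, c, hasGammaTwo_of_ae hc', by simpa using h1⟩

theorem cau_coe_zero {δ : ℂ} (hδ : δ.im ≠ 0) : cau (0 : L2R) δ = 0 := by
  rw [cau_eq_inner 0 hδ, inner_zero_right]

theorem inner_rk (φ : L2R) {δ : ℂ} (hδ : δ.im ≠ 0) :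
    inner ℂ φ (rk δ) = cau (fun x => conj (φ x)) δ := by
  rw [inner_eq_integral]
  refine integral_congr_ae ?_
  filter_upwards [coeFn_rk hδ] with x hx
  rw [hx, div_eq_mul_inv, mul_comm]

theorem inner_Res (φ ψ : L2R) {δ : ℂ} (hδ : δ.im ≠ 0) :
    inner ℂ φ (Res δ ψ) = funD φ ψ δ - 1 := by
  rw [inner_eq_integral, funD, add_sub_cancel_left]
  refine integral_congr_ae ?_
  filter_upwards [coeFn_Res hδ ψ] with x hx
  rw [hx]; ring

theorem ae_eq_iff_eq_Res {u v : L2R} {δ c k : ℂ} (hδ : δ.im ≠ 0) :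
    (v =ᵐ[volume] fun x : ℝ => ((x : ℂ) - δ) * u x - c + k * ψ x) ↔
      u = Res δ v + c • rk δ - k • Res δ ψ := by
  have h1 : (Res δ v + c • rk δ - k • Res δ ψ : L2R) =ᵐ[volume]
      fun x : ℝ => (v x + c - k * ψ x) / ((x : ℂ) - δ) := by
    filter_upwards [Lp.coeFn_sub (Res δ v + c • rk δ) (k • Res δ ψ),
      Lp.coeFn_add (Res δ v) (c • rk δ), Lp.coeFn_smul c (rk δ), Lp.coeFn_smul k (Res δ ψ),
      coeFn_Res hδ v, coeFn_Res hδ ψ, coeFn_rk hδ] with x e1 e2 e3 e4 e5 e6 e7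
    rw [e1, Pi.sub_apply, e2, Pi.add_apply, e3, e4, Pi.smul_apply, Pi.smul_apply, e5, e6, e7]
    simp only [smul_eq_mul]
    ring
  constructor
  · intro h
    refine Lp.ext ?_
    filter_upwards [h, h1] with x h2 h3
    rw [h3, h2, eq_div_iff (ofReal_sub_ne_zero hδ x)]
    ring
  · intro h
    rw [h]
    filter_upwards [h1] with x h2
    rw [h2, mul_div_cancel₀ _ (ofReal_sub_ne_zero hδ x)]
    ring

theorem inner_combination {v : L2R} {δ c k : ℂ} (hδ : δ.im ≠ 0) :
    inner ℂ φ (Res δ v + c • rk δ - k • Res δ ψ) = inner ℂ φ (Res δ v)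
      + c * cau (fun x => conj (φ x)) δ - k * (funD φ ψ δ - 1) := by
  rw [inner_sub_right, inner_add_right, inner_smul_right, inner_smul_right, inner_rk φ hδ,
    inner_Res φ ψ hδ]

theorem hasGammaOne_combination {v : L2R} {δ : ℂ} (c k : ℂ) (hδ : δ.im ≠ 0) :
    HasGammaOne (Res δ v + c • rk δ - k • Res δ ψ) (cau v δ + c * sgm δ - k * cau ψ δ) :=
  ((hasGammaOne_Res hδ v).add ((hasGammaOne_rk hδ).smul c)).sub ((hasGammaOne_Res hδ ψ).smul k)

/-- For nonreal `δ`, solving `(A_B - δ) u = v` amounts to solving a `2 × 2` linear system. -/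
theorem exists_opB_iff_of_im_ne {u v : L2R} {δ : ℂ} (hδ : δ.im ≠ 0) :
    (∃ w : (opB φ ψ B).domain, (w : L2R) = u ∧ opB φ ψ B w - δ • u = v) ↔
      ∃ c k : ℂ, u = Res δ v + c • rk δ - k • Res δ ψ ∧
        k * funD φ ψ δ - c * cau (fun x => conj (φ x)) δ = inner ℂ φ (Res δ v) ∧
        c * (B - sgm δ) + k * cau ψ δ = cau v δ := by
  rw [exists_opB_iff]
  constructor
  · rintro ⟨c, h, h1⟩
    have hu := (ae_eq_iff_eq_Res hδ).1 h
    refine ⟨c, inner ℂ φ u, hu, ?_, ?_⟩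
    · have := inner_combination (φ := φ) (ψ := ψ) (v := v) (c := c) (k := inner ℂ φ u) hδ
      rw [← hu] at this
      linear_combination this
    · have := hasGammaOne_combination (ψ := ψ) (v := v) c (inner ℂ φ u) hδ
      rw [← hu] at this
      linear_combination h1.unique this
  · rintro ⟨c, k, hu, e1, e2⟩
    have hk : inner ℂ φ u = k := by
      rw [hu, inner_combination hδ]; linear_combination -e1
    refine ⟨c, (ae_eq_iff_eq_Res hδ).2 (by rw [hk]; exact hu), ?_⟩
    rw [hu]
    convert hasGammaOne_combination (ψ := ψ) (v := v) c k hδ using 1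
    linear_combination e2

theorem mem_solutionRange_iff_of_im_ne {u : L2R} {δ : ℂ} (hδ : δ.im ≠ 0) :
    u ∈ solutionRange φ ψ B δ ↔ ∃ c k : ℂ, u = c • rk δ - k • Res δ ψ ∧
        k * funD φ ψ δ = c * cau (fun x => conj (φ x)) δ := by
  rw [mem_solutionRange_iff]
  constructor
  · rintro ⟨c, h, -⟩
    have hu := (ae_eq_iff_eq_Res hδ).1 h
    refine ⟨c, inner ℂ φ u, by simpa using hu, ?_⟩
    have := inner_combination (φ := φ) (ψ := ψ) (v := 0) (c := c) (k := inner ℂ φ u) hδ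
    rw [← hu, map_zero, inner_zero_right] at this
    linear_combination this
  · rintro ⟨c, k, hu, e1⟩
    have hu' : u = Res δ 0 + c • rk δ - k • Res δ ψ := by simpa using hu
    have hk : inner ℂ φ u = k := by
      rw [hu', inner_combination hδ, map_zero, inner_zero_right]; linear_combination -e1
    refine ⟨c, (ae_eq_iff_eq_Res hδ).2 (by rw [hk]; exact hu'), _,
      hu' ▸ hasGammaOne_combination (ψ := ψ) (v := 0) c k hδ⟩

theorem mem_resolventSet_iff {T : L2R →ₗ.[ℂ] L2R} {δ : ℂ} :
    δ ∈ resolventSet T ↔ ∃ R : L2R →L[ℂ] L2R, ∀ u v : L2R,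
      (∃ w : T.domain, (w : L2R) = u ∧ T w - δ • u = v) ↔ u = R v := by
  constructor
  · rintro ⟨R, h1, h2⟩
    refine ⟨R, fun u v => ⟨?_, ?_⟩⟩
    · rintro ⟨w, rfl, rfl⟩
      exact (h1 w).symm
    · rintro rfl
      obtain ⟨w, hw, hw'⟩ := h2 v
      exact ⟨w, hw, by rw [← hw, hw']⟩
  · rintro ⟨R, h⟩
    refine ⟨R, fun u => ((h _ _).1 ⟨u, rfl, rfl⟩).symm, fun v => ?_⟩
    obtain ⟨w, hw, hw'⟩ := (h (R v) v).2 rfl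
    exact ⟨w, hw, by rw [hw, hw']⟩

theorem mem_resolventSet_iff_of_im_ne {δ : ℂ} (hδ : δ.im ≠ 0) (hB : B - sgm δ ≠ 0)
    (h0 : cau ψ δ * cau (fun x => conj (φ x)) δ = 0) :
    δ ∈ resolventSet (opB φ ψ B) ↔ funD φ ψ δ ≠ 0 := by
  rw [mem_resolventSet_iff]
  set D := funD φ ψ δ
  set E := B - sgm δ with hE
  set β := cau (fun x => conj (φ x)) δ with hβ
  set γ := cau ψ δ with hγ
  constructor
  · rintro ⟨R, hR⟩ hD
    have e1 := (hR 0 0).1 ((exists_opB_iff_of_im_ne hδ).2 ⟨0, 0, by simp, by simp, by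
      rw [cau_coe_zero hδ]; ring⟩)
    -- If `D = 0`, then `(c, k) = (γ, -E)` solves the homogeneous system because `γ β = 0`. The
    -- corresponding vector has inner product `-E ≠ 0` with `φ`, so injectivity fails.
    have e2 := (hR (γ • rk δ - (-E) • Res δ ψ) 0).1 ((exists_opB_iff_of_im_ne hδ).2
      ⟨γ, -E, by simp, ?_, ?_⟩)
    · have h3 := inner_combination (φ := φ) (ψ := ψ) (v := 0) (c := γ) (k := -E) hδ
      rw [map_zero, zero_add, e2, ← e1, inner_zero_right, zero_add] at h3
      apply hB
      linear_combination h3 + h0 + E * hD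
    · rw [map_zero, inner_zero_right]
      linear_combination -E * hD - h0
    · rw [cau_coe_zero hδ]; ring
  · intro hD
    set e : L2R →L[ℂ] ℂ := (innerSL ℂ φ).comp (Res δ) with he
    set a : L2R →L[ℂ] ℂ := innerSL ℂ (rk (conj δ)) with ha
    have hav : ∀ v : L2R, cau v δ = a v := fun v => cau_eq_inner v hδ
    -- Cramer's rule; since `γ β = 0`, the determinant is `-D E`.
    refine ⟨Res δ + ((D * E)⁻¹ • (D • a - γ • e)).smulRight (rk δ)
      - ((D * E)⁻¹ • (E • e + β • a)).smulRight (Res δ ψ), fun u v => ?_⟩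
    have hRv : (Res δ + ((D * E)⁻¹ • (D • a - γ • e)).smulRight (rk δ)
      - ((D * E)⁻¹ • (E • e + β • a)).smulRight (Res δ ψ)) v = Res δ v +
        ((D * E)⁻¹ * (D * a v - γ * e v)) • rk δ
        - ((D * E)⁻¹ * (E * e v + β * a v)) • Res δ ψ := by
      simp [mul_add]
    rw [hRv, exists_opB_iff_of_im_ne hδ]
    have hev : inner ℂ φ (Res δ v) = e v := rfl
    constructor
    · rintro ⟨c, k, hu, e1, e2⟩
      rw [hav v] at e2
      rw [hev] at e1
      have hc : c = (D * E)⁻¹ * (D * a v - γ * e v) := by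
        rw [eq_inv_mul_iff_mul_eq₀ (mul_ne_zero hD hB)]
        linear_combination D * e2 - γ * e1 - c * h0
      have hk : k = (D * E)⁻¹ * (E * e v + β * a v) := by
        rw [eq_inv_mul_iff_mul_eq₀ (mul_ne_zero hD hB)]
        linear_combination E * e1 + β * e2 - k * h0
      rw [← hc, ← hk]; exact hu
    · intro hu
      refine ⟨_, _, hu, ?_, ?_⟩
      · rw [hev]
        field_simp
        linear_combination e v * h0
      · rw [hav v]
        field_simp
        linear_combination a v * h0

/-- Step functions on three adjacent intervals form a three-dimensional space, and zero mean and
orthogonality to `φ` are two linear conditions. Such an `f` satisfies every boundary condition, with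
`c_f = 0`, and `Ã*` acts on it as multiplication by `x`: it is an approximate eigenvector at `δ`. -/
theorem exists_localized (φ : L2R) (δ : ℝ) {ε : ℝ} (hε : 0 < ε) :
    ∃ f : L2R, f ≠ 0 ∧ (∀ᵐ x : ℝ, f x ≠ 0 → |x - δ| ≤ ε) ∧ HasGammaOne f 0 ∧
      inner ℂ φ f = 0 := by
  set η : ℝ := ε / 3 with hη
  have hη0 : 0 < η := by positivity
  set I : Fin 3 → Set ℝ := fun j => Set.Ioc (δ + j * η) (δ + (j + 1) * η) with hI
  have hIm : ∀ j, MeasurableSet (I j) := fun j => measurableSet_Ioc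
  have hIv : ∀ j, volume (I j) = ENNReal.ofReal η := fun j => by
    simp only [hI, Real.volume_Ioc]; congr 1; ring
  set e : Fin 3 → L2R := fun j => indicatorConstLp 2 (hIm j) (by simp [hIv]) (1 : ℂ) with he
  have heco : ∀ᵐ x : ℝ, ∀ j, e j x = (I j).indicator (fun _ => (1 : ℂ)) x := by
    rw [ae_all_iff]; exact fun j => indicatorConstLp_coeFn
  let V : (Fin 3 → ℂ) →ₗ[ℂ] L2R := Fintype.linearCombination ℂ e
  have hVco : ∀ a : Fin 3 → ℂ, ∀ᵐ x : ℝ, V a x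
      = ∑ j, a j * (I j).indicator (fun _ => (1 : ℂ)) x := by
    intro a
    have h1 : V a = ∑ j, a j • e j := Fintype.linearCombination_apply ..
    have h2 : ∀ᵐ x : ℝ, ∀ j, (a j • e j : L2R) x = a j * e j x := by
      rw [ae_all_iff]
      intro j
      filter_upwards [Lp.coeFn_smul (a j) (e j)] with x hx
      rw [hx, Pi.smul_apply, smul_eq_mul]
    rw [h1, Fin.sum_univ_three]
    filter_upwards [heco, h2, Lp.coeFn_add (a 0 • e 0 + a 1 • e 1) (a 2 • e 2),
      Lp.coeFn_add (a 0 • e 0) (a 1 • e 1)] with x h3 h4 h5 h6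
    rw [h5, Pi.add_apply, h6, Pi.add_apply, h4, h4, h4, h3, h3, h3, Fin.sum_univ_three]
  let T : (Fin 3 → ℂ) →ₗ[ℂ] ℂ × ℂ :=
    (Fintype.linearCombination ℂ (fun _ => (1 : ℂ))).prod ((innerSL ℂ φ).toLinearMap.comp V)
  have hker : LinearMap.ker T ≠ ⊥ := LinearMap.ker_ne_bot_of_finrank_lt (by simp)
  obtain ⟨a, haT, ha0⟩ := Submodule.exists_mem_ne_zero_of_ne_bot hker
  have haT' : T a = 0 := haT
  have hT1 : ∑ j, a j = 0 := by
    have : ∑ j, a j • (1 : ℂ) = 0 := by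
      rw [← Fintype.linearCombination_apply]; exact congrArg Prod.fst haT'
    simpa using this
  have hT2 : inner ℂ φ (V a) = 0 := congrArg Prod.snd haT'
  have hdisj : ∀ i j : Fin 3, ∀ x, x ∈ I i → x ∈ I j → i = j := by
    intro i j x hi hj
    simp only [hI, Set.mem_Ioc] at hi hj
    by_contra hne
    rcases lt_or_gt_of_ne hne with h | h
    · have h1 : ((i : ℕ) : ℝ) + 1 ≤ (j : ℕ) := by exact_mod_cast h
      have := mul_le_mul_of_nonneg_right h1 hη0.le
      linarith [hi.2, hj.1]
    · have h1 : ((j : ℕ) : ℝ) + 1 ≤ (i : ℕ) := by exact_mod_cast h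
      have := mul_le_mul_of_nonneg_right h1 hη0.le
      linarith [hj.2, hi.1]
  have hsupp : ∀ j : Fin 3, ∀ x ∈ I j, |x - δ| ≤ ε := by
    intro j x hx
    simp only [hI, Set.mem_Ioc] at hx
    have h0 : (0 : ℝ) ≤ (j : ℕ) := by positivity
    have h2 : ((j : ℕ) : ℝ) ≤ 2 := by exact_mod_cast Nat.lt_succ_iff.1 j.2
    have := mul_nonneg h0 hη0.le
    have := mul_le_mul_of_nonneg_right h2 hη0.le
    rw [abs_le]
    constructor <;> nlinarith [hx.1, hx.2]
  refine ⟨V a, ?_, ?_, ?_, hT2⟩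
  · intro hV
    apply ha0
    funext j
    by_contra hj
    have h1 : ∀ᵐ x : ℝ, x ∉ I j := by
      have h2 : ∀ᵐ x : ℝ, V a x = 0 := by
        rw [hV]; exact Lp.coeFn_zero ℂ 2 _
      filter_upwards [hVco a, h2] with x h3 h4 hx
      rw [h4, Finset.sum_eq_single j] at h3
      · rw [Set.indicator_of_mem hx, mul_one] at h3
        exact hj h3.symm
      · intro i _ hij
        rw [Set.indicator_of_notMem (fun hi => hij (hdisj i j x hi hx)), mul_zero]
      · simp
    rw [ae_iff] at h1
    simp only [not_not, Set.ofPred_mem_eq, hIv] at h1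
    simp at h1
    linarith
  · filter_upwards [hVco a] with x hx hne
    by_contra hcon
    apply hne
    rw [hx]
    refine Finset.sum_eq_zero fun j _ => ?_
    rw [Set.indicator_of_notMem (fun hj => hcon (hsupp j x hj)), mul_zero]
  · have hi : ∀ j, Integrable ((I j).indicator (fun _ => (1 : ℂ))) := fun j =>
      (integrable_indicator_iff (hIm j)).2 (integrableOn_const (by simp [hIv]))
    have hint : Integrable (fun x => ∑ j, a j * (I j).indicator (fun _ => (1 : ℂ)) x) :=
      integrable_finsetSum _ fun j _ => (hi j).const_mul _
    have hz : ∫ x, ∑ j, a j * (I j).indicator (fun _ => (1 : ℂ)) x = 0 := by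
      rw [integral_finsetSum _ fun j _ => (hi j).const_mul _]
      have : ∀ j, ∫ x, a j * (I j).indicator (fun _ => (1 : ℂ)) x = a j * η := by
        intro j
        rw [integral_const_mul, integral_indicator (hIm j), setIntegral_const, Measure.real, hIv,
          ENNReal.toReal_ofReal hη0.le]
        simp
      simp only [this, ← Finset.sum_mul, hT1, zero_mul]
    have h1 := intervalIntegral_tendsto_integral hint tendsto_neg_atTop_atBot tendsto_id
    rw [hz] at h1
    refine h1.congr fun R => ?_
    refine intervalIntegral.integral_congr_ae ?_
    filter_upwards [hVco a] with x hx _ using hx.symm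

/-- The resolvent set of `A_B` contains no real point. -/
theorem im_ne_zero_of_mem_resolventSet {δ : ℂ} (hδ : δ ∈ resolventSet (opB φ ψ B)) :
    δ.im ≠ 0 := by
  intro him
  obtain ⟨r, rfl⟩ : ∃ r : ℝ, (r : ℂ) = δ := ⟨δ.re, Complex.ext (by simp) (by simp [him])⟩
  obtain ⟨R, hR⟩ := mem_resolventSet_iff.1 hδ
  -- Chosen so that `‖R‖ ε ≤ 1/2`, against the inequality `‖f‖ ≤ ‖R‖ ε ‖f‖` obtained below.
  set ε : ℝ := (2 * (‖R‖ + 1))⁻¹ with hε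
  have hε0 : 0 < ε := by positivity
  obtain ⟨f, hf0, hsupp, hf1, hf2⟩ := exists_localized φ r hε0
  have hbd : ∀ᵐ x : ℝ, ‖((x : ℂ) - r) * f x‖ ≤ ε * ‖f x‖ := by
    filter_upwards [hsupp] with x hx
    by_cases h : f x = 0
    · simp [h]
    · rw [norm_mul, ← Complex.ofReal_sub, Complex.norm_real]
      exact mul_le_mul_of_nonneg_right (hx h) (norm_nonneg _)
  have hm : MemLp (fun x : ℝ => ((x : ℂ) - r) * f x) 2 volume :=
    MemLp.of_le_mul (Lp.memLp f) ((by fun_prop : Continuous fun x : ℝ =>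
      (x : ℂ) - r).aestronglyMeasurable.mul (Lp.memLp f).1) hbd
  have hsol := (hR f (hm.toLp _)).1 (exists_opB_iff.2 ⟨0, by
    filter_upwards [hm.coeFn_toLp] with x hx
    rw [hx, hf2]; ring, by simpa using hf1⟩)
  have hn : ‖hm.toLp _‖ ≤ ε * ‖f‖ := by
    refine Lp.norm_le_mul_norm_of_ae_le_mul ?_
    filter_upwards [hm.coeFn_toLp, hbd] with x h1 h2
    rw [h1]; exact h2
  have h1 : ‖f‖ ≤ ‖R‖ * (ε * ‖f‖) := by
    calc ‖f‖ = ‖R (hm.toLp _)‖ := by rw [← hsol]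
      _ ≤ ‖R‖ * ‖hm.toLp _‖ := R.le_opNorm _
      _ ≤ _ := by gcongr
  have hfpos : 0 < ‖f‖ := norm_pos_iff.2 hf0
  have h2 : ‖R‖ * ε ≤ 1 / 2 := by
    rw [hε, ← div_eq_mul_inv, div_le_iff₀ (by positivity)]; linarith
  nlinarith

/-- The vector spanning the kernel of `Ã* - δ`. -/
def kerVec (φ ψ : L2R) (δ : ℂ) : L2R :=
  funD φ ψ δ • rk δ - cau (fun x => conj (φ x)) δ • Res δ ψ

theorem mem_solutionRange_of_funD_ne {u : L2R} {δ : ℂ} (hδ : δ.im ≠ 0) (hD : funD φ ψ δ ≠ 0) :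
    u ∈ solutionRange φ ψ B δ ↔ ∃ a : ℂ, u = a • kerVec φ ψ δ := by
  rw [mem_solutionRange_iff_of_im_ne hδ]
  constructor
  · rintro ⟨c, k, rfl, h⟩
    refine ⟨c / funD φ ψ δ, ?_⟩
    rw [kerVec, smul_sub, smul_smul, smul_smul, div_mul_cancel₀ _ hD]
    congr 2
    rw [div_mul_eq_mul_div, eq_div_iff hD, h]
  · rintro ⟨a, rfl⟩
    exact ⟨a * funD φ ψ δ, a * cau (fun x => conj (φ x)) δ, by
      rw [kerVec, smul_sub, smul_smul, smul_smul], by ring⟩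

theorem integrable_mul_conj (φ ψ : L2R) : Integrable fun x => ψ x * conj (φ x) :=
  (Lp.memLp ψ).integrable_mul (Lp.memLp φ).star

theorem funD_eq (φ ψ : L2R) : funD φ ψ = fun μ => 1 + cau (fun x => ψ x * conj (φ x)) μ := rfl

theorem differentiableAt_funD (φ ψ : L2R) {μ : ℂ} (hμ : μ.im ≠ 0) :
    DifferentiableAt ℂ (funD φ ψ) μ := by
  rw [funD_eq]
  exact (differentiableAt_cau_of_integrable (integrable_mul_conj φ ψ) hμ).const_add _

theorem tendsto_funD (φ ψ : L2R) {s : ℂ} (hs : s.im ≠ 0) :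
    Tendsto (fun R : ℝ => funD φ ψ (R * s)) atTop (𝓝 1) := by
  have h1 : Tendsto (fun R : ℝ => |((R : ℂ) * s).im|⁻¹ * ∫ x, ‖ψ x * conj (φ x)‖) atTop (𝓝 0) := by
    have h2 : Tendsto (fun R : ℝ => |((R : ℂ) * s).im|) atTop atTop := by
      simp only [Complex.im_ofReal_mul, abs_mul]
      exact tendsto_abs_atTop_atTop.atTop_mul_const (abs_pos.2 hs)
    simpa using h2.inv_tendsto_atTop.mul_const (∫ x, ‖ψ x * conj (φ x)‖)
  rw [tendsto_iff_norm_sub_tendsto_zero]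
  refine squeeze_zero' (Eventually.of_forall fun _ => norm_nonneg _) ?_ h1
  filter_upwards [eventually_gt_atTop 0] with R hR
  rw [funD_eq]
  simp only [add_sub_cancel_left]
  exact norm_cau_le_of_integrable (integrable_mul_conj φ ψ) (by simp [hR.ne', hs])

/-- In each half-plane `D` is holomorphic and tends to `1` along the imaginary axis, so by the
identity theorem its zeros are isolated. -/
theorem eventually_funD_ne_zero (φ ψ : L2R) {δ : ℂ} (hδ : δ.im ≠ 0) :
    ∀ᶠ μ in 𝓝[≠] δ, funD φ ψ μ ≠ 0 := by
  by_contra hcon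
  have hfreq : ∃ᶠ μ in 𝓝[≠] δ, funD φ ψ μ = 0 := hcon
  obtain ⟨U, hUo, hUc, hδU, s, hs, hsU, hU⟩ : ∃ U : Set ℂ, IsOpen U ∧ IsPreconnected U ∧ δ ∈ U ∧
      ∃ s : ℂ, s.im ≠ 0 ∧ (∀ R : ℝ, 0 < R → R * s ∈ U) ∧ ∀ μ ∈ U, μ.im ≠ 0 := by
    rcases lt_or_gt_of_ne hδ with h | h
    · exact ⟨{w | w.im < 0}, isOpen_lt Complex.continuous_im continuous_const,
        (convex_halfSpace_im_lt 0).isPreconnected, h, -Complex.I, by simp,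
        fun R hR => by simpa using hR, fun μ hμ => ne_of_lt hμ⟩
    · exact ⟨{w | 0 < w.im}, isOpen_lt continuous_const Complex.continuous_im,
        (convex_halfSpace_im_gt 0).isPreconnected, h, Complex.I, by simp,
        fun R hR => by simpa using hR, fun μ hμ => ne_of_gt hμ⟩
  have han : AnalyticOnNhd ℂ (funD φ ψ) U :=
    DifferentiableOn.analyticOnNhd (fun μ hμ =>
      (differentiableAt_funD φ ψ (hU μ hμ)).differentiableWithinAt) hUo
  have hz := han.eqOn_zero_of_preconnected_of_frequently_eq_zero hUc hδU hfreq
  have h1 := (tendsto_funD φ ψ hs).congr' (f₂ := fun _ => (0 : ℂ)) (by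
    filter_upwards [eventually_gt_atTop 0] with R hR using hz (hsU R hR))
  exact one_ne_zero (tendsto_nhds_unique h1 tendsto_const_nhds)

theorem continuousAt_kerVec (φ ψ : L2R) {δ : ℂ} (hδ : δ.im ≠ 0) :
    ContinuousAt (kerVec φ ψ) δ :=
  ((differentiableAt_funD φ ψ hδ).continuousAt.smul (continuousAt_rk hδ)).sub
    ((differentiableAt_cau (Lp.memLp φ).star hδ).continuousAt.smul (continuousAt_Res_apply hδ ψ))

theorem tendsto_rk_atTop : Tendsto (fun R : ℝ => rk (R * Complex.I)) atTop (𝓝 0) := by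
  rw [tendsto_zero_iff_norm_tendsto_zero]
  have h1 : Tendsto (fun R : ℝ => Real.sqrt (Real.pi / R)) atTop (𝓝 0) := by
    have h2 := (Real.continuous_sqrt.tendsto 0).comp
      ((tendsto_const_nhds (x := Real.pi)).div_atTop tendsto_id)
    rwa [Real.sqrt_zero] at h2
  refine h1.congr' ?_
  filter_upwards [eventually_gt_atTop 0] with R hR
  have him : ((R : ℂ) * Complex.I).im = R := by simp
  rw [Real.sqrt_eq_iff_mul_self_eq (by positivity) (norm_nonneg _), ← sq,
    norm_rk_sq (by rw [him]; exact hR.ne'), him, abs_of_pos hR]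

/-! ### The closure of the detectable space as a closed span of kernel vectors. -/

section Closure

variable {Φ : ℂ → ℂ}

/-- In each half-plane one of the two factors vanishes. This is what makes `D (B - sgm)` alone
decide solvability. -/
theorem cau_mul_cau_eq_zero (hφ : IsHardyExtension Φ φ) (hψ : ψ ∈ HardyPlus) {δ : ℂ}
    (hδ : δ.im ≠ 0) : cau ψ δ * cau (fun x => conj (φ x)) δ = 0 := by
  obtain ⟨Ψ, hΨ⟩ := hψ
  rcases lt_or_gt_of_ne hδ with h | h
  · rw [hΨ.cau_eq_zero h, zero_mul]
  · rw [hφ.cau_conj_eq_zero h, mul_zero]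

theorem sub_sgm_ne_zero (hB : B ≠ Real.pi * Complex.I) (hB' : B ≠ -(Real.pi * Complex.I)) (δ : ℂ) :
    B - sgm δ ≠ 0 := by
  rw [sub_ne_zero, sgm]
  split_ifs <;> assumption

theorem kerVec_mem_detectable_closure (hφ : IsHardyExtension Φ φ) (hψ : ψ ∈ HardyPlus)
    (hB : B ≠ Real.pi * Complex.I) (hB' : B ≠ -(Real.pi * Complex.I)) {μ₀ : ℂ}
    (hμ₀ : μ₀ ∈ resolventSet (opB φ ψ B)) {δ : ℂ} (hδ : δ.im ≠ 0) (hD : funD φ ψ δ ≠ 0) :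
    kerVec φ ψ δ ∈ (detectable φ ψ B μ₀).topologicalClosure := by
  -- The scaling gives `Γ₂ (s δ) = (sgm δ - B)⁻¹` and `(Γ₁ - B Γ₂) (s δ) = 1`, so differences of
  -- these vectors lie in the domain of `A_B`.
  set s : ℂ → L2R := fun δ => (funD φ ψ δ * (sgm δ - B))⁻¹ • kerVec φ ψ δ with hs
  have hne : ∀ δ, sgm δ - B ≠ 0 := fun δ => by
    rw [← neg_sub]; exact neg_ne_zero.2 (sub_sgm_ne_zero hB hB' δ)
  have hres : ∀ {δ : ℂ}, δ.im ≠ 0 → (δ ∈ resolventSet (opB φ ψ B) ↔ funD φ ψ δ ≠ 0) := fun h =>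
    mem_resolventSet_iff_of_im_ne h (sub_sgm_ne_zero hB hB' _) (cau_mul_cau_eq_zero hφ hψ h)
  have hμ₀' := im_ne_zero_of_mem_resolventSet hμ₀
  have hDμ₀ := (hres hμ₀').1 hμ₀
  have hprop : ∀ δ : ℂ, δ.im ≠ 0 → funD φ ψ δ ≠ 0 →
      ((0 : L2R) =ᵐ[volume] fun x : ℝ => ((x : ℂ) - δ) * s δ x - (sgm δ - B)⁻¹
        + inner ℂ φ (s δ) * ψ x) ∧ HasGammaOne (s δ) (sgm δ * (sgm δ - B)⁻¹) := by
    intro δ hδ hD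
    have h0 := hne δ
    set k := (funD φ ψ δ * (sgm δ - B))⁻¹ * cau (fun x => conj (φ x)) δ with hk
    have hsδ : s δ = Res δ 0 + (sgm δ - B)⁻¹ • rk δ - k • Res δ ψ := by
      simp only [hs, kerVec, smul_sub, smul_smul, map_zero, zero_add]
      congr 2
      field_simp
    have hin : inner ℂ φ (s δ) = k := by
      rw [hsδ, inner_combination hδ, map_zero, inner_zero_right, hk]
      field_simp
      ring
    constructor
    · rw [hin]; exact (ae_eq_iff_eq_Res hδ).2 hsδ
    · rw [hsδ]
      convert hasGammaOne_combination (ψ := ψ) (v := 0) (sgm δ - B)⁻¹ k hδ using 1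
      have := cau_mul_cau_eq_zero hφ hψ hδ
      rw [cau_coe_zero hδ, hk]
      linear_combination (funD φ ψ δ * (sgm δ - B))⁻¹ * this
  obtain ⟨p1, p2⟩ := hprop μ₀ hμ₀' hDμ₀
  have hdiff : ∀ δ : ℂ, δ.im ≠ 0 → funD φ ψ δ ≠ 0 → s δ - s μ₀ ∈ detectable φ ψ B μ₀ := by
    intro δ hδ hD
    obtain ⟨q1, q2⟩ := hprop δ hδ hD
    refine Submodule.subset_span ⟨δ, (hres hδ).2 hD, ?_⟩
    -- Since `s δ` and `s μ₀` are eigenvectors of `Ã*`, `(A_B - δ) (s δ - s μ₀) = (δ - μ₀) s μ₀`.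
    have hex := (exists_opB_iff (φ := φ) (ψ := ψ) (B := B) (u := s δ - s μ₀)
      (v := (δ - μ₀) • s μ₀) (δ := δ)).2 ⟨(sgm δ - B)⁻¹ - (sgm μ₀ - B)⁻¹, by
        filter_upwards [q1, p1, Lp.coeFn_sub (s δ) (s μ₀), Lp.coeFn_smul (δ - μ₀) (s μ₀),
          Lp.coeFn_zero ℂ 2 (volume : Measure ℝ)] with x h1 h2 h3 h4 h5
        rw [h3, h4, Pi.sub_apply, Pi.smul_apply, smul_eq_mul, inner_sub_right]
        rw [h5, Pi.zero_apply] at h1 h2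
        linear_combination h1 - h2, by
        convert q2.sub p2 using 1
        have := hne δ
        have := hne μ₀
        field_simp
        ring⟩
    obtain ⟨w, hw, hw'⟩ := hex
    refine ⟨w, hw, ?_⟩
    rw [hw', mem_solutionRange_of_funD_ne hμ₀' hDμ₀]
    exact ⟨_, smul_smul _ _ _⟩
  -- Only differences have been reached so far. High on the imaginary axis `s (i R) = (π i - B)⁻¹ •
  -- rk (i R)` tends to zero, which isolates `s μ₀`.
  have hμ₀s : s μ₀ ∈ (detectable φ ψ B μ₀).topologicalClosure := by
    have ht : Tendsto (fun R : ℝ => s μ₀ - s (R * Complex.I)) atTop (𝓝 (s μ₀)) := by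
      have h1 : Tendsto (fun R : ℝ => s (R * Complex.I)) atTop (𝓝 0) := by
        have h2 := tendsto_rk_atTop.const_smul (Real.pi * Complex.I - B)⁻¹
        rw [smul_zero] at h2
        refine h2.congr' ?_
        filter_upwards [eventually_gt_atTop 0, (tendsto_funD φ ψ (s := Complex.I)
          (by simp)).eventually_ne one_ne_zero] with R hR hDR
        have him : 0 < ((R : ℂ) * Complex.I).im := by simpa using hR
        have h0 := hne (R * Complex.I)
        simp only [hs, kerVec, hφ.cau_conj_eq_zero him, zero_smul, sub_zero, smul_smul]
        congr 1
        rw [sgm, if_pos him] at h0 ⊢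
        generalize funD φ ψ (R * Complex.I) = D at hDR ⊢
        field_simp
      simpa using tendsto_const_nhds.sub h1
    rw [← SetLike.mem_coe, Submodule.topologicalClosure_coe]
    refine mem_closure_of_tendsto ht ?_
    filter_upwards [eventually_gt_atTop 0, (tendsto_funD φ ψ (s := Complex.I)
          (by simp)).eventually_ne one_ne_zero] with R hR hDR
    rw [← neg_sub]
    exact Submodule.neg_mem _ (hdiff _ (by simpa using hR.ne') hDR)
  have hδs : s δ ∈ (detectable φ ψ B μ₀).topologicalClosure := by
    have := Submodule.add_mem _ (Submodule.le_topologicalClosure _ (hdiff δ hδ hD)) hμ₀s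
    rwa [sub_add_cancel] at this
  have : kerVec φ ψ δ = (funD φ ψ δ * (sgm δ - B)) • s δ := by
    simp only [hs]
    rw [smul_inv_smul₀ (mul_ne_zero hD (hne δ))]
  rw [this]
  exact Submodule.smul_mem _ _ hδs

theorem mem_closure_of_eventually_punctured {F : ℂ → L2R} {δ : ℂ} {S : Submodule ℂ L2R}
    (hF : ContinuousAt F δ) (h : ∀ᶠ μ in 𝓝[≠] δ, F μ ∈ S.topologicalClosure) :
    F δ ∈ S.topologicalClosure :=
  S.isClosed_topologicalClosure.mem_of_tendsto
    (hF.tendsto.mono_left (nhdsWithin_le_nhds (s := {δ}ᶜ))) h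

/-- The span of the vectors `1 / (x - μ)` for `μ ∈ ℂ₊` and `kerVec μ` for `μ ∈ ℂ₋`. -/
def kerSpan (φ ψ : L2R) : Submodule ℂ L2R :=
  Submodule.span ℂ (rk '' {μ | 0 < μ.im} ∪ kerVec φ ψ '' {μ | μ.im < 0})

theorem kerVec_mem_kerSpan (hφ : IsHardyExtension Φ φ) {δ : ℂ} (hδ : δ.im ≠ 0) :
    kerVec φ ψ δ ∈ kerSpan φ ψ := by
  rcases lt_or_gt_of_ne hδ with h | h
  · exact Submodule.subset_span (Or.inr ⟨δ, h, rfl⟩)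
  · rw [kerVec, hφ.cau_conj_eq_zero h, zero_smul, sub_zero]
    exact Submodule.smul_mem _ _ (Submodule.subset_span (Or.inl ⟨δ, h, rfl⟩))

theorem detectable_closure_eq (hφ : IsHardyExtension Φ φ) (hψ : ψ ∈ HardyPlus)
    (hB : B ≠ Real.pi * Complex.I) (hB' : B ≠ -(Real.pi * Complex.I)) {μ₀ : ℂ}
    (hμ₀ : μ₀ ∈ resolventSet (opB φ ψ B)) :
    (detectable φ ψ B μ₀).topologicalClosure = (kerSpan φ ψ).topologicalClosure := by
  have hres : ∀ {δ : ℂ}, δ.im ≠ 0 → (δ ∈ resolventSet (opB φ ψ B) ↔ funD φ ψ δ ≠ 0) := fun h =>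
    mem_resolventSet_iff_of_im_ne h (sub_sgm_ne_zero hB hB' _) (cau_mul_cau_eq_zero hφ hψ h)
  have hμ₀' := im_ne_zero_of_mem_resolventSet hμ₀
  have hDμ₀ := (hres hμ₀').1 hμ₀
  refine le_antisymm ?_ ?_
  · refine Submodule.topologicalClosure_minimal _ (Submodule.span_le.2 ?_)
      (kerSpan φ ψ).isClosed_topologicalClosure
    rintro v ⟨δ, hδ, w, rfl, hw⟩
    set v : L2R := opB φ ψ B w - δ • (w : L2R) with hv
    have hvμ := (mem_solutionRange_of_funD_ne hμ₀' hDμ₀).1 hw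
    obtain ⟨a, ha⟩ := hvμ
    have hvT : v ∈ kerSpan φ ψ := by
      rw [ha]; exact Submodule.smul_mem _ _ (kerVec_mem_kerSpan hφ hμ₀')
    obtain ⟨c₀, hc₀, a₀, ha₀⟩ := mem_solutionRange_iff.1 hw
    -- As `Ã* v = μ₀ v`, adding `(ν - μ₀)⁻¹ v` to `u` turns the inhomogeneous equation at `ν` into
    -- the homogeneous one.
    have hsolve : ∀ ν : ℂ, ν ∈ resolventSet (opB φ ψ B) → ν ≠ μ₀ → ∀ u : L2R,
        (∃ w : (opB φ ψ B).domain, (w : L2R) = u ∧ opB φ ψ B w - ν • u = v) → u ∈ kerSpan φ ψ := by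
      intro ν hν hne u hu
      have hν' := im_ne_zero_of_mem_resolventSet hν
      have hDν := (hres hν').1 hν
      obtain ⟨c, hc, hg⟩ := exists_opB_iff.1 hu
      have hmem : u + (ν - μ₀)⁻¹ • v ∈ solutionRange φ ψ B ν := by
        refine mem_solutionRange_iff.2 ⟨c + (ν - μ₀)⁻¹ * c₀, ?_, _, hg.add (ha₀.smul _)⟩
        filter_upwards [hc, hc₀, Lp.coeFn_add u ((ν - μ₀)⁻¹ • v), Lp.coeFn_smul (ν - μ₀)⁻¹ v,
          Lp.coeFn_zero ℂ 2 (volume : Measure ℝ)] with x h1 h2 h3 h4 h5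
        rw [h3, Pi.add_apply, h4, Pi.smul_apply, smul_eq_mul, inner_add_right, inner_smul_right]
        rw [h5, Pi.zero_apply] at h2 ⊢
        have h6 : (ν - μ₀)⁻¹ * (ν - μ₀) = 1 := inv_mul_cancel₀ (sub_ne_zero.2 hne)
        linear_combination h1 + (ν - μ₀)⁻¹ * h2 + v x * h6
      obtain ⟨b, hb⟩ := (mem_solutionRange_of_funD_ne hν' hDν).1 hmem
      have : u = b • kerVec φ ψ ν - (ν - μ₀)⁻¹ • v := by rw [← hb]; abel
      rw [this]
      exact Submodule.sub_mem _ (Submodule.smul_mem _ _ (kerVec_mem_kerSpan hφ hν'))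
        (Submodule.smul_mem _ _ hvT)
    rcases eq_or_ne δ μ₀ with rfl | hne
    -- At `δ = μ₀` the division by `δ - μ₀` fails. The solution is instead the limit of the
    -- solutions at nearby `ν`, by the estimate `‖u ν - w‖ ≤ |ν - δ| ‖R‖ ‖u ν‖`.
    · obtain ⟨R, hR⟩ := mem_resolventSet_iff.1 hδ
      have hw0 : (w : L2R) = R v := (hR _ _).1 ⟨w, rfl, rfl⟩
      have hgood : ∀ᶠ ν in 𝓝[≠] δ, ν ∈ resolventSet (opB φ ψ B) := by
        filter_upwards [eventually_funD_ne_zero φ ψ hμ₀', mem_nhdsWithin_of_mem_nhds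
          (Complex.continuous_im.continuousAt.eventually_ne hμ₀')] with ν h1 h2
        exact (hres h2).2 h1
      have hex : ∀ ν : ℂ, ∃ u : L2R, ν ∈ resolventSet (opB φ ψ B) →
          (∃ w : (opB φ ψ B).domain, (w : L2R) = u ∧ opB φ ψ B w - ν • u = v) := by
        intro ν
        by_cases hν : ν ∈ resolventSet (opB φ ψ B)
        · obtain ⟨R', hR'⟩ := mem_resolventSet_iff.1 hν
          exact ⟨R' v, fun _ => (hR' _ _).2 rfl⟩
        · exact ⟨0, fun h => absurd h hν⟩
      choose u hu using hex
      have hlim : Tendsto u (𝓝[≠] δ) (𝓝 (w : L2R)) := by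
        rw [tendsto_iff_norm_sub_tendsto_zero]
        have h0 : Tendsto (fun ν : ℂ => ‖ν - δ‖) (𝓝[≠] δ) (𝓝 0) := by
          have : Tendsto (fun ν : ℂ => ‖ν - δ‖) (𝓝 δ) (𝓝 ‖δ - δ‖) :=
            (tendsto_id.sub_const δ).norm
          rw [sub_self, norm_zero] at this
          exact this.mono_left nhdsWithin_le_nhds
        have h1 : Tendsto (fun ν : ℂ => ‖ν - δ‖ * (‖R‖ * (2 * ‖(w : L2R)‖))) (𝓝[≠] δ) (𝓝 0) := by
          simpa using h0.mul_const (‖R‖ * (2 * ‖(w : L2R)‖))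
        refine squeeze_zero' (Eventually.of_forall fun _ => norm_nonneg _) ?_ h1
        have h2 : Tendsto (fun ν : ℂ => ‖ν - δ‖ * ‖R‖) (𝓝[≠] δ) (𝓝 0) := by
          simpa using h0.mul_const ‖R‖
        filter_upwards [hgood, h2.eventually_lt_const (show (0 : ℝ) < 1 / 2 by norm_num)]
          with ν hν hsmall
        have e1 : u ν = R (v + (ν - δ) • u ν) := by
          obtain ⟨w', hw', hw''⟩ := hu ν hν
          refine (hR _ _).1 ⟨w', hw', ?_⟩
          rw [← hw'', sub_smul]; abel
        have e2 : u ν - w = (ν - δ) • R (u ν) := by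
          conv_lhs => rw [e1]
          rw [map_add, map_smul, ← hw0, add_sub_cancel_left]
        have e3 : ‖u ν - w‖ ≤ ‖ν - δ‖ * (‖R‖ * ‖u ν‖) := by
          rw [e2, norm_smul]
          gcongr
          exact R.le_opNorm _
        have e4 : ‖u ν‖ ≤ ‖u ν - w‖ + ‖(w : L2R)‖ := by
          simpa using norm_add_le (u ν - w) (w : L2R)
        have e5 : ‖u ν‖ ≤ 2 * ‖(w : L2R)‖ := by
          have := mul_le_mul_of_nonneg_right hsmall.le (norm_nonneg (u ν))
          rw [mul_assoc] at this
          linarith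
        refine e3.trans ?_
        gcongr
      rw [SetLike.mem_coe, ← SetLike.mem_coe, Submodule.topologicalClosure_coe]
      refine mem_closure_of_tendsto hlim ?_
      filter_upwards [hgood, self_mem_nhdsWithin] with ν hν hne
      exact hsolve ν hν hne _ (hu ν hν)
    · exact Submodule.le_topologicalClosure _ (hsolve δ hδ hne w ⟨w, rfl, rfl⟩)
  · refine Submodule.topologicalClosure_minimal _ (Submodule.span_le.2 ?_)
      (detectable φ ψ B μ₀).isClosed_topologicalClosure
    -- Zeros of `D` are isolated and the generators depend continuously on the parameter, so points
    -- with `D = 0` are reached as limits.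
    have hev : ∀ {δ : ℂ}, δ.im ≠ 0 → ∀ᶠ μ in 𝓝[≠] δ, μ.im ≠ 0 ∧ funD φ ψ μ ≠ 0 := by
      intro δ hδ
      filter_upwards [eventually_funD_ne_zero φ ψ hδ, mem_nhdsWithin_of_mem_nhds
          (Complex.continuous_im.continuousAt.eventually_ne hδ)] with μ h1 h2 using ⟨h2, h1⟩
    rintro _ (⟨δ, hδ, rfl⟩ | ⟨δ, hδ, rfl⟩)
    · have hδ' : δ.im ≠ 0 := ne_of_gt hδ
      refine mem_closure_of_eventually_punctured (continuousAt_rk hδ') ?_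
      filter_upwards [hev hδ', mem_nhdsWithin_of_mem_nhds
        ((isOpen_lt continuous_const Complex.continuous_im).mem_nhds hδ)] with μ h1 h2
      have h3 := kerVec_mem_detectable_closure hφ hψ hB hB' hμ₀ h1.1 h1.2
      rw [kerVec, hφ.cau_conj_eq_zero h2, zero_smul, sub_zero] at h3
      have h4 := Submodule.smul_mem _ (funD φ ψ μ)⁻¹ h3
      rwa [inv_smul_smul₀ h1.2] at h4
    · have hδ' : δ.im ≠ 0 := ne_of_lt hδ
      refine mem_closure_of_eventually_punctured (continuousAt_kerVec φ ψ hδ') ?_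
      filter_upwards [hev hδ'] with μ h1
      exact kerVec_mem_detectable_closure hφ hψ hB hB' hμ₀ h1.1 h1.2

theorem kerSpan_eq (hφ : IsHardyExtension Φ φ) :
    kerSpan φ ψ = Submodule.span ℂ
        ({f : L2R | ∃ μ : ℂ, 0 < μ.im ∧ f =ᵐ[volume] fun x : ℝ => 1 / ((x : ℂ) - μ)} ∪
          {f : L2R | ∃ μ : ℂ, μ.im < 0 ∧ f =ᵐ[volume] fun x : ℝ =>
              (funD φ ψ μ + 2 * Real.pi * Complex.I * lowerExt Φ μ * ψ x) / ((x : ℂ) - μ)}) := by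
  rw [kerSpan]
  congr 2
  · ext f
    constructor
    · rintro ⟨μ, hμ, rfl⟩
      refine ⟨μ, hμ, ?_⟩
      simpa only [one_div] using coeFn_rk (ne_of_gt hμ)
    · rintro ⟨μ, hμ, hf⟩
      refine ⟨μ, hμ, Lp.ext ?_⟩
      filter_upwards [hf, coeFn_rk (ne_of_gt hμ)] with x h1 h2
      rw [h1, h2, one_div]
  · have key : ∀ μ : ℂ, μ.im < 0 → kerVec φ ψ μ =ᵐ[volume] fun x : ℝ =>
        (funD φ ψ μ + 2 * Real.pi * Complex.I * lowerExt Φ μ * ψ x) / ((x : ℂ) - μ) := by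
      intro μ hμ
      rw [kerVec, hφ.cau_conj_eq hμ]
      filter_upwards [Lp.coeFn_sub (funD φ ψ μ • rk μ)
          ((-(2 * Real.pi * Complex.I) * lowerExt Φ μ) • Res μ ψ),
        Lp.coeFn_smul (funD φ ψ μ) (rk μ),
        Lp.coeFn_smul (-(2 * Real.pi * Complex.I) * lowerExt Φ μ) (Res μ ψ), coeFn_rk hμ.ne,
        coeFn_Res hμ.ne ψ] with x h1 h2 h3 h4 h5
      rw [h1, Pi.sub_apply, h2, h3, Pi.smul_apply, Pi.smul_apply, h4, h5]
      simp only [smul_eq_mul]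
      ring
    ext f
    constructor
    · rintro ⟨μ, hμ, rfl⟩
      exact ⟨μ, hμ, key μ hμ⟩
    · rintro ⟨μ, hμ, hf⟩
      exact ⟨μ, hμ, Lp.ext ((key μ hμ).trans hf.symm)⟩

end Closure

end Resolvent

/-! ### Partial fractions over the nodes and divisibility of polynomials. -/

section PolynomialAlgebra

section PartialFractions

open Polynomial Finset

variable {N : ℕ} (z : Fin N → ℂ)

/-- The numerator of `∑ⱼ aⱼ / (X - zⱼ)` over the common denominator `∏ⱼ (X - zⱼ)`. -/
def numer (a : Fin N → ℂ) : ℂ[X] := ∑ j, C (a j) * Lagrange.nodal (univ.erase j) z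

/-- The numerator of `1 + ∑ⱼ aⱼ / (X - zⱼ)` over the common denominator `∏ⱼ (X - zⱼ)`. -/
def onePlusNumer (a : Fin N → ℂ) : ℂ[X] := Lagrange.nodal univ z + numer z a

variable {z}

theorem eval_nodal_ne_zero {μ : ℂ} (h : ∀ j, μ ≠ z j) : (Lagrange.nodal univ z).eval μ ≠ 0 :=
  Lagrange.eval_nodal_not_at_node fun j _ => h j

theorem eval_nodal_erase {μ : ℂ} (h : ∀ j, μ ≠ z j) (j : Fin N) :
    (Lagrange.nodal (univ.erase j) z).eval μ = (Lagrange.nodal univ z).eval μ / (μ - z j) := by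
  rw [eq_div_iff (sub_ne_zero.2 (h j)), Lagrange.nodal_eq_mul_nodal_erase (mem_univ j)]
  simp [mul_comm]

theorem eval_numer {μ : ℂ} (h : ∀ j, μ ≠ z j) (a : Fin N → ℂ) :
    (numer z a).eval μ = (Lagrange.nodal univ z).eval μ * ∑ j, a j / (μ - z j) := by
  rw [numer, eval_finsetSum, mul_sum]
  refine sum_congr rfl fun j _ => ?_
  rw [eval_mul, eval_C, eval_nodal_erase h]
  ring

theorem eval_onePlusNumer {μ : ℂ} (h : ∀ j, μ ≠ z j) (a : Fin N → ℂ) :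
    (onePlusNumer z a).eval μ
      = (Lagrange.nodal univ z).eval μ * (1 + ∑ j, a j / (μ - z j)) := by
  rw [onePlusNumer, eval_add, eval_numer h]; ring

theorem eval_numer_node (a : Fin N → ℂ) (j : Fin N) :
    (numer z a).eval (z j) = a j * (Lagrange.nodal (univ.erase j) z).eval (z j) := by
  rw [numer, eval_finsetSum, sum_eq_single j]
  · rw [eval_mul, eval_C]
  · intro i _ hij
    rw [eval_mul, Lagrange.eval_nodal_at_node (mem_erase.2 ⟨hij.symm, mem_univ j⟩), mul_zero]
  · simp

theorem eval_onePlusNumer_node (a : Fin N → ℂ) (j : Fin N) :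
    (onePlusNumer z a).eval (z j) = a j * (Lagrange.nodal (univ.erase j) z).eval (z j) := by
  rw [onePlusNumer, eval_add, eval_numer_node, Lagrange.eval_nodal_at_node (mem_univ j), zero_add]

theorem eval_nodal_erase_node_ne_zero (hz : Function.Injective z) (j : Fin N) :
    (Lagrange.nodal (univ.erase j) z).eval (z j) ≠ 0 :=
  Lagrange.eval_nodal_not_at_node fun _ hi h => (mem_erase.1 hi).1 (hz h).symm

theorem degree_numer_lt (a : Fin N → ℂ) : (numer z a).degree < N := by
  refine (degree_sum_le _ _).trans_lt ((Finset.sup_lt_iff (WithBot.bot_lt_coe N)).2 fun j _ => ?_)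
  rw [← smul_eq_C_mul]
  refine (degree_smul_le _ _).trans_lt ?_
  rw [Lagrange.degree_nodal]
  have : (univ.erase j).card < N := by
    have := Finset.card_erase_lt_of_mem (mem_univ j)
    simpa using this
  exact Nat.cast_lt.2 this

/-- Lagrange interpolation: a polynomial of degree less than `N` is determined by its values at the
`N` nodes. -/
theorem eq_numer (hz : Function.Injective z) {q : ℂ[X]} (hq : q.degree < N) {a : Fin N → ℂ}
    (h : ∀ j, q.eval (z j) = a j * (Lagrange.nodal (univ.erase j) z).eval (z j)) :
    q = numer z a := by
  refine Polynomial.eq_of_degrees_lt_of_eval_index_eq univ hz.injOn (by simpa using hq)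
    (by simpa using degree_numer_lt a) fun j _ => ?_
  rw [h, eval_numer_node]

theorem monic_onePlusNumer (a : Fin N → ℂ) : (onePlusNumer z a).Monic :=
  Lagrange.nodal_monic.add_of_left (by simpa [Lagrange.degree_nodal] using degree_numer_lt a)

theorem degree_onePlusNumer (a : Fin N → ℂ) : (onePlusNumer z a).degree = N := by
  rw [onePlusNumer, degree_add_eq_left_of_degree_lt] <;>
    simp [Lagrange.degree_nodal, degree_numer_lt a]

theorem natDegree_onePlusNumer (a : Fin N → ℂ) : (onePlusNumer z a).natDegree = N :=
  natDegree_eq_of_degree_eq_some (degree_onePlusNumer a)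

end PartialFractions

section Divisibility

open Polynomial

theorem eventually_eval_ne_zero {p : ℂ[X]} (hp : p ≠ 0) (w : ℂ) :
    ∀ᶠ μ in 𝓝[≠] w, p.eval μ ≠ 0 := by
  have hfin := (Polynomial.finite_setOfPred_isRoot hp).subset (Set.sdiff_subset (t := {w}))
  filter_upwards [self_mem_nhdsWithin,
    mem_nhdsWithin_of_mem_nhds (hfin.isClosed.compl_mem_nhds (by simp))] with μ h1 h2 h3
  exact h2 ⟨h3, h1⟩

theorem eventually_forall_ne {N : ℕ} (z : Fin N → ℂ) (w : ℂ) : ∀ᶠ μ in 𝓝[≠] w, ∀ j, μ ≠ z j := by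
  filter_upwards [eventually_eval_ne_zero (Lagrange.nodal_ne_zero (s := Finset.univ) (v := z)) w]
    with μ hμ j hj
  exact hμ (hj ▸ Lagrange.eval_nodal_at_node (Finset.mem_univ j))

/-- A polynomial is divisible by another one if the quotient has no poles. -/
theorem dvd_of_forall_tendsto {s n : ℂ[X]} (hn : n ≠ 0)
    (h : ∀ w : ℂ, ∃ l : Filter ℂ, l.NeBot ∧ l ≤ 𝓝[≠] w ∧
      Tendsto (fun μ => (μ - w) * (s.eval μ / n.eval μ)) l (𝓝 0)) : n ∣ s := by
  rcases eq_or_ne s 0 with rfl | hs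
  · exact dvd_zero n
  rw [(IsAlgClosed.splits n).dvd_iff_roots_le_roots hn hs, Multiset.le_iff_count]
  intro w
  rw [count_roots, count_roots]
  -- If the multiplicity `a` of `w` in `s` were less than its multiplicity `k` in `n`, multiplying
  -- `(μ - w) s / n` by `(μ - w) ^ (k - a - 1) n1` would leave `s1`. Along `l` this tends both to
  -- zero and to `s1(w) ≠ 0`.
  by_contra! hlt
  obtain ⟨l, hl, hle, hlim⟩ := h w
  obtain ⟨s1, hs1, hs1'⟩ := s.exists_eq_pow_rootMultiplicity_mul_and_not_dvd hs w
  obtain ⟨n1, hn1, hn1'⟩ := n.exists_eq_pow_rootMultiplicity_mul_and_not_dvd hn w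
  set a := rootMultiplicity w s
  set k := rootMultiplicity w n
  rw [dvd_iff_isRoot, IsRoot] at hs1' hn1'
  have h1 : Tendsto (fun μ => n1.eval μ * ((μ - w) ^ (k - a - 1) *
      ((μ - w) * (s.eval μ / n.eval μ)))) l (𝓝 (n1.eval w * ((w - w) ^ (k - a - 1) * 0))) := by
    have hl' : l ≤ 𝓝 w := hle.trans nhdsWithin_le_nhds
    refine ((n1.continuous.tendsto w).mono_left hl').mul (Tendsto.mul ?_ hlim)
    exact (((continuous_id.sub continuous_const).pow _).tendsto w).mono_left hl'
  have h2 : Tendsto (fun μ => n1.eval μ * ((μ - w) ^ (k - a - 1) *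
      ((μ - w) * (s.eval μ / n.eval μ)))) l (𝓝 (s1.eval w)) := by
    refine ((s1.continuous.tendsto w).mono_left (hle.trans nhdsWithin_le_nhds)).congr' ?_
    filter_upwards [hle (eventually_eval_ne_zero hn w), hle self_mem_nhdsWithin] with μ h3 h4
    have h5 : μ - w ≠ 0 := sub_ne_zero.2 h4
    have es : s.eval μ = (μ - w) ^ a * s1.eval μ := by
      conv_lhs => rw [hs1]
      simp
    have en : n.eval μ = (μ - w) ^ k * n1.eval μ := by
      conv_lhs => rw [hn1]
      simp
    rw [en] at h3
    have h6 : n1.eval μ ≠ 0 := right_ne_zero_of_mul h3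
    obtain ⟨m, hm⟩ : ∃ m, k = a + 1 + m := ⟨k - a - 1, by omega⟩
    have hm' : k - a - 1 = m := by omega
    rw [es, en, hm', hm]
    field_simp
    ring
  apply hs1'
  have := tendsto_nhds_unique h2 h1
  simpa using this

end Divisibility

end PolynomialAlgebra

/-! ### The orthogonal complement for rational `ψ`. -/

section FiniteDefect

open Polynomial (C X)

variable {N : ℕ} {z : Fin N → ℂ}

theorem memLp_sum_div_mul (hz : ∀ j, (z j).im < 0) (a : Fin N → ℂ) {f : ℝ → ℂ}
    (hf : MemLp f 2 volume) : MemLp (fun x : ℝ => (∑ j, a j / ((x : ℂ) - z j)) * f x) 2 volume := by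
  have h1 := memLp_finsetSum Finset.univ fun j _ => (memLp_kern_mul (z j) hf).const_mul (a j)
  refine h1.ae_eq (Eventually.of_forall fun x => ?_)
  simp only [Finset.sum_mul, kern_of_im_ne (hz _).ne]
  exact Finset.sum_congr rfl fun j _ => by ring

theorem cau_sum_div_mul (hz : ∀ j, (z j).im < 0) (a : Fin N → ℂ) {f : ℝ → ℂ}
    (hf : MemLp f 2 volume) {μ : ℂ} (hμ : μ.im ≠ 0) (hne : ∀ j, μ ≠ z j) :
    cau (fun x : ℝ => (∑ j, a j / ((x : ℂ) - z j)) * f x) μ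
      = ∑ j, a j / (μ - z j) * (cau f μ - cau f (z j)) := by
  have hfj : ∀ j, MemLp (fun x : ℝ => f x / ((x : ℂ) - z j)) 2 volume := fun j => by
    refine (memLp_kern_mul (z j) hf).ae_eq (Eventually.of_forall fun x => ?_)
    simp only [kern_of_im_ne (hz j).ne]; ring
  have e : ∀ x : ℝ, (∑ j, a j / ((x : ℂ) - z j)) * f x / ((x : ℂ) - μ)
      = ∑ j, a j * (f x / ((x : ℂ) - z j) / ((x : ℂ) - μ)) := fun x => by
    rw [Finset.sum_mul, Finset.sum_div]
    exact Finset.sum_congr rfl fun j _ => by ring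
  rw [cau]
  simp only [e]
  rw [integral_finsetSum _ fun j _ => (integrable_div_of_memLp (hfj j) hμ).const_mul _]
  refine Finset.sum_congr rfl fun j _ => ?_
  rw [integral_const_mul]
  have := cau_div_eq hf hμ (hz j).ne (hne j)
  rw [cau] at this
  rw [this]; ring

/-- Multiplication by a rational function `r` almost commutes with the Cauchy transform: after
clearing denominators, `cau (r f)` and `r cau f` differ by a polynomial of degree less than `N`,
built from the values of `cau f` at the nodes. -/
theorem eval_mul_cau_sum_div_mul (hz : ∀ j, (z j).im < 0) (a : Fin N → ℂ) {f : ℝ → ℂ}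
    (hf : MemLp f 2 volume) {μ : ℂ} (hμ : μ.im ≠ 0) (hne : ∀ j, μ ≠ z j) :
    (Lagrange.nodal Finset.univ z).eval μ *
        cau (fun x : ℝ => (∑ j, a j / ((x : ℂ) - z j)) * f x) μ
      = (numer z a).eval μ * cau f μ - (numer z fun j => a j * cau f (z j)).eval μ := by
  rw [cau_sum_div_mul hz a hf hμ hne, eval_numer hne, eval_numer hne, mul_assoc, ← mul_sub,
    Finset.sum_mul, ← Finset.sum_sub_distrib]
  congr 1
  exact Finset.sum_congr rfl fun j _ => by ring

theorem eq_of_eventually_punctured {F G : ℂ → ℂ} {μ : ℂ} (hF : ContinuousAt F μ)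
    (hG : ContinuousAt G μ) (h : ∀ᶠ ν in 𝓝[≠] μ, F ν = G ν) : F μ = G μ :=
  tendsto_nhds_unique (hF.tendsto.mono_left (nhdsWithin_le_nhds (s := {μ}ᶜ)))
    ((hG.tendsto.mono_left (nhdsWithin_le_nhds (s := {μ}ᶜ))).congr'
      (by filter_upwards [h] with ν hν using hν.symm))

theorem eventually_im_ne {μ : ℂ} (hμ : μ.im ≠ 0) : ∀ᶠ ν in 𝓝[≠] μ, ν.im ≠ 0 :=
  mem_nhdsWithin_of_mem_nhds (Complex.continuous_im.continuousAt.eventually_ne hμ)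

theorem eventually_im_neg {μ : ℂ} (hμ : μ.im < 0) : ∀ᶠ ν in 𝓝[≠] μ, ν.im < 0 :=
  mem_nhdsWithin_of_mem_nhds
    ((isOpen_lt Complex.continuous_im continuous_const).mem_nhds hμ)

theorem eventually_im_pos {μ : ℂ} (hμ : 0 < μ.im) : ∀ᶠ ν in 𝓝[≠] μ, 0 < ν.im :=
  mem_nhdsWithin_of_mem_nhds
    ((isOpen_lt continuous_const Complex.continuous_im).mem_nhds hμ)

variable {φ ψ : L2R} {B : ℂ} {Φ : ℂ → ℂ} {c : Fin N → ℂ}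

/-- The residue of `D₊` at `zⱼ`. -/
def residue (Φ : ℂ → ℂ) (c z : Fin N → ℂ) (j : Fin N) : ℂ :=
  2 * Real.pi * Complex.I * (c j * lowerExt Φ (z j))

/-- The numerator of `D₊` over the denominator `∏ⱼ (X - zⱼ)`. -/
def numerDPlus (Φ : ℂ → ℂ) (c z : Fin N → ℂ) : Polynomial ℂ := onePlusNumer z (residue Φ c z)

theorem funDPlus_eq (Φ : ℂ → ℂ) (c z : Fin N → ℂ) (μ : ℂ) :
    funDPlus Φ c z μ = 1 + ∑ j, residue Φ c z j / (μ - z j) := by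
  rw [funDPlus, Finset.mul_sum]
  congr 1
  exact Finset.sum_congr rfl fun j _ => by rw [residue]; ring

theorem eval_numerDPlus {μ : ℂ} (h : ∀ j, μ ≠ z j) :
    (numerDPlus Φ c z).eval μ
      = (Lagrange.nodal Finset.univ z).eval μ * funDPlus Φ c z μ := by
  rw [numerDPlus, eval_onePlusNumer h, funDPlus_eq]

theorem numerDPlus_ne_zero (Φ : ℂ → ℂ) (c z : Fin N → ℂ) : numerDPlus Φ c z ≠ 0 :=
  (monic_onePlusNumer _).ne_zero

theorem mul_cau_conj_node (hφ : IsHardyExtension Φ φ) (hz : ∀ j, (z j).im < 0) (j : Fin N) :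
    c j * cau (fun x => conj (φ x)) (z j) = -residue Φ c z j := by
  rw [hφ.cau_conj_eq (hz j), residue]; ring

theorem memLp_conj (φ : L2R) : MemLp (fun x => conj (φ x)) 2 volume := (Lp.memLp φ).star

/-- Pairing `g` with `rk μ` and with `Res μ ψ` gives the Cauchy transforms of `conj g` and `ψ conj
g`; the right-hand side is orthogonality to the generators of `kerSpan`. -/
theorem mem_orthogonal_detectable_iff (hφ : IsHardyExtension Φ φ) (hψ : ψ ∈ HardyPlus)
    (hB : B ≠ Real.pi * Complex.I) (hB' : B ≠ -(Real.pi * Complex.I)) {μ₀ : ℂ}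
    (hμ₀ : μ₀ ∈ resolventSet (opB φ ψ B)) (g : L2R) :
    g ∈ (detectable φ ψ B μ₀)ᗮ ↔ (∀ μ : ℂ, 0 < μ.im → cau (fun x => conj (g x)) μ = 0) ∧
      ∀ μ : ℂ, μ.im < 0 → funD φ ψ μ * cau (fun x => conj (g x)) μ
        - cau (fun x => conj (φ x)) μ * cau (fun x => ψ x * conj (g x)) μ = 0 := by
  rw [← Submodule.orthogonal_closure, detectable_closure_eq hφ hψ hB hB' hμ₀,
    Submodule.orthogonal_closure, kerSpan, Submodule.mem_orthogonal']
  have e1 : ∀ μ : ℂ, μ.im ≠ 0 → inner ℂ g (rk μ) = cau (fun x => conj (g x)) μ := fun μ hμ =>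
    inner_rk g hμ
  have e2 : ∀ μ : ℂ, μ.im ≠ 0 → inner ℂ g (kerVec φ ψ μ)
      = funD φ ψ μ * cau (fun x => conj (g x)) μ
        - cau (fun x => conj (φ x)) μ * cau (fun x => ψ x * conj (g x)) μ := fun μ hμ => by
    have h1 : funD g ψ μ - 1 = cau (fun x => ψ x * conj (g x)) μ := by
      simp only [funD_eq, add_sub_cancel_left]
    rw [kerVec, inner_sub_right, inner_smul_right, inner_smul_right, e1 μ hμ, inner_Res g ψ hμ, h1]
  constructor
  · intro h
    refine ⟨fun μ hμ => ?_, fun μ hμ => ?_⟩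
    · rw [← e1 μ hμ.ne']
      exact h _ (Submodule.subset_span (Or.inl ⟨μ, hμ, rfl⟩))
    · rw [← e2 μ hμ.ne]
      exact h _ (Submodule.subset_span (Or.inr ⟨μ, hμ, rfl⟩))
  · rintro ⟨h1, h2⟩ u hu
    have hle : Submodule.span ℂ (rk '' {μ | 0 < μ.im} ∪ kerVec φ ψ '' {μ | μ.im < 0})
        ≤ LinearMap.ker (innerSL ℂ g).toLinearMap := by
      rw [Submodule.span_le]
      rintro _ (⟨μ, hμ, rfl⟩ | ⟨μ, hμ, rfl⟩)
      · exact (e1 μ (ne_of_gt hμ)).trans (h1 μ hμ)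
      · exact (e2 μ (ne_of_lt hμ)).trans (h2 μ hμ)
    exact hle hu

section Rational

variable (hφ : IsHardyExtension Φ φ) (hz : ∀ j, (z j).im < 0)
  (hψz : ψ =ᵐ[volume] fun x : ℝ => ∑ j, c j / ((x : ℂ) - z j))

theorem cau_mul_eq (hψz : ψ =ᵐ[volume] fun x : ℝ => ∑ j, c j / ((x : ℂ) - z j)) (f : ℝ → ℂ)
    (μ : ℂ) : cau (fun x => ψ x * f x) μ
      = cau (fun x : ℝ => (∑ j, c j / ((x : ℂ) - z j)) * f x) μ := by
  refine cau_congr ?_ μ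
  filter_upwards [hψz] with x hx
  rw [hx]

include hφ hz hψz

/-- With `ψ` read as a rational function this is `D = D₊ + ψ · cau (conj φ)`; the node values `cⱼ
cau (conj φ) (zⱼ)` are minus the residues of `D₊`. The second term drops out in `ℂ₊`. -/
theorem eval_mul_funD {μ : ℂ} (hμ : μ.im ≠ 0) (hne : ∀ j, μ ≠ z j) :
    (Lagrange.nodal Finset.univ z).eval μ * funD φ ψ μ = (numerDPlus Φ c z).eval μ
      + (numer z c).eval μ * cau (fun x => conj (φ x)) μ := by
  have h1 := eval_mul_cau_sum_div_mul hz c (memLp_conj φ) hμ hne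
  rw [← cau_mul_eq hψz] at h1
  have h2 : (numer z fun j => c j * cau (fun x => conj (φ x)) (z j)).eval μ
      = -(numer z (residue Φ c z)).eval μ := by
    simp only [mul_cau_conj_node hφ hz, eval_numer hne, neg_div, Finset.sum_neg_distrib, mul_neg]
  rw [h2] at h1
  rw [funD_eq, numerDPlus, onePlusNumer, Polynomial.eval_add]
  linear_combination h1

theorem funD_eq_funDPlus {μ : ℂ} (hμ : 0 < μ.im) : funD φ ψ μ = funDPlus Φ c z μ := by
  have hne : ∀ j, μ ≠ z j := fun j h => by have := hz j; rw [← h] at this; linarith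
  have h1 := eval_mul_funD hφ hz hψz hμ.ne' hne
  rw [hφ.cau_conj_eq_zero hμ, mul_zero, add_zero, eval_numerDPlus hne] at h1
  exact mul_left_cancel₀ (eval_nodal_ne_zero hne) h1

/-- The terms `ψ · cau (conj φ) · cau f` coming from `D` and from `cau (ψ f)` cancel. Only `D₊` and
the node values of `cau f` survive. -/
theorem eval_mul_pairing {f : ℝ → ℂ} (hf : MemLp f 2 volume) {μ : ℂ} (hμ : μ.im ≠ 0)
    (hne : ∀ j, μ ≠ z j) :
    (Lagrange.nodal Finset.univ z).eval μ * (funD φ ψ μ * cau f μ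
        - cau (fun x => conj (φ x)) μ * cau (fun x => ψ x * f x) μ)
      = (numerDPlus Φ c z).eval μ * cau f μ
        + cau (fun x => conj (φ x)) μ * (numer z fun j => c j * cau f (z j)).eval μ := by
  have h1 := eval_mul_cau_sum_div_mul hz c hf hμ hne
  rw [← cau_mul_eq hψz] at h1
  have h2 := eval_mul_funD hφ hz hψz hμ hne
  linear_combination cau f μ * h2 - cau (fun x => conj (φ x)) μ * h1

omit hφ hz hψz in
theorem ae_eval_numerDPlus_ne_zero : ∀ᵐ x : ℝ, (numerDPlus Φ c z).eval (x : ℂ) ≠ 0 := by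
  have hfin : {x : ℝ | (numerDPlus Φ c z).IsRoot (x : ℂ)}.Finite :=
    (Polynomial.finite_setOfPred_isRoot (numerDPlus_ne_zero Φ c z)).preimage
      Complex.ofReal_injective.injOn
  simpa [ae_iff] using hfin.measure_zero volume

omit hφ hψz in
theorem ofReal_ne_node (x : ℝ) (j : Fin N) : (x : ℂ) ≠ z j := fun h => by
  have := hz j; rw [← h] at this; simp at this

/-- An `L²` function orthogonal to the detectable subspace is a rational multiple of `φ`. -/
theorem exists_polynomial_of_pairing {f : ℝ → ℂ} (hf : MemLp f 2 volume)
    (h1 : ∀ μ : ℂ, 0 < μ.im → cau f μ = 0)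
    (h2 : ∀ μ : ℂ, μ.im < 0 → funD φ ψ μ * cau f μ
        - cau (fun x => conj (φ x)) μ * cau (fun x => ψ x * f x) μ = 0) :
    ∃ q : Polynomial ℂ, q.degree < N ∧
      (f =ᵐ[volume] fun x : ℝ => conj (φ x) * (q.eval (x : ℂ) / (numerDPlus Φ c z).eval (x : ℂ))) ∧
      (∀ μ : ℂ, μ.im < 0 → (∀ j, μ ≠ z j) →
        (numerDPlus Φ c z).eval μ * cau f μ = cau (fun x => conj (φ x)) μ * q.eval μ) ∧
      ∀ j, q.eval (z j) =
        -(c j * cau f (z j)) * (Lagrange.nodal (Finset.univ.erase j) z).eval (z j) := by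
  set a : Fin N → ℂ := fun j => c j * cau f (z j) with ha
  have hneg : numer z (fun j => -a j) = -numer z a := by
    simp [numer, Finset.sum_neg_distrib]
  have hrel : ∀ μ : ℂ, μ.im ≠ 0 → (∀ j, μ ≠ z j) → (numerDPlus Φ c z).eval μ * cau f μ
      + cau (fun x => conj (φ x)) μ * (numer z a).eval μ = 0 := by
    intro μ hμ hne
    rcases lt_or_gt_of_ne hμ with h | h
    · have := eval_mul_pairing hφ hz hψz hf hμ hne
      rw [h2 μ h, mul_zero] at this
      exact this.symm
    · rw [h1 μ h, hφ.cau_conj_eq_zero h, mul_zero, zero_mul, add_zero]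
  refine ⟨numer z fun j => -a j, degree_numer_lt _, ?_, fun μ hμ hne => ?_, fun j => ?_⟩
  -- The claim is `D₊ f + (∑ aⱼ / (x - zⱼ)) conj φ = 0` on the line. It suffices that the Cauchy
  -- transform of the left-hand side vanishes.
  · set e1 : ℝ → ℂ := fun x => (∑ j, residue Φ c z j / ((x : ℂ) - z j)) * f x with he1
    set e2 : ℝ → ℂ := fun x => (∑ j, a j / ((x : ℂ) - z j)) * conj (φ x) with he2
    have m1 : MemLp e1 2 volume := memLp_sum_div_mul hz _ hf
    have m2 : MemLp e2 2 volume := memLp_sum_div_mul hz _ (memLp_conj φ)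
    have mm : MemLp (f + e1 + e2) 2 volume := (hf.add m1).add m2
    have hcau : ∀ μ : ℂ, μ.im ≠ 0 → (∀ j, μ ≠ z j) → cau (f + e1 + e2) μ = 0 := by
      intro μ hμ hne
      have s1 := eval_mul_cau_sum_div_mul hz (residue Φ c z) hf hμ hne
      have s2 := eval_mul_cau_sum_div_mul hz a (memLp_conj φ) hμ hne
      have s3 : cau (f + e1 + e2) μ = cau f μ + cau e1 μ + cau e2 μ := by
        have i1 := integrable_div_of_memLp hf hμ
        have i2 := integrable_div_of_memLp m1 hμ
        have i3 := integrable_div_of_memLp m2 hμ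
        have i12 : Integrable fun x : ℝ => f x / ((x : ℂ) - μ) + e1 x / ((x : ℂ) - μ) := i1.add i2
        rw [cau, cau, cau, cau, ← integral_add i1 i2, ← integral_add i12 i3]
        simp only [Pi.add_apply, add_div]
      -- The polynomial corrections from `e1` and `e2` cancel, because `cⱼ cau (conj φ) (zⱼ)` is
      -- minus the residue at `zⱼ`.
      have s4 : (numer z fun j => a j * cau (fun x => conj (φ x)) (z j)).eval μ
          = -(numer z fun j => residue Φ c z j * cau f (z j)).eval μ := by
        rw [eval_numer hne, eval_numer hne, ← mul_neg, ← Finset.sum_neg_distrib]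
        congr 1
        refine Finset.sum_congr rfl fun j _ => ?_
        rw [← neg_div]
        congr 1
        have := mul_cau_conj_node (c := c) hφ hz j
        simp only [ha]
        linear_combination cau f (z j) * this
      rw [s4] at s2
      refine mul_left_cancel₀ (eval_nodal_ne_zero hne) ?_
      rw [mul_zero, s3]
      have s5 := hrel μ hμ hne
      rw [numerDPlus, onePlusNumer, Polynomial.eval_add] at s5
      linear_combination s1 + s2 + s5
    have hz0 := ae_eq_zero_of_cau_eq_zero mm (fun μ hμ => by
      refine eq_of_eventually_punctured (differentiableAt_cau mm hμ).continuousAt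
        (continuousAt_const (y := (0 : ℂ))) ?_
      filter_upwards [eventually_im_ne hμ, eventually_forall_ne z μ] with ν h3 h4
        using hcau ν h3 h4)
    filter_upwards [hz0, ae_eval_numerDPlus_ne_zero (Φ := Φ) (c := c) (z := z)] with x h3 h4
    have hx := ofReal_ne_node hz x
    rw [hneg, Polynomial.eval_neg, eval_numer hx, ← mul_div_assoc, eq_div_iff h4, numerDPlus,
      eval_onePlusNumer hx]
    simp only [Pi.add_apply, he1, he2, Pi.zero_apply] at h3
    linear_combination (Lagrange.nodal Finset.univ z).eval (x : ℂ) * h3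
  · rw [hneg, Polynomial.eval_neg]
    linear_combination hrel μ hμ.ne hne
  · rw [eval_numer_node]

omit hψz in
/-- The Cauchy transform of an `L²` function of the form `conj φ · q / n`, where `n` is the
numerator of `D₊`. -/
theorem cau_of_polynomial (hinj : Function.Injective z)
    {f : ℝ → ℂ} (hf : MemLp f 2 volume) {q : Polynomial ℂ} (hq : q.degree < N)
    (hfq : f =ᵐ[volume] fun x : ℝ =>
      conj (φ x) * (q.eval (x : ℂ) / (numerDPlus Φ c z).eval (x : ℂ)))
    (hlim : ∀ w : ℂ, w.im < 0 → ∃ l, Tendsto (fun μ => cau (fun x => conj (φ x)) μ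
      * (q.eval μ / (numerDPlus Φ c z).eval μ)) (𝓝[≠] w) (𝓝 l))
    (hnode : ∀ j, Tendsto (fun μ => cau (fun x => conj (φ x)) μ
      * (q.eval μ / (numerDPlus Φ c z).eval μ)) (𝓝[≠] (z j))
        (𝓝 (-(q.eval (z j) / (c j * (Lagrange.nodal (Finset.univ.erase j) z).eval (z j)))))) :
    (∀ μ : ℂ, 0 < μ.im → cau f μ = 0) ∧
      (∀ μ : ℂ, μ.im ≠ 0 → (∀ j, μ ≠ z j) →
        (numerDPlus Φ c z).eval μ * cau f μ = cau (fun x => conj (φ x)) μ * q.eval μ) ∧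
      ∀ j, cau f (z j) =
        -(q.eval (z j) / (c j * (Lagrange.nodal (Finset.univ.erase j) z).eval (z j))) := by
  set n := numerDPlus Φ c z with hn
  set β := cau (fun x => conj (φ x)) with hβ
  set a : Fin N → ℂ := fun j =>
    q.eval (z j) / (Lagrange.nodal (Finset.univ.erase j) z).eval (z j) with ha
  have hn0 : n ≠ 0 := numerDPlus_ne_zero Φ c z
  have hqa : q = numer z a := eq_numer hinj hq fun j =>
    (div_mul_cancel₀ _ (eval_nodal_erase_node_ne_zero hinj j)).symm
  -- The error in `n · cau f = β q` is a polynomial of degree less than `N = deg n`. It is zero once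
  -- `s / n` is shown to have no poles.
  set s : Polynomial ℂ := numer z fun j => residue Φ c z j * cau f (z j) - a j * β (z j) with hs
  have key : ∀ μ : ℂ, μ.im ≠ 0 → (∀ j, μ ≠ z j) → n.eval μ * cau f μ - β μ * q.eval μ = s.eval μ := by
    intro μ hμ hne
    have s1 := eval_mul_cau_sum_div_mul hz (residue Φ c z) hf hμ hne
    have s2 := eval_mul_cau_sum_div_mul hz a (memLp_conj φ) hμ hne
    have s3 : cau f μ + cau (fun x : ℝ => (∑ j, residue Φ c z j / ((x : ℂ) - z j)) * f x) μ
        = cau (fun x : ℝ => (∑ j, a j / ((x : ℂ) - z j)) * conj (φ x)) μ := by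
      rw [cau, cau, ← integral_add (integrable_div_of_memLp hf hμ)
        (integrable_div_of_memLp (memLp_sum_div_mul hz _ hf) hμ)]
      refine integral_congr_ae ?_
      filter_upwards [hfq, ae_eval_numerDPlus_ne_zero (Φ := Φ) (c := c) (z := z)] with x h3 h4
      have hx := ofReal_ne_node hz x
      rw [← mul_div_assoc, eq_div_iff h4, hqa, eval_numer hx, numerDPlus,
        eval_onePlusNumer hx] at h3
      rw [← add_div]
      congr 1
      refine mul_left_cancel₀ (eval_nodal_ne_zero hx) ?_
      linear_combination h3
    have s4 : s.eval μ = (numer z fun j => residue Φ c z j * cau f (z j)).eval μ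
        - (numer z fun j => a j * β (z j)).eval μ := by
      rw [hs, eval_numer hne, eval_numer hne, eval_numer hne, ← mul_sub, ← Finset.sum_sub_distrib]
      simp only [sub_div]
    rw [s4, hn, numerDPlus, onePlusNumer, Polynomial.eval_add, hqa]
    linear_combination (Lagrange.nodal Finset.univ z).eval μ * s3 - s1 + s2
  have hdiv : ∀ w : ℂ, ∀ᶠ μ in 𝓝[≠] w, μ.im ≠ 0 →
      s.eval μ / n.eval μ = cau f μ - β μ * (q.eval μ / n.eval μ) := by
    intro w
    filter_upwards [eventually_eval_ne_zero hn0 w, eventually_forall_ne z w] with μ h1 h2 h3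
    rw [← key μ h3 h2]
    field_simp
  have hs0 : s = 0 := by
    refine Polynomial.eq_zero_of_dvd_of_degree_lt (dvd_of_forall_tendsto hn0 fun w => ?_) ?_
    · rcases lt_trichotomy w.im 0 with hw | hw | hw
      · refine ⟨𝓝[≠] w, inferInstance, le_rfl, ?_⟩
        obtain ⟨l, hl⟩ := hlim w hw
        have h1 : Tendsto (fun μ : ℂ => μ - w) (𝓝[≠] w) (𝓝 (w - w)) :=
          (tendsto_id.sub_const w).mono_left nhdsWithin_le_nhds
        have h2 := h1.mul (((differentiableAt_cau hf hw.ne).continuousAt.tendsto.mono_left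
          (nhdsWithin_le_nhds (s := {w}ᶜ))).sub hl)
        rw [sub_self, zero_mul] at h2
        refine h2.congr' ?_
        filter_upwards [hdiv w, eventually_im_ne hw.ne] with μ h3 h4
        rw [h3 h4]
      -- At a real point, approach vertically from above. There `β = 0`, and `cau f` grows at most
      -- like `y ^ (-1/2)`, too slowly for a pole.
      · refine ⟨map (fun y : ℝ => w + y * Complex.I) (𝓝[>] 0), inferInstance, ?_, ?_⟩
        · refine tendsto_nhdsWithin_iff.2 ⟨?_, ?_⟩
          · have : Continuous fun y : ℝ => w + y * Complex.I := by fun_prop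
            simpa using (this.tendsto 0).mono_left (nhdsWithin_le_nhds (s := Set.Ioi 0))
          · filter_upwards [self_mem_nhdsWithin] with y hy
            have : y ≠ 0 := ne_of_gt hy
            simp [this]
        · have hev : ∀ᶠ y : ℝ in 𝓝[>] 0, s.eval (w + y * Complex.I) / n.eval (w + y * Complex.I)
              = cau f (w + y * Complex.I) := by
            have ht : Tendsto (fun y : ℝ => w + y * Complex.I) (𝓝[>] 0) (𝓝[≠] w) := by
              refine tendsto_nhdsWithin_iff.2 ⟨?_, ?_⟩
              · have : Continuous fun y : ℝ => w + y * Complex.I := by fun_prop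
                simpa using (this.tendsto 0).mono_left (nhdsWithin_le_nhds (s := Set.Ioi 0))
              · filter_upwards [self_mem_nhdsWithin] with y hy
                have : y ≠ 0 := ne_of_gt hy
                simp [this]
            filter_upwards [ht.eventually (hdiv w), self_mem_nhdsWithin] with y h1 h2
            have him : 0 < (w + y * Complex.I).im := by simpa [hw] using h2
            rw [h1 him.ne', hβ, hφ.cau_conj_eq_zero him, zero_mul, sub_zero]
          rw [tendsto_map'_iff, tendsto_zero_iff_norm_tendsto_zero]
          have hb : Tendsto (fun y : ℝ => Real.sqrt (Real.pi * y) * (eLpNorm f 2 volume).toReal)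
              (𝓝[>] 0) (𝓝 0) := by
            have : Continuous fun y : ℝ => Real.sqrt (Real.pi * y) * (eLpNorm f 2 volume).toReal := by
              fun_prop
            simpa using (this.tendsto 0).mono_left (nhdsWithin_le_nhds (s := Set.Ioi 0))
          refine squeeze_zero' (Eventually.of_forall fun _ => norm_nonneg _) ?_ hb
          filter_upwards [hev, self_mem_nhdsWithin] with y h1 h2
          have hy : 0 < y := h2
          have him : (w + y * Complex.I).im = y := by simp [hw]
          simp only [Function.comp_apply]
          rw [h1, norm_mul, add_sub_cancel_left, norm_mul, Complex.norm_I, mul_one,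
            Complex.norm_real, Real.norm_of_nonneg hy.le]
          have h3 := norm_cau_le_of_memLp hf (μ := w + y * Complex.I) (by rw [him]; exact hy.ne')
          rw [him, abs_of_pos hy] at h3
          have h4 : y * Real.sqrt (Real.pi / y) = Real.sqrt (Real.pi * y) := by
            rw [show Real.pi * y = y ^ 2 * (Real.pi / y) by field_simp,
              Real.sqrt_mul (sq_nonneg y), Real.sqrt_sq hy.le]
          rw [← h4, mul_assoc]
          exact mul_le_mul_of_nonneg_left h3 hy.le
      · refine ⟨𝓝[≠] w, inferInstance, le_rfl, ?_⟩
        have h1 : Tendsto (fun μ : ℂ => μ - w) (𝓝[≠] w) (𝓝 (w - w)) :=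
          (tendsto_id.sub_const w).mono_left nhdsWithin_le_nhds
        have h2 := h1.mul ((differentiableAt_cau hf hw.ne').continuousAt.tendsto.mono_left
          (nhdsWithin_le_nhds (s := {w}ᶜ)))
        rw [sub_self, zero_mul] at h2
        refine h2.congr' ?_
        filter_upwards [hdiv w, eventually_im_pos hw] with μ h3 h4
        rw [h3 h4.ne', hβ, hφ.cau_conj_eq_zero h4, zero_mul, sub_zero]
    · rw [hn, numerDPlus, degree_onePlusNumer]
      exact degree_numer_lt _
  have key' : ∀ μ : ℂ, μ.im ≠ 0 → (∀ j, μ ≠ z j) → n.eval μ * cau f μ = β μ * q.eval μ := by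
    intro μ hμ hne
    have := key μ hμ hne
    rw [hs0, Polynomial.eval_zero, sub_eq_zero] at this
    exact this
  refine ⟨fun μ hμ => ?_, key', fun j => ?_⟩
  · refine eq_of_eventually_punctured (differentiableAt_cau hf hμ.ne').continuousAt
        (continuousAt_const (y := (0 : ℂ))) ?_
    filter_upwards [eventually_im_pos hμ, eventually_forall_ne z μ,
      eventually_eval_ne_zero hn0 μ] with ν h1 h2 h3
    have := key' ν h1.ne' h2
    rw [hβ, hφ.cau_conj_eq_zero h1, zero_mul] at this
    exact (mul_eq_zero.1 this).resolve_left h3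
  · refine tendsto_nhds_unique ((differentiableAt_cau hf (hz j).ne).continuousAt.tendsto.mono_left
      (nhdsWithin_le_nhds (s := {z j}ᶜ))) ((hnode j).congr' ?_)
    filter_upwards [eventually_im_ne (hz j).ne, eventually_forall_ne z (z j),
      eventually_eval_ne_zero hn0 (z j)] with ν h1 h2 h3
    rw [← mul_div_assoc, ← key' ν h1 h2, mul_div_cancel_left₀ _ h3]

/-- The node values force `q` to be minus the interpolation polynomial in `eval_mul_pairing`, so the
relation `n · cau f = β q` is the pairing equation away from the nodes; continuity covers the nodes.
-/
theorem pairing_eq_zero_of_polynomial (hinj : Function.Injective z) (hc : ∀ j, c j ≠ 0)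
    {f : ℝ → ℂ} (hf : MemLp f 2 volume) {q : Polynomial ℂ} (hq : q.degree < N)
    (hrel : ∀ μ : ℂ, μ.im ≠ 0 → (∀ j, μ ≠ z j) →
        (numerDPlus Φ c z).eval μ * cau f μ = cau (fun x => conj (φ x)) μ * q.eval μ)
    (hnode : ∀ j, cau f (z j) =
        -(q.eval (z j) / (c j * (Lagrange.nodal (Finset.univ.erase j) z).eval (z j))))
    {μ : ℂ} (hμ : μ.im < 0) : funD φ ψ μ * cau f μ
        - cau (fun x => conj (φ x)) μ * cau (fun x => ψ x * f x) μ = 0 := by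
  have hqa : q = numer z fun j => -(c j * cau f (z j)) := eq_numer hinj hq fun j => by
    have := eval_nodal_erase_node_ne_zero hinj j
    have := hc j
    rw [hnode]; field_simp
  have hneg : numer z (fun j => -(c j * cau f (z j))) = -numer z fun j => c j * cau f (z j) := by
    simp [numer, Finset.sum_neg_distrib]
  have hcont : ContinuousAt (fun μ => funD φ ψ μ * cau f μ
        - cau (fun x => conj (φ x)) μ * cau (fun x => ψ x * f x) μ) μ := by
    have i : Integrable fun x => ψ x * f x := (Lp.memLp ψ).integrable_mul hf
    exact (((differentiableAt_funD φ ψ hμ.ne).mul (differentiableAt_cau hf hμ.ne)).sub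
      ((differentiableAt_cau (memLp_conj φ) hμ.ne).mul
        (differentiableAt_cau_of_integrable i hμ.ne))).continuousAt
  refine eq_of_eventually_punctured hcont (continuousAt_const (y := (0 : ℂ))) ?_
  filter_upwards [eventually_im_neg hμ, eventually_forall_ne z μ] with ν h1 h2
  refine mul_left_cancel₀ (eval_nodal_ne_zero h2) ?_
  rw [eval_mul_pairing hφ hz hψz hf h1.ne h2, hrel ν h1.ne h2, hqa, hneg, Polynomial.eval_neg]
  ring

end Rational

end FiniteDefect

/-! ### Regularity of `conj φ · q / n` as divisibility of `q`. -/

section Singularities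

open Polynomial (C X)

section LocallySquareIntegrable

/-- Square integrability on a neighbourhood of `t`. -/
def LocL2 (f : ℝ → ℂ) (t : ℝ) : Prop :=
  ∃ ε > 0, MemLp f 2 (volume.restrict (Set.Ioo (t - ε) (t + ε)))

theorem LocL2.mul {f u : ℝ → ℂ} {t δ : ℝ} (hf : LocL2 f t) (hδ : 0 < δ)
    (hu : ContinuousOn u (Set.Icc (t - δ) (t + δ))) : LocL2 (fun x => f x * u x) t := by
  obtain ⟨ε, hε, hf⟩ := hf
  obtain ⟨b, hb⟩ := isCompact_Icc.exists_bound_of_continuousOn hu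
  have hmin : 0 < min ε δ := lt_min hε hδ
  have hsub : Set.Ioo (t - min ε δ) (t + min ε δ) ⊆ Set.Icc (t - δ) (t + δ) := fun x hx =>
    ⟨by linarith [hx.1, min_le_right ε δ], by linarith [hx.2, min_le_right ε δ]⟩
  have hsub' : Set.Ioo (t - min ε δ) (t + min ε δ) ⊆ Set.Ioo (t - ε) (t + ε) := fun x hx =>
    ⟨by linarith [hx.1, min_le_left ε δ], by linarith [hx.2, min_le_left ε δ]⟩
  have hf' := hf.mono_measure (Measure.restrict_mono hsub' le_rfl)
  refine ⟨min ε δ, hmin, MemLp.of_le_mul (c := b) hf'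
    (hf'.1.mul ((hu.mono hsub).aestronglyMeasurable measurableSet_Ioo)) ?_⟩
  filter_upwards [ae_restrict_mem measurableSet_Ioo] with x hx
  rw [norm_mul, mul_comm]
  exact mul_le_mul_of_nonneg_right (hb x (hsub hx)) (norm_nonneg _)

theorem LocL2.congr {f g : ℝ → ℂ} {t δ : ℝ} (hf : LocL2 f t) (hδ : 0 < δ)
    (h : ∀ x ∈ Set.Icc (t - δ) (t + δ), f x = g x) : LocL2 g t := by
  obtain ⟨ε, hε, hf⟩ := hf
  have hsub' : Set.Ioo (t - min ε δ) (t + min ε δ) ⊆ Set.Ioo (t - ε) (t + ε) := fun x hx =>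
    ⟨by linarith [hx.1, min_le_left ε δ], by linarith [hx.2, min_le_left ε δ]⟩
  refine ⟨min ε δ, lt_min hε hδ, (hf.mono_measure (Measure.restrict_mono hsub' le_rfl)).ae_eq ?_⟩
  filter_upwards [ae_restrict_mem measurableSet_Ioo] with x hx
  exact h x ⟨by linarith [hx.1, min_le_right ε δ], by linarith [hx.2, min_le_right ε δ]⟩

theorem locL2_mul_iff {f u : ℝ → ℂ} {t : ℝ} (hu : Continuous u) (hut : u t ≠ 0) :
    LocL2 (fun x => f x * u x) t ↔ LocL2 f t := by
  refine ⟨fun h => ?_, fun h => h.mul one_pos hu.continuousOn⟩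
  obtain ⟨δ, hδ, hball⟩ := Metric.nhds_basis_closedBall.mem_iff.1
    (hu.continuousAt.eventually_ne hut)
  rw [Real.closedBall_eq_Icc] at hball
  have h1 := h.mul hδ (u := fun x => (u x)⁻¹) (hu.continuousOn.inv₀ fun x hx => hball hx)
  exact h1.congr hδ fun x hx => mul_inv_cancel_right₀ (hball hx) _

theorem memLp_of_locL2 {f g : ℝ → ℂ} {b : ℝ} (hfm : AEStronglyMeasurable f volume)
    (hf : ∀ t, LocL2 f t) (hg : MemLp g 2 volume)
    (h : ∀ᶠ x in cocompact ℝ, ‖f x‖ ≤ b * ‖g x‖) : MemLp f 2 volume := by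
  have hloc : LocallyIntegrable (fun x => ‖f x‖ ^ 2) := by
    intro t
    obtain ⟨ε, hε, hf⟩ := hf t
    exact ⟨_, Ioo_mem_nhds (by linarith) (by linarith), hf.integrable_norm_pow (by norm_num)⟩
  obtain ⟨K, hK, hKh⟩ := mem_cocompact.1 h
  rw [memLp_two_iff_integrable_sq_norm hfm, ← integrableOn_univ, ← Set.union_compl_self K]
  refine (hloc.integrableOn_isCompact hK).union ?_
  have h1 : MemLp f 2 (volume.restrict Kᶜ) := by
    refine MemLp.of_le_mul (c := b) (hg.restrict _) hfm.restrict ?_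
    filter_upwards [ae_restrict_mem hK.isClosed.isOpen_compl.measurableSet] with x hx using hKh hx
  exact h1.integrable_norm_pow (by norm_num)

end LocallySquareIntegrable

variable {N : ℕ} {z : Fin N → ℂ} {φ ψ : L2R} {B : ℂ} {Φ : ℂ → ℂ} {c : Fin N → ℂ}

theorem meromorphicAt_funDPlus (Φ : ℂ → ℂ) (c z : Fin N → ℂ) (μ : ℂ) :
    MeromorphicAt (funDPlus Φ c z) μ := by
  have h1 := (((numerDPlus Φ c z).differentiable.analyticAt μ).meromorphicAt).div
    (((Lagrange.nodal Finset.univ z).differentiable.analyticAt μ).meromorphicAt)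
  refine h1.congr ?_
  filter_upwards [eventually_forall_ne z μ] with ν hν
  simp only [Pi.div_apply]
  rw [eval_numerDPlus hν, mul_div_cancel_left₀ _ (eval_nodal_ne_zero hν)]

theorem analyticAt_lowerExt (hφ : IsHardyExtension Φ φ) {w : ℂ} (hw : w.im < 0) :
    AnalyticAt ℂ (lowerExt Φ) w := by
  have hopen : IsOpen {w : ℂ | w.im < 0} := isOpen_lt Complex.continuous_im continuous_const
  refine DifferentiableOn.analyticAt (s := {w : ℂ | w.im < 0}) (fun μ hμ => ?_)
    (hopen.mem_nhds hw)
  have h1 := (differentiableAt_cau (memLp_conj φ) (ne_of_lt hμ)).const_mul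
    (-(2 * Real.pi * Complex.I))⁻¹
  refine (h1.congr_of_eventuallyEq ?_).differentiableWithinAt
  filter_upwards [hopen.mem_nhds hμ] with ν hν
  rw [hφ.cau_conj_eq hν, inv_mul_cancel_left₀]
  simp [Real.pi_ne_zero]

/-- The condition on a polynomial `q` for `conj φ · q / n` to have no pole at a point of the lower
half-plane other than the `zⱼ`. -/
theorem tendsto_iff_poleOrder_dvd (hφ : IsHardyExtension Φ φ) {w : ℂ} (hw : w.im < 0)
    (hne : ∀ j, w ≠ z j) {q : Polynomial ℂ} (hq : q ≠ 0) :
    (∃ l, Tendsto (fun μ => cau (fun x => conj (φ x)) μ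
      * (q.eval μ / (numerDPlus Φ c z).eval μ)) (𝓝[≠] w) (𝓝 l)) ↔
    (X - C w) ^ poleOrder (fun w => lowerExt Φ w / funDPlus Φ c z w) w ∣ q := by
  set G : ℂ → ℂ := fun w => lowerExt Φ w / funDPlus Φ c z w with hG
  have hGm : MeromorphicAt G w :=
    (analyticAt_lowerExt hφ hw).meromorphicAt.div (meromorphicAt_funDPlus Φ c z w)
  rw [← Polynomial.le_rootMultiplicity_iff hq]
  obtain ⟨q1, hq1, hq1'⟩ := q.exists_eq_pow_rootMultiplicity_mul_and_not_dvd hq w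
  set k := Polynomial.rootMultiplicity w q
  rw [Polynomial.dvd_iff_isRoot, Polynomial.IsRoot] at hq1'
  have hqe : ∀ μ, q.eval μ = (μ - w) ^ k * q1.eval μ := fun μ => by
    conv_lhs => rw [hq1]
    simp
  have h2πi : -(2 * Real.pi * Complex.I) ≠ (0 : ℂ) := by simp [Real.pi_ne_zero]
  set u : ℂ → ℂ := fun μ =>
    -(2 * Real.pi * Complex.I) * (q1.eval μ / (Lagrange.nodal Finset.univ z).eval μ) with hu
  have hua : AnalyticAt ℂ u w := analyticAt_const.mul
    ((q1.differentiable.analyticAt w).div ((Lagrange.nodal Finset.univ z).differentiable.analyticAt w)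
      (eval_nodal_ne_zero hne))
  set P : ℂ → ℂ := fun μ => (μ - w) ^ k * u μ with hP
  have hPm : MeromorphicAt P w :=
    (((analyticAt_id.sub analyticAt_const).pow k).mul hua).meromorphicAt
  have hPord : meromorphicOrderAt P w = (k : ℤ) := by
    rw [meromorphicOrderAt_eq_int_iff hPm]
    exact ⟨u, hua, mul_ne_zero h2πi (div_ne_zero hq1' (eval_nodal_ne_zero hne)),
      Eventually.of_forall fun μ => by simp [hP]⟩
  have heq : (fun μ => cau (fun x => conj (φ x)) μ
      * (q.eval μ / (numerDPlus Φ c z).eval μ)) =ᶠ[𝓝[≠] w] G * P := by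
    filter_upwards [eventually_im_neg hw, eventually_forall_ne z w] with μ h1 h2
    rw [hφ.cau_conj_eq h1, hqe, eval_numerDPlus h2, div_eq_mul_inv, mul_inv]
    simp only [Pi.mul_apply, hG, hP, hu]
    ring
  have hm := (hGm.mul hPm).congr heq.symm
  -- A finite limit exists iff the order of `G` plus `k` is nonnegative. If `G` vanishes identically
  -- near `w`, its order is `⊤` and `poleOrder` is `0`, so both sides hold.
  rw [tendsto_nhds_iff_meromorphicOrderAt_nonneg hm, meromorphicOrderAt_congr heq,
    meromorphicOrderAt_mul hGm hPm, hPord, poleOrder]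
  induction meromorphicOrderAt G w using WithTop.recTopCoe with
  | top => simp
  | coe m =>
    have : ((m : WithTop ℤ) + ((k : ℤ) : WithTop ℤ)) = ((m + k : ℤ) : WithTop ℤ) := rfl
    rw [this, WithTop.untop₀_coe, show (0 : WithTop ℤ) = ((0 : ℤ) : WithTop ℤ) from rfl,
      WithTop.coe_le_coe]
    omega

/-- The behaviour of `conj φ · q / n` at `zⱼ`. -/
theorem exists_tendsto_node (hφ : IsHardyExtension Φ φ) (hz : ∀ j, (z j).im < 0)
    (hinj : Function.Injective z) (hc : ∀ j, c j ≠ 0) (j : Fin N)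
    (hl : lowerExt Φ (z j) = 0 → ∃ l : ℂ, Tendsto (degenerateQuotient Φ c z j) (𝓝[≠] (z j)) (𝓝 l))
    (q : Polynomial ℂ) :
    ∃ l, Tendsto (fun μ => cau (fun x => conj (φ x)) μ
      * (q.eval μ / (numerDPlus Φ c z).eval μ)) (𝓝[≠] (z j)) (𝓝 l) ∧
      (l = -(q.eval (z j) / (c j * (Lagrange.nodal (Finset.univ.erase j) z).eval (z j))) ↔
        (lowerExt Φ (z j) = 0 → ¬ Tendsto (degenerateQuotient Φ c z j) (𝓝[≠] (z j)) (𝓝 1) →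
          q.eval (z j) = 0)) := by
  have hd := eval_nodal_erase_node_ne_zero hinj j
  have hcj := hc j
  have hpi : (Real.pi : ℂ) ≠ 0 := by simp [Real.pi_ne_zero]
  by_cases hF : lowerExt Φ (z j) = 0
  · obtain ⟨l, hl⟩ := hl hF
    set u : ℂ → ℂ := fun μ =>
      -(q.eval μ / (c j * (Lagrange.nodal (Finset.univ.erase j) z).eval μ)) with hu
    have hucont : ContinuousAt u (z j) := by
      refine (q.continuous.continuousAt.div (continuousAt_const.mul
        (Polynomial.continuous _).continuousAt) (mul_ne_zero hcj hd)).neg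
    -- Near `zⱼ` the function `β q / n` is `degenerateQuotient` times `u`, and the prescribed value
    -- is `u (zⱼ)`. The condition becomes `(l - 1) u (zⱼ) = 0`.
    refine ⟨l * u (z j), ?_, ?_⟩
    · refine (hl.mul (hucont.tendsto.mono_left nhdsWithin_le_nhds)).congr' ?_
      filter_upwards [eventually_im_neg (hz j), eventually_forall_ne z (z j)] with μ h1 h2
      have h3 : (Lagrange.nodal Finset.univ z).eval μ
          = (μ - z j) * (Lagrange.nodal (Finset.univ.erase j) z).eval μ := by
        rw [eval_nodal_erase h2, mul_div_cancel₀ _ (sub_ne_zero.2 (h2 j))]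
      rw [hφ.cau_conj_eq h1, eval_numerDPlus h2, h3, degenerateQuotient]
      simp only [hu, div_eq_mul_inv, mul_inv]
      have : c j * (c j)⁻¹ = 1 := mul_inv_cancel₀ hcj
      linear_combination (-(2 * Real.pi * Complex.I * lowerExt Φ μ) * (funDPlus Φ c z μ)⁻¹
        * (μ - z j)⁻¹ * q.eval μ *
          ((Lagrange.nodal (Finset.univ.erase j) z).eval μ)⁻¹) * this
    · have h1 : (l = 1) ↔ Tendsto (degenerateQuotient Φ c z j) (𝓝[≠] (z j)) (𝓝 1) :=
        ⟨fun h => h ▸ hl, fun h => tendsto_nhds_unique hl h⟩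
      have h2 : u (z j) = 0 ↔ q.eval (z j) = 0 := by
        simp [hu, hcj, hd]
      rw [← h1, ← h2]
      have h3 : -(q.eval (z j) / (c j * (Lagrange.nodal (Finset.univ.erase j) z).eval (z j)))
        = u (z j) := rfl
      rw [h3]
      constructor
      · intro h _ h4
        have : (l - 1) * u (z j) = 0 := by linear_combination h
        exact (mul_eq_zero.1 this).resolve_left (sub_ne_zero.2 h4)
      · intro h
        by_cases h4 : l = 1
        · rw [h4, one_mul]
        · rw [h hF h4, mul_zero]
  -- If `conj φ` does not vanish at `zⱼ`, then `D₊` has a genuine pole there, `n (zⱼ) ≠ 0`, and the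
  -- residue formula gives the prescribed value for every `q`.
  · have hnode : (numerDPlus Φ c z).eval (z j)
        = residue Φ c z j * (Lagrange.nodal (Finset.univ.erase j) z).eval (z j) :=
      eval_onePlusNumer_node _ j
    have hres : residue Φ c z j ≠ 0 := by
      rw [residue]
      simp [hpi, hcj, hF]
    have hne : (numerDPlus Φ c z).eval (z j) ≠ 0 := by
      rw [hnode]; exact mul_ne_zero hres hd
    refine ⟨_, (((differentiableAt_cau (memLp_conj φ) (hz j).ne).continuousAt.mul
      (q.continuous.continuousAt.div (Polynomial.continuous _).continuousAt hne)).tendsto).mono_left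
        nhdsWithin_le_nhds, iff_of_true ?_ fun h => absurd h hF⟩
    change cau (fun x => conj (φ x)) (z j) * (q.eval (z j) / (numerDPlus Φ c z).eval (z j)) = _
    rw [hnode, hφ.cau_conj_eq (hz j), residue]
    field_simp

theorem continuous_eval_ofReal_div (hz : ∀ j, (z j).im < 0) (q : Polynomial ℂ) :
    Continuous fun x : ℝ => q.eval (x : ℂ) / (Lagrange.nodal Finset.univ z).eval (x : ℂ) :=
  (q.continuous.comp Complex.continuous_ofReal).div
    ((Polynomial.continuous _).comp Complex.continuous_ofReal)
    fun x => eval_nodal_ne_zero (ofReal_ne_node hz x)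

/-- The condition on a polynomial `q` for `conj φ · q / n` to be square integrable near a point of
the real line. -/
theorem locL2_iff_realPoleOrder_dvd (hz : ∀ j, (z j).im < 0) (t : ℝ) {q : Polynomial ℂ}
    (hq : q ≠ 0) :
    LocL2 (fun x : ℝ => conj (φ x) * (q.eval (x : ℂ) / (numerDPlus Φ c z).eval (x : ℂ))) t ↔
      (X - C (t : ℂ)) ^ realPoleOrder φ Φ c z t ∣ q := by
  set A : Set ℕ := {m : ℕ | ∃ ε > 0, MemLp
    (fun x : ℝ => conj (φ x) / funDPlus Φ c z (x : ℂ) * ((x : ℂ) - t) ^ m) 2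
    (volume.restrict (Set.Ioo (t - ε) (t + ε)))} with hA
  have key : ∀ q : Polynomial ℂ, q ≠ 0 →
      (LocL2 (fun x : ℝ => conj (φ x) * (q.eval (x : ℂ) / (numerDPlus Φ c z).eval (x : ℂ))) t ↔
        Polynomial.rootMultiplicity (t : ℂ) q ∈ A) := by
    intro q hq
    obtain ⟨q1, hq1, hq1'⟩ := q.exists_eq_pow_rootMultiplicity_mul_and_not_dvd hq (t : ℂ)
    set k := Polynomial.rootMultiplicity (t : ℂ) q
    rw [Polynomial.dvd_iff_isRoot, Polynomial.IsRoot] at hq1'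
    have hqe : ∀ μ, q.eval μ = (μ - t) ^ k * q1.eval μ := fun μ => by
      conv_lhs => rw [hq1]
      simp
    have h1 := locL2_mul_iff (f := fun x : ℝ => conj (φ x) / funDPlus Φ c z (x : ℂ) *
      ((x : ℂ) - t) ^ k) (t := t) (continuous_eval_ofReal_div hz q1)
      (div_ne_zero hq1' (eval_nodal_ne_zero (ofReal_ne_node hz t)))
    have h2 : (fun x : ℝ => conj (φ x) * (q.eval (x : ℂ) / (numerDPlus Φ c z).eval (x : ℂ)))
        = fun x : ℝ => conj (φ x) / funDPlus Φ c z (x : ℂ) * ((x : ℂ) - t) ^ k *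
          (q1.eval (x : ℂ) / (Lagrange.nodal Finset.univ z).eval (x : ℂ)) := by
      funext x
      rw [eval_numerDPlus (ofReal_ne_node hz x), hqe, div_eq_mul_inv, mul_inv]
      ring
    rw [h2, h1]
    rfl
  -- For `q = n` the function is `conj φ` itself, which is square integrable. So the infimum
  -- defining `realPoleOrder` is attained.
  have hne : A.Nonempty := by
    refine ⟨_, (key _ (numerDPlus_ne_zero Φ c z)).1 ⟨1, one_pos, ?_⟩⟩
    refine ((memLp_conj φ).restrict _).ae_eq ?_
    filter_upwards [ae_restrict_of_ae (ae_eval_numerDPlus_ne_zero (Φ := Φ) (c := c) (z := z))]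
      with x hx
    rw [div_self hx, mul_one]
  have hup : ∀ m m', m ≤ m' → m ∈ A → m' ∈ A := by
    intro m m' hmm hm
    have hm' : LocL2 (fun x : ℝ => conj (φ x) / funDPlus Φ c z (x : ℂ) * ((x : ℂ) - t) ^ m) t := hm
    have h1 := hm'.mul one_pos (u := fun x : ℝ => ((x : ℂ) - t) ^ (m' - m)) (by fun_prop)
    have h2 : (fun x : ℝ => conj (φ x) / funDPlus Φ c z (x : ℂ) * ((x : ℂ) - t) ^ m *
        ((x : ℂ) - t) ^ (m' - m))
        = fun x : ℝ => conj (φ x) / funDPlus Φ c z (x : ℂ) * ((x : ℂ) - t) ^ m' := by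
      funext x
      rw [mul_assoc, ← pow_add, Nat.add_sub_cancel' hmm]
    rw [h2] at h1
    exact h1
  rw [key q hq, ← Polynomial.le_rootMultiplicity_iff hq]
  exact ⟨fun h => Nat.sInf_le h, fun h => hup _ _ h (Nat.sInf_mem hne)⟩

theorem tendsto_div_ofReal_sub_cocompact (a w : ℂ) :
    Tendsto (fun x : ℝ => a / ((x : ℂ) - w)) (cocompact ℝ) (𝓝 0) := by
  have h1 : Tendsto (fun x : ℝ => (x : ℂ) - w) (cocompact ℝ) (cocompact ℂ) :=
    (Homeomorph.subRight w).isClosedEmbedding.tendsto_cocompact.comp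
      Complex.isometry_ofReal.isClosedEmbedding.tendsto_cocompact
  rw [← Metric.cobounded_eq_cocompact (α := ℂ)] at h1
  have h2 := (tendsto_inv₀_cobounded.comp h1).const_mul a
  rw [mul_zero] at h2
  exact h2.congr fun x => by simp [div_eq_mul_inv]

/-- In partial fractions `q / n` is a sum of terms `aⱼ / (x - zⱼ)` divided by `D₊`, hence tends to
`0 / 1` at infinity. Square integrability of `conj φ · q / n` is therefore a local question. -/
theorem eventually_norm_eval_div_le (hz : ∀ j, (z j).im < 0) (hinj : Function.Injective z)
    {q : Polynomial ℂ} (hq : q.degree < N) :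
    ∀ᶠ x : ℝ in cocompact ℝ, ‖q.eval (x : ℂ) / (numerDPlus Φ c z).eval (x : ℂ)‖ ≤ 1 := by
  have hsum : ∀ a : Fin N → ℂ,
      Tendsto (fun x : ℝ => ∑ j, a j / ((x : ℂ) - z j)) (cocompact ℝ) (𝓝 0) := fun a => by
    simpa using tendsto_finsetSum Finset.univ fun j _ =>
      tendsto_div_ofReal_sub_cocompact (a j) (z j)
  set a : Fin N → ℂ := fun j =>
    q.eval (z j) / (Lagrange.nodal (Finset.univ.erase j) z).eval (z j) with ha
  have hqa : q = numer z a := eq_numer hinj hq fun j =>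
    (div_mul_cancel₀ _ (eval_nodal_erase_node_ne_zero hinj j)).symm
  have hlim := (hsum a).div (tendsto_const_nhds.add (hsum (residue Φ c z)))
    (show (1 : ℂ) + 0 ≠ 0 by simp)
  rw [zero_div] at hlim
  have h1 := hlim.norm
  rw [norm_zero] at h1
  filter_upwards [h1.eventually_le_const one_pos] with x hx
  have hne := ofReal_ne_node hz x
  rw [numerDPlus, hqa, eval_numer hne, eval_onePlusNumer hne,
    mul_div_mul_left _ _ (eval_nodal_ne_zero hne)]
  exact hx

theorem memLp_conj_mul (hz : ∀ j, (z j).im < 0) (hinj : Function.Injective z)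
    {q : Polynomial ℂ} (hq : q.degree < N)
    (hdvd : ∀ t : ℝ, (X - C (t : ℂ)) ^ realPoleOrder φ Φ c z t ∣ q) :
    MemLp (fun x : ℝ => conj (φ x) * (q.eval (x : ℂ) / (numerDPlus Φ c z).eval (x : ℂ)))
      2 volume := by
  rcases eq_or_ne q 0 with rfl | hq0
  · simp
  refine memLp_of_locL2 (b := 1) ?_ (fun t => (locL2_iff_realPoleOrder_dvd hz t hq0).2 (hdvd t))
    (memLp_conj φ) ?_
  · exact (memLp_conj φ).1.mul (((q.continuous.comp Complex.continuous_ofReal).measurable.div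
      ((Polynomial.continuous _).comp Complex.continuous_ofReal).measurable).aestronglyMeasurable)
  · filter_upwards [eventually_norm_eval_div_le (Φ := Φ) (c := c) hz hinj hq] with x hx
    rw [norm_mul, mul_comm]
    exact mul_le_mul_of_nonneg_right hx (norm_nonneg _)

end Singularities

/-! ### Collecting the exponents and counting dimensions. -/

section DefectFormula

open Polynomial (C X)

variable {N : ℕ} {z : Fin N → ℂ} {φ ψ : L2R} {B : ℂ} {Φ : ℂ → ℂ} {c : Fin N → ℂ}

section Exponents

/-- The nodes that are counted by `numMZero`. -/
def IsBadNode (Φ : ℂ → ℂ) (c z : Fin N → ℂ) (j : Fin N) : Prop :=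
  lowerExt Φ (z j) = 0 ∧ ¬ Tendsto (degenerateQuotient Φ c z j) (𝓝[≠] (z j)) (𝓝 1)

open Classical in
/-- The multiplicity with which `w` must be a root of a polynomial `q` for `conj φ · q / n` to
be the conjugate of an element of the orthogonal complement of the detectable subspace. -/
def expo (φ : L2R) (Φ : ℂ → ℂ) (c z : Fin N → ℂ) (w : ℂ) : ℕ :=
  if ∃ j, z j = w then if ∃ j, z j = w ∧ IsBadNode Φ c z j then 1 else 0
  else if w.im < 0 then poleOrder (fun w => lowerExt Φ w / funDPlus Φ c z w) w
  else if w.im = 0 then realPoleOrder φ Φ c z w.re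
  else 0

theorem expo_node_of_bad {j : Fin N} (h : IsBadNode Φ c z j) : expo φ Φ c z (z j) = 1 := by
  rw [expo, if_pos ⟨j, rfl⟩, if_pos ⟨j, rfl, h⟩]

theorem expo_node_of_not_bad (hinj : Function.Injective z) {j : Fin N}
    (h : ¬ IsBadNode Φ c z j) : expo φ Φ c z (z j) = 0 := by
  rw [expo, if_pos ⟨j, rfl⟩, if_neg]
  rintro ⟨i, hi, hi'⟩
  exact h (hinj hi ▸ hi')

theorem expo_lower {w : ℂ} (hw : w.im < 0) (hne : ∀ j, w ≠ z j) :
    expo φ Φ c z w = poleOrder (fun w => lowerExt Φ w / funDPlus Φ c z w) w := by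
  rw [expo, if_neg (fun ⟨j, hj⟩ => hne j hj.symm), if_pos hw]

theorem expo_real (hz : ∀ j, (z j).im < 0) (t : ℝ) :
    expo φ Φ c z t = realPoleOrder φ Φ c z t := by
  rw [expo, if_neg (fun ⟨j, hj⟩ => ofReal_ne_node hz t j hj.symm), if_neg (by simp),
    if_pos (by simp), Complex.ofReal_re]

theorem expo_upper (hz : ∀ j, (z j).im < 0) {w : ℂ} (hw : 0 < w.im) : expo φ Φ c z w = 0 := by
  rw [expo, if_neg, if_neg (by linarith), if_neg hw.ne']
  rintro ⟨j, rfl⟩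
  linarith [hz j]

theorem pow_expo_dvd_of_tendsto (hφ : IsHardyExtension Φ φ) (hz : ∀ j, (z j).im < 0)
    (hinj : Function.Injective z) (hc : ∀ j, c j ≠ 0)
    (hl : ∀ j, lowerExt Φ (z j) = 0 →
      ∃ l : ℂ, Tendsto (degenerateQuotient Φ c z j) (𝓝[≠] (z j)) (𝓝 l))
    {q : Polynomial ℂ} (hq : q ≠ 0)
    (hreal : ∀ t, LocL2 (fun x : ℝ =>
      conj (φ x) * (q.eval (x : ℂ) / (numerDPlus Φ c z).eval (x : ℂ))) t)
    (hlim : ∀ w : ℂ, w.im < 0 → (∀ j, w ≠ z j) → ∃ l, Tendsto (fun μ => cau (fun x => conj (φ x)) μ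
      * (q.eval μ / (numerDPlus Φ c z).eval μ)) (𝓝[≠] w) (𝓝 l))
    (hnode : ∀ j, Tendsto (fun μ => cau (fun x => conj (φ x)) μ
      * (q.eval μ / (numerDPlus Φ c z).eval μ)) (𝓝[≠] (z j))
        (𝓝 (-(q.eval (z j) / (c j * (Lagrange.nodal (Finset.univ.erase j) z).eval (z j))))))
    (w : ℂ) : (X - C w) ^ expo φ Φ c z w ∣ q := by
  by_cases hw : ∃ j, z j = w
  · obtain ⟨j, rfl⟩ := hw
    by_cases hbad : IsBadNode Φ c z j
    · rw [expo_node_of_bad hbad, pow_one, Polynomial.dvd_iff_isRoot]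
      obtain ⟨l, hl1, hl2⟩ := exists_tendsto_node hφ hz hinj hc j (hl j) q
      exact hl2.1 (tendsto_nhds_unique hl1 (hnode j)) hbad.1 hbad.2
    · rw [expo_node_of_not_bad hinj hbad, pow_zero]
      exact one_dvd q
  · have hne : ∀ j, w ≠ z j := fun j h => hw ⟨j, h.symm⟩
    rcases lt_trichotomy w.im 0 with h | h | h
    · rw [expo_lower h hne]
      exact (tendsto_iff_poleOrder_dvd hφ h hne hq).1 (hlim w h hne)
    · obtain ⟨t, rfl⟩ : ∃ t : ℝ, (t : ℂ) = w := ⟨w.re, Complex.ext (by simp) (by simp [h])⟩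
      rw [expo_real hz]
      exact (locL2_iff_realPoleOrder_dvd hz t hq).1 (hreal t)
    · rw [expo_upper hz h, pow_zero]
      exact one_dvd q

/-- Taking `q = n` leaves `conj φ`, which has no singularities, and `n` vanishes at the bad nodes
because the residue does. Thus nonzero exponents occur only at the finitely many roots of `n`, and
their sum is at most `N`. -/
theorem pow_expo_dvd_numerDPlus (hφ : IsHardyExtension Φ φ) (hz : ∀ j, (z j).im < 0)
    (hinj : Function.Injective z) (w : ℂ) :
    (X - C w) ^ expo φ Φ c z w ∣ numerDPlus Φ c z := by
  have hn0 := numerDPlus_ne_zero Φ c z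
  by_cases hw : ∃ j, z j = w
  · obtain ⟨j, rfl⟩ := hw
    by_cases hbad : IsBadNode Φ c z j
    · rw [expo_node_of_bad hbad, pow_one, Polynomial.dvd_iff_isRoot, Polynomial.IsRoot, numerDPlus,
        eval_onePlusNumer_node, residue, hbad.1]
      simp
    · rw [expo_node_of_not_bad hinj hbad, pow_zero]
      exact one_dvd _
  · have hne : ∀ j, w ≠ z j := fun j h => hw ⟨j, h.symm⟩
    rcases lt_trichotomy w.im 0 with h | h | h
    · rw [expo_lower h hne]
      refine (tendsto_iff_poleOrder_dvd hφ h hne hn0).1 ⟨_,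
        ((differentiableAt_cau (memLp_conj φ) h.ne).continuousAt.tendsto.mono_left
          (nhdsWithin_le_nhds (s := {w}ᶜ))).congr' ?_⟩
      filter_upwards [eventually_eval_ne_zero hn0 w] with μ hμ
      rw [div_self hμ, mul_one]
    · obtain ⟨t, rfl⟩ : ∃ t : ℝ, (t : ℂ) = w := ⟨w.re, Complex.ext (by simp) (by simp [h])⟩
      rw [expo_real hz]
      refine (locL2_iff_realPoleOrder_dvd hz t hn0).1 ⟨1, one_pos, ?_⟩
      refine ((memLp_conj φ).restrict _).ae_eq ?_
      filter_upwards [ae_restrict_of_ae (ae_eval_numerDPlus_ne_zero (Φ := Φ) (c := c) (z := z))]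
        with x hx
      rw [div_self hx, mul_one]
    · rw [expo_upper hz h, pow_zero]
      exact one_dvd _

/-- The product of the powers `(X - w)^(expo w)`. -/
def expoPoly (φ : L2R) (Φ : ℂ → ℂ) (c z : Fin N → ℂ) : Polynomial ℂ :=
  ∏ w ∈ (numerDPlus Φ c z).roots.toFinset, (X - C w) ^ expo φ Φ c z w

theorem mem_roots_of_expo_ne_zero (hφ : IsHardyExtension Φ φ) (hz : ∀ j, (z j).im < 0)
    (hinj : Function.Injective z) {w : ℂ} (hw : expo φ Φ c z w ≠ 0) :
    w ∈ (numerDPlus Φ c z).roots.toFinset := by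
  rw [Multiset.mem_toFinset, Polynomial.mem_roots (numerDPlus_ne_zero Φ c z),
    ← Polynomial.dvd_iff_isRoot]
  exact (dvd_pow_self _ hw).trans (pow_expo_dvd_numerDPlus hφ hz hinj w)

theorem expoPoly_dvd {q : Polynomial ℂ} (h : ∀ w, (X - C w) ^ expo φ Φ c z w ∣ q) :
    expoPoly φ Φ c z ∣ q :=
  Finset.prod_dvd_of_coprime (fun _ _ _ _ hne =>
    (Polynomial.isCoprime_X_sub_C_of_isUnit_sub (sub_ne_zero.2 hne).isUnit).pow) fun w _ => h w

theorem pow_expo_dvd_expoPoly (hφ : IsHardyExtension Φ φ) (hz : ∀ j, (z j).im < 0)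
    (hinj : Function.Injective z) (w : ℂ) : (X - C w) ^ expo φ Φ c z w ∣ expoPoly φ Φ c z := by
  by_cases hw : expo φ Φ c z w = 0
  · rw [hw, pow_zero]; exact one_dvd _
  · exact Finset.dvd_prod_of_mem _ (mem_roots_of_expo_ne_zero hφ hz hinj hw)

theorem monic_expoPoly (φ : L2R) (Φ : ℂ → ℂ) (c z : Fin N → ℂ) : (expoPoly φ Φ c z).Monic :=
  Polynomial.monic_prod_of_monic _ _ fun w _ => (Polynomial.monic_X_sub_C w).pow _

theorem natDegree_expoPoly (φ : L2R) (Φ : ℂ → ℂ) (c z : Fin N → ℂ) : (expoPoly φ Φ c z).natDegree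
    = ∑ w ∈ (numerDPlus Φ c z).roots.toFinset, expo φ Φ c z w := by
  rw [expoPoly, Polynomial.natDegree_prod_of_monic _ _ fun w _ =>
    (Polynomial.monic_X_sub_C w).pow _]
  simp

theorem natDegree_expoPoly_le (hφ : IsHardyExtension Φ φ) (hz : ∀ j, (z j).im < 0)
    (hinj : Function.Injective z) : (expoPoly φ Φ c z).natDegree ≤ N := by
  have h := Polynomial.natDegree_le_of_dvd
    (expoPoly_dvd (pow_expo_dvd_numerDPlus (c := c) hφ hz hinj)) (numerDPlus_ne_zero Φ c z)
  rwa [numerDPlus, natDegree_onePlusNumer] at h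

-- The lower half-plane without nodes, the real line and the nodes are disjoint, and every nonzero
-- exponent lies in one of them. The three counts are thus sums over the roots of `n`.
open Classical in
theorem natDegree_expoPoly_eq (hφ : IsHardyExtension Φ φ) (hz : ∀ j, (z j).im < 0)
    (hinj : Function.Injective z) : (expoPoly φ Φ c z).natDegree
      = numP Φ c z + numM φ Φ c z + numMZero Φ c z := by
  set S := (numerDPlus Φ c z).roots.toFinset with hS
  set L : Set ℂ := {w : ℂ | w.im < 0 ∧ ∀ j, w ≠ z j} with hL
  set R : Set ℂ := Set.range ((↑) : ℝ → ℂ) with hR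
  have hsum : ∀ T : Set ℂ, ∑ᶠ w ∈ T, expo φ Φ c z w
      = ∑ w ∈ S, T.indicator (expo φ Φ c z) w := by
    intro T
    rw [finsum_mem_def]
    refine finsum_eq_sum_of_support_subset _ fun w hw => ?_
    refine mem_roots_of_expo_ne_zero hφ hz hinj fun h0 => hw ?_
    rw [Set.indicator_apply, h0, ite_self]
  have hP : numP Φ c z = ∑ w ∈ S, L.indicator (expo φ Φ c z) w := by
    rw [← hsum, numP]
    exact finsum_mem_congr rfl fun w hw => (expo_lower hw.1 hw.2).symm
  have hM : numM φ Φ c z = ∑ w ∈ S, R.indicator (expo φ Φ c z) w := by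
    rw [← hsum, hR, finsum_mem_range Complex.ofReal_injective, numM]
    exact finsum_congr fun t => (expo_real hz t).symm
  have hMZ : numMZero Φ c z = ∑ w ∈ S, (Set.range z).indicator (expo φ Φ c z) w := by
    have h1 : ∀ j, expo φ Φ c z (z j) = if IsBadNode Φ c z j then 1 else 0 := fun j => by
      split_ifs with h
      · exact expo_node_of_bad h
      · exact expo_node_of_not_bad hinj h
    rw [← hsum, finsum_mem_range hinj, finsum_eq_sum_of_fintype, numMZero,
      Nat.card_eq_fintype_card, Fintype.card_subtype]
    simp only [h1, Finset.sum_boole, Nat.cast_id]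
    congr
  rw [natDegree_expoPoly, hP, hM, hMZ, ← Finset.sum_add_distrib, ← Finset.sum_add_distrib]
  refine Finset.sum_congr rfl fun w _ => ?_
  by_cases hw : w ∈ Set.range z
  · have h1 : w ∉ L := fun h => by obtain ⟨j, rfl⟩ := hw; exact h.2 j rfl
    have h2 : w ∉ R := fun h => by
      obtain ⟨j, rfl⟩ := hw; obtain ⟨t, ht⟩ := h; exact ofReal_ne_node hz t j ht
    simp [h1, h2, hw]
  · have hne : ∀ j, w ≠ z j := fun j h => hw ⟨j, h.symm⟩
    rcases lt_trichotomy w.im 0 with h | h | h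
    · have h1 : w ∈ L := ⟨h, hne⟩
      have h2 : w ∉ R := by rintro ⟨t, rfl⟩; simp at h
      simp [h1, h2, hw]
    · have h1 : w ∉ L := fun h' => h'.1.ne h
      have h2 : w ∈ R := ⟨w.re, Complex.ext (by simp) (by simp [h])⟩
      simp [h1, h2, hw]
    · simp [expo_upper hz h, Set.indicator_apply]

end Exponents

section Dimension

/-- Converse to `pow_expo_dvd_of_tendsto` in the lower half-plane: divisibility supplies the
hypotheses of `cau_of_polynomial`. -/
theorem tendsto_of_pow_expo_dvd (hφ : IsHardyExtension Φ φ) (hz : ∀ j, (z j).im < 0)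
    (hinj : Function.Injective z) (hc : ∀ j, c j ≠ 0)
    (hl : ∀ j, lowerExt Φ (z j) = 0 →
      ∃ l : ℂ, Tendsto (degenerateQuotient Φ c z j) (𝓝[≠] (z j)) (𝓝 l))
    {q : Polynomial ℂ} (hdvd : ∀ w, (X - C w) ^ expo φ Φ c z w ∣ q) :
    (∀ w : ℂ, w.im < 0 → ∃ l, Tendsto (fun μ => cau (fun x => conj (φ x)) μ
      * (q.eval μ / (numerDPlus Φ c z).eval μ)) (𝓝[≠] w) (𝓝 l)) ∧
    ∀ j, Tendsto (fun μ => cau (fun x => conj (φ x)) μ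
      * (q.eval μ / (numerDPlus Φ c z).eval μ)) (𝓝[≠] (z j))
        (𝓝 (-(q.eval (z j) / (c j * (Lagrange.nodal (Finset.univ.erase j) z).eval (z j))))) := by
  have hnode : ∀ j, Tendsto (fun μ => cau (fun x => conj (φ x)) μ
      * (q.eval μ / (numerDPlus Φ c z).eval μ)) (𝓝[≠] (z j))
        (𝓝 (-(q.eval (z j) / (c j * (Lagrange.nodal (Finset.univ.erase j) z).eval (z j))))) := by
    intro j
    obtain ⟨l, hl1, hl2⟩ := exists_tendsto_node hφ hz hinj hc j (hl j) q
    rw [← hl2.2 fun h1 h2 => ?_]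
    · exact hl1
    · have := hdvd (z j)
      rwa [expo_node_of_bad ⟨h1, h2⟩, pow_one, Polynomial.dvd_iff_isRoot] at this
  refine ⟨fun w hw => ?_, hnode⟩
  by_cases h : ∃ j, z j = w
  · obtain ⟨j, rfl⟩ := h
    exact ⟨_, hnode j⟩
  · have hne : ∀ j, w ≠ z j := fun j hj => h ⟨j, hj.symm⟩
    rcases eq_or_ne q 0 with rfl | hq
    · exact ⟨0, by simp⟩
    · refine (tendsto_iff_poleOrder_dvd hφ hw hne hq).2 ?_
      rw [← expo_lower (φ := φ) hw hne]
      exact hdvd w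

/-- The complement is parametrised by the polynomials `p` of degree less than `N - deg Q`, through
`conj g = conj φ · Q p / n`. -/
theorem finrank_orthogonal_detectable (hφ : IsHardyExtension Φ φ) (hψ : ψ ∈ HardyPlus)
    (hB : B ≠ Real.pi * Complex.I) (hB' : B ≠ -(Real.pi * Complex.I)) {μ₀ : ℂ}
    (hμ₀ : μ₀ ∈ resolventSet (opB φ ψ B)) (hc : ∀ j, c j ≠ 0) (hz : ∀ j, (z j).im < 0)
    (hinj : Function.Injective z)
    (hψz : ψ =ᵐ[volume] fun x : ℝ => ∑ j, c j / ((x : ℂ) - z j))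
    (hl : ∀ j, lowerExt Φ (z j) = 0 →
      ∃ l : ℂ, Tendsto (degenerateQuotient Φ c z j) (𝓝[≠] (z j)) (𝓝 l)) :
    Module.rank ℂ (detectable φ ψ B μ₀)ᗮ = (N - (expoPoly φ Φ c z).natDegree : ℕ) := by
  set Q := expoPoly φ Φ c z with hQ
  set n := numerDPlus Φ c z with hn
  set K := N - Q.natDegree with hK
  have hQ0 : Q ≠ 0 := (monic_expoPoly φ Φ c z).ne_zero
  have hQN : Q.natDegree ≤ N := natDegree_expoPoly_le hφ hz hinj
  have hdeg : ∀ p : Polynomial ℂ, p ∈ Polynomial.degreeLT ℂ K ↔ (Q * p).degree < N := by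
    intro p
    rw [Polynomial.mem_degreeLT]
    rcases eq_or_ne p 0 with rfl | hp
    · simp
    · rw [← Polynomial.natDegree_lt_iff_degree_lt hp,
        ← Polynomial.natDegree_lt_iff_degree_lt (mul_ne_zero hQ0 hp),
        Polynomial.natDegree_mul hQ0 hp]
      omega
  have hdvd : ∀ p w, (X - C w) ^ expo φ Φ c z w ∣ Q * p := fun p w =>
    (pow_expo_dvd_expoPoly hφ hz hinj w).mul_right p
  set f : Polynomial ℂ → ℝ → ℂ := fun p x =>
    conj (φ x) * ((Q * p).eval (x : ℂ) / n.eval (x : ℂ)) with hf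
  have hfL : ∀ p : Polynomial.degreeLT ℂ K, MemLp (f p) 2 volume := fun p =>
    memLp_conj_mul hz hinj ((hdeg p).1 p.2) fun t => by
      rw [← expo_real hz]; exact hdvd p t
  have hgL : ∀ p : Polynomial.degreeLT ℂ K, MemLp (fun x => conj (f p x)) 2 volume := fun p =>
    (hfL p).star
  have hfg : ∀ p : Polynomial.degreeLT ℂ K, f p =ᵐ[volume] fun x => conj ((hgL p).toLp _ x) := fun p => by
    filter_upwards [(hgL p).coeFn_toLp] with x hx
    rw [hx, Complex.conj_conj]
  have hcau : ∀ p : Polynomial.degreeLT ℂ K, _ := fun p =>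
    cau_of_polynomial (c := c) hφ hz hinj (hfL p) ((hdeg p).1 p.2) (EventuallyEq.rfl)
      (tendsto_of_pow_expo_dvd hφ hz hinj hc hl (hdvd p)).1
      (tendsto_of_pow_expo_dvd hφ hz hinj hc hl (hdvd p)).2
  have hmem : ∀ p : Polynomial.degreeLT ℂ K, (hgL p).toLp _ ∈ (detectable φ ψ B μ₀)ᗮ := by
    intro p
    obtain ⟨h1, h2, h3⟩ := hcau p
    rw [mem_orthogonal_detectable_iff hφ hψ hB hB' hμ₀]
    refine ⟨fun μ hμ => ?_, fun μ hμ => ?_⟩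
    · rw [← cau_congr (hfg p)]; exact h1 μ hμ
    · have h4 := pairing_eq_zero_of_polynomial hφ hz hψz hinj hc (hfL p) ((hdeg p).1 p.2) h2 h3 hμ
      have h5 : (fun x => ψ x * f p x) =ᵐ[volume]
          fun x => ψ x * conj ((hgL p).toLp _ x) := by
        filter_upwards [hfg p] with x hx
        rw [hx]
      rw [← cau_congr (hfg p), ← cau_congr h5]
      exact h4
  -- The parametrisation `p ↦ g` involves a conjugation, so it is only conjugate linear; it is set
  -- up as an additive map.
  let T : Polynomial.degreeLT ℂ K →+ (detectable φ ψ B μ₀)ᗮ :=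
    AddMonoidHom.mk' (fun p => ⟨(hgL p).toLp _, hmem p⟩) fun p p' => by
      refine Subtype.ext ?_
      change (hgL (p + p')).toLp _ = (hgL p).toLp _ + (hgL p').toLp _
      rw [← MemLp.toLp_add]
      refine MemLp.toLp_congr _ _ (Eventually.of_forall fun x => ?_)
      simp only [hf, Pi.add_apply, Submodule.coe_add, mul_add, Polynomial.eval_add, add_div, map_add]
  have hTsmul : ∀ (r : ℂ) (p : Polynomial.degreeLT ℂ K), T (r • p) = conj r • T p := by
    intro r p
    refine Subtype.ext ?_
    change (hgL (r • p)).toLp _ = conj r • (hgL p).toLp _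
    rw [← MemLp.toLp_const_smul]
    refine MemLp.toLp_congr _ _ (Eventually.of_forall fun x => ?_)
    simp only [hf, Pi.smul_apply, Submodule.coe_smul, smul_eq_mul, mul_smul_comm,
      Polynomial.eval_smul, map_mul, map_div₀]
    ring
  have hTinj : Function.Injective T := by
    rw [injective_iff_map_eq_zero]
    intro p hp
    have hp0 : (hgL p).toLp _ = 0 := congrArg Subtype.val hp
    have hf0 : f p =ᵐ[volume] 0 := by
      have h0 : ∀ᵐ x : ℝ, (hgL p).toLp _ x = 0 := by rw [hp0]; exact Lp.coeFn_zero ℂ 2 _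
      filter_upwards [hfg p, h0] with x h1 h2
      rw [h1, h2, map_zero, Pi.zero_apply]
    obtain ⟨-, -, h3⟩ := hcau p
    -- Injectivity comes from the node values: `cau f (zⱼ) = 0` forces `Q p` to vanish at all `N`
    -- nodes. This needs no cancellation of `φ`, which may be zero.
    have hq : Q * (p : Polynomial ℂ) = numer z fun _ => 0 := eq_numer hinj ((hdeg p).1 p.2) fun j => by
      have h4 := h3 j
      rw [cau_congr hf0] at h4
      have h5 : cau (0 : ℝ → ℂ) (z j) = 0 := by simp [cau]
      rw [h5] at h4
      simpa [hc j, eval_nodal_erase_node_ne_zero hinj j] using h4.symm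
    have h6 : Q * (p : Polynomial ℂ) = 0 := by rw [hq]; simp [numer]
    exact Subtype.ext ((mul_eq_zero.1 h6).resolve_left hQ0)
  have hTsurj : Function.Surjective T := by
    rintro ⟨g, hg⟩
    rw [mem_orthogonal_detectable_iff hφ hψ hB hB' hμ₀] at hg
    obtain ⟨q, hqdeg, hgq, hrel, hnode⟩ := exists_polynomial_of_pairing hφ hz hψz (memLp_conj g)
      hg.1 hg.2
    have hQq : Q ∣ q := by
      rcases eq_or_ne q 0 with rfl | hq0
      · exact dvd_zero Q
      have hlim : ∀ w : ℂ, w.im < 0 → Tendsto (fun μ => cau (fun x => conj (φ x)) μ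
          * (q.eval μ / n.eval μ)) (𝓝[≠] w) (𝓝 (cau (fun x => conj (g x)) w)) := by
        intro w hw
        refine ((differentiableAt_cau (memLp_conj g) hw.ne).continuousAt.tendsto.mono_left
          (nhdsWithin_le_nhds (s := {w}ᶜ))).congr' ?_
        filter_upwards [eventually_im_neg hw, eventually_forall_ne z w,
          eventually_eval_ne_zero (numerDPlus_ne_zero Φ c z) w] with μ h1 h2 h3
        rw [← mul_div_assoc, ← hrel μ h1 h2, mul_div_cancel_left₀ _ h3]
      refine expoPoly_dvd (pow_expo_dvd_of_tendsto hφ hz hinj hc hl hq0 (fun t => ?_)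
        (fun w hw _ => ⟨_, hlim w hw⟩) fun j => ?_)
      · exact ⟨1, one_pos, ((memLp_conj g).ae_eq hgq).restrict _⟩
      · have h1 : cau (fun x => conj (g x)) (z j)
            = -(q.eval (z j) / (c j * (Lagrange.nodal (Finset.univ.erase j) z).eval (z j))) := by
          have := hc j
          have := eval_nodal_erase_node_ne_zero hinj j
          rw [hnode j]
          field_simp
        rw [← h1]
        exact hlim _ (hz j)
    obtain ⟨p, rfl⟩ := hQq
    refine ⟨⟨p, (hdeg p).2 hqdeg⟩, Subtype.ext (Lp.ext ?_)⟩
    change (hgL ⟨p, (hdeg p).2 hqdeg⟩).toLp _ =ᵐ[volume] g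
    filter_upwards [(hgL ⟨p, (hdeg p).2 hqdeg⟩).coeFn_toLp, hgq] with x h1 h2
    rw [h1]
    simp only [hf]
    rw [← h2, Complex.conj_conj]
  -- A bijection semilinear over the automorphism `conj` of the scalars preserves the dimension.
  have hrank := rank_eq_of_equiv_equiv (starRingEnd ℂ) (AddEquiv.ofBijective T ⟨hTinj, hTsurj⟩)
    (starRingAut (R := ℂ)).bijective hTsmul
  rw [← hrank, (Polynomial.degreeLTEquiv ℂ K).rank_eq]
  simp

end Dimension

end DefectFormula

end Friedrichs

end

theorem theorem8p10 (φ ψ : Friedrichs.L2R) (Φ : ℂ → ℂ)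
    (hφ : Friedrichs.IsHardyExtension Φ φ) (hψ : ψ ∈ Friedrichs.HardyPlus)
    (B μ₀ : ℂ) (hB : B ≠ Real.pi * Complex.I) (hB' : B ≠ -(Real.pi * Complex.I))
    (hμ₀ : μ₀ ∈ Friedrichs.resolventSet (Friedrichs.opB φ ψ B)) :
    (Friedrichs.detectable φ ψ B μ₀).topologicalClosure =
      (Submodule.span ℂ
        ({f : Friedrichs.L2R | ∃ μ : ℂ, 0 < μ.im ∧
            f =ᵐ[volume] fun x : ℝ => 1 / ((x : ℂ) - μ)} ∪
          {f : Friedrichs.L2R | ∃ μ : ℂ, μ.im < 0 ∧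
            f =ᵐ[volume] fun x : ℝ =>
              (Friedrichs.funD φ ψ μ +
                2 * Real.pi * Complex.I * Friedrichs.lowerExt Φ μ * ψ x) /
                  ((x : ℂ) - μ)})).topologicalClosure ∧
    ∀ (N : ℕ) (c z : Fin N → ℂ), (∀ j, c j ≠ 0) → (∀ j, (z j).im < 0) →
      Function.Injective z →
      (ψ =ᵐ[volume] fun x : ℝ => ∑ j, c j / ((x : ℂ) - z j)) →
      (∀ μ : ℂ, MeromorphicAt (Friedrichs.funDPlus Φ c z) μ) ∧
      (∀ μ : ℂ, 0 < μ.im → Friedrichs.funD φ ψ μ = Friedrichs.funDPlus Φ c z μ) ∧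
      ((∀ j, Friedrichs.lowerExt Φ (z j) = 0 →
          ∃ l : ℂ, Tendsto (Friedrichs.degenerateQuotient Φ c z j) (𝓝[≠] (z j)) (𝓝 l)) →
        FiniteDimensional ℂ (Friedrichs.detectable φ ψ B μ₀)ᗮ ∧
        (Module.finrank ℂ (Friedrichs.detectable φ ψ B μ₀)ᗮ : ℤ) =
          (N : ℤ) - Friedrichs.numP Φ c z - Friedrichs.numM φ Φ c z
            - Friedrichs.numMZero Φ c z) := by
  refine ⟨?_, fun N c z hc hz hinj hψz => ⟨Friedrichs.meromorphicAt_funDPlus Φ c z, fun μ hμ =>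
    Friedrichs.funD_eq_funDPlus hφ hz hψz hμ, fun hl => ?_⟩⟩
  · rw [Friedrichs.detectable_closure_eq hφ hψ hB hB' hμ₀, Friedrichs.kerSpan_eq hφ]
  · have hrank := Friedrichs.finrank_orthogonal_detectable hφ hψ hB hB' hμ₀ hc hz hinj hψz hl
    refine ⟨Module.finite_of_rank_eq_nat hrank, ?_⟩
    rw [Module.finrank_eq_of_rank_eq hrank]
    -- The bound `deg Q ≤ N` ensures that the natural number subtraction in the rank does not
    -- truncate.
    have h1 := Friedrichs.natDegree_expoPoly_le (c := c) hφ hz hinj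
    have h2 := Friedrichs.natDegree_expoPoly_eq (c := c) hφ hz hinj
    omega
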